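/- **Conventions.** A generalized quantum circuit consists of gates from $\{\mathrm{CNOT},H,T\}$ on finitely many qubits; designated qubits carry the input, the others start in $|0\rangle$, and all but the designated output qubits are traced out at the end. Its size is the number of gates plus the number of input qubits (including those initialized to zero) plus the number of output qubits (including those traced out). A *QPT algorithm* is a family of circuits, indexed by $\lambda\in\mathbb N$, of size polynomial in $\lambda$; classical outputs are obtained by measuring the output qubits in the computational basis. A *non-uniform QPT adversary* is such a family in which some input qubits are in addition initialized to an arbitrary density matrix $\rho_\lambda$ (quantum advice). A function $\varepsilon:\mathbb N\to\mathbb R$ is negligible if $\lambda^d\varepsilon(\lambda)\to0$ for every $d\in\mathbb N$. "Polynomially bounded" means bounded by a polynomial. **QPRF.** A *selectively secure quantum pseudorandom function* $F:\{0,1\}^\lambda\times\{0,1\}^{m(\lambda)}\to\{0,1\}^{\ell(\lambda)}$ is a QPT algorithm, with classical input $(k,x)$ and randomized classical output $F(k,x)$, such that: * (*Pseudodeterminism*) there are a constant $c>0$ and a function $\mu(\lambda)=O(\lambda^{-c})$ such that for all $\lambda$ and all $x\in\{0,1\}^{m(\lambda)}$ there is a set $\mathcal K_{\lambda,x}\subseteq\{0,1\}^\lambda$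 with $\Pr_{k\gets\{0,1\}^\lambda}[k\in\mathcal K_{\lambda,x}]\ge1-\mu(\lambda)$ and $\max_{y}\Pr[F(k,x)=y]\ge1-\mu(\lambda)$ for all $k\in\mathcal K_{\lambda,x}$; * (*Selective security*) for every polynomially bounded $q:\mathbb N\to\mathbb N$, every non-uniform QPT distinguisher $A$ and every family of inputs $x_1,\dots,x_{q(\lambda)}\in\{0,1\}^{m(\lambda)}$ there is a negligible $\varepsilon$ such that, for every $\lambda$ for which $x_1,\dots,x_{q(\lambda)}$ are pairwise distinct, the probabilities that $A_\lambda(x_1,\dots,x_{q(\lambda)},y_1,\dots,y_{q(\lambda)})=1$ in the following two cases differ by at most $\varepsilon(\lambda)$: (i) $k\gets\{0,1\}^\lambda$ and $y_j\gets F(k,x_j)$ with fresh randomness for each $j$; (ii) $y_1,\dots,y_{q(\lambda)}$ are independent and uniform in $\{0,1\}^{\ell(\lambda)}$. **Construction.** Given such an $F$: * $\mathsf{Gen}(1^\lambda)$ outputs a uniform key $k=k_1\|\cdots\|k_\lambda\in\{0,1\}^{\lambda^2}$ with blocks $k_i\in\{0,1\}^\lambda$. * $\mathsf{Enc}(1^\lambda,k,msg)$,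 for $msg\in\{0,1\}^{\ell(\lambda)}$, picks $r\gets\{0,1\}^{m(\lambda)}$ uniformly, computes $y_i\gets F(k_i,r)$ for $i=1,\dots,\lambda$ and outputs $(r,\,msg\oplus y_1,\dots,msg\oplus y_\lambda)$. * $\mathsf{Dec}(1^\lambda,k,(r,c_1,\dots,c_\lambda))$ computes $y_i'\gets F(k_i,r)$ for $i=1,\dots,\lambda$ afresh and outputs the majority of the strings $c_1\oplus y_1',\dots,c_\lambda\oplus y_\lambda'$, i.e. the string that occurs more than $\lambda/2$ times, or $0^{\ell(\lambda)}$ if there is none. **Theorem.** Let $F:\{0,1\}^\lambda\times\{0,1\}^{m(\lambda)}\to\{0,1\}^{\ell(\lambda)}$ be a selectively secure quantum pseudorandom function with $m(\lambda)=\omega(\log\lambda)$. Then $(\mathsf{Gen},\mathsf{Enc},\mathsf{Dec})$ is a non-adaptive CPA-secure quantum private-key encryption scheme with classical ciphertexts, that is: 1. $\mathsf{Gen}$, $\mathsf{Enc}$ and $\mathsf{Dec}$ are QPT algorithms. 2. (*Correctness*) There is a negligible $\varepsilon$ such that for all $\lambda\in\mathbb N$ and all $msg\in\{0,1\}^{\ell(\lambda)}$,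 $$\Pr\big[\mathsf{Dec}(1^\lambda,k,\mathsf{Enc}(1^\lambda,k,msg))=msg\big]\ge1-\varepsilon(\lambda),$$ where the probability is over $k\gets\mathsf{Gen}(1^\lambda)$ and the randomness of $\mathsf{Enc}$ and $\mathsf{Dec}$. 3. (*Non-adaptive CPA security*) For every polynomially bounded $q:\mathbb N\to\mathbb N$ and every non-uniform QPT adversary $A$ there is a negligible $\varepsilon$ such that for all $\lambda\in\mathbb N$, $|\Pr[b'=b]-\tfrac12|\le\varepsilon(\lambda)$ in the following experiment: the challenger samples $k\gets\mathsf{Gen}(1^\lambda)$ and a uniform bit $b$; $A$ outputs classical message pairs $(m_1^0,m_1^1),\dots,(m_{q(\lambda)}^0,m_{q(\lambda)}^1)$ with all messages in $\{0,1\}^{\ell(\lambda)}$, keeping a quantum memory; $A$ receives $\mathsf{Enc}(1^\lambda,k,m_1^b),\dots,\mathsf{Enc}(1^\lambda,k,m_{q(\lambda)}^b)$; $A$ outputs a bit $b'$. -/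

import Mathlib

open Filter Asymptotics
open scoped ComplexOrder

noncomputable section

namespace QCrypto

/-! ### Bit registers and quantum states -/

/-- Assignments of bits to the positions of a register `I`, i.e. `{0,1}^I`. -/
abbrev Bits (I : Type) : Type := I → Bool

/-- Operators on the Hilbert space `(ℂ²)^{⊗ I}` of a register of qubits labelled by `I`. -/
abbrev Op (I : Type) : Type := Matrix (Bits I) (Bits I) ℂ

/-- Density matrices. -/
structure IsDensity {I : Type} [Fintype I] [DecidableEq I] (ρ : Op I) : Prop where
  posSemidef : ρ.PosSemidef
  trace_eq_one : ρ.trace = 1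

/-- The computational basis state `|x⟩⟨x|`. -/
def ket {I : Type} [Fintype I] (x : Bits I) : Op I :=
  Matrix.single x x 1

/-- The product state `ρ ⊗ σ` on the union of two registers. -/
def tensor {I J : Type} (ρ : Op I) (σ : Op J) : Op (I ⊕ J) :=
  Matrix.of fun u v => ρ (u ∘ Sum.inl) (v ∘ Sum.inl) * σ (u ∘ Sum.inr) (v ∘ Sum.inr)

/-- Probability of outcome `y` when all qubits are measured in the computational basis. -/
def measure {I : Type} (ρ : Op I) (y : Bits I) : ℝ := (ρ y y).re

/-- The unnormalised state of register `J` after register `I` has been measured in the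
computational basis with outcome `x`; its trace is the probability of that outcome. -/
def afterOutcome {I J : Type} (σ : Op (I ⊕ J)) (x : Bits I) : Op J :=
  Matrix.of fun u v => σ (Sum.elim x u) (Sum.elim x v)

/-! ### Generalized quantum circuits over the gate set `{CNOT, H, T}` -/

inductive Gate (W : Type) : Type
  | H (v : W) : Gate W
  | T (v : W) : Gate W
  | CNOT (control target : W) (ne : control ≠ target) : Gate W

/-- The unitary of a gate, acting on all wires `W` (as the identity on the untouched ones). -/
def Gate.unitary {W : Type} [Fintype W] [DecidableEq W] : Gate W → Op W
  | .H v => Matrix.of fun x y =>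
      if ∀ w, w ≠ v → x w = y w then
        (if x v = true ∧ y v = true then -1 else 1) / (Real.sqrt 2 : ℂ)
      else 0
  | .T v => Matrix.diagonal fun x =>
      if x v = true then Complex.exp (Complex.I * Real.pi / 4) else 1
  | .CNOT c t _ => Matrix.of fun x y =>
      if x = Function.update y t (xor (y t) (y c)) then 1 else 0

/-- A generalized quantum circuit with input register `I` and output register `O`. Wires that are
not input wires start in state zero; wires that are not output wires are traced out. -/
structure Circuit (I O : Type) where
  Wire : Type
  [fintypeWire : Fintype Wire]
  [decEqWire : DecidableEq Wire]
  gates : List (Gate Wire)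
  inp : I ↪ Wire
  out : O ↪ Wire

attribute [instance] Circuit.fintypeWire Circuit.decEqWire

namespace Circuit

variable {I O : Type} (C : Circuit I O)

/-- Number of gates, plus number of input qubits (including those initialized to zero), plus
number of output qubits (including those traced out). -/
def size : ℕ := C.gates.length + Fintype.card C.Wire + Fintype.card C.Wire

/-- The unitary part; the head of the list of gates is applied first. -/
def unitary : Op C.Wire := C.gates.foldl (fun U g => g.unitary * U) 1

open Classical in
/-- The input `ρ` placed on the input wires, all other wires being zero. -/
def load (ρ : Op I) : Op C.Wire :=
  Matrix.of fun u v =>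
    if ∀ w, w ∉ Set.range C.inp → u w = false ∧ v w = false then ρ (u ∘ C.inp) (v ∘ C.inp) else 0

open Classical in
/-- The partial trace over the wires that are not output wires. -/
def traceOut (σ : Op C.Wire) : Op O :=
  Matrix.of fun i j => ∑ u : Bits C.Wire, ∑ v : Bits C.Wire,
    if u ∘ C.out = i ∧ v ∘ C.out = j ∧ ∀ w, w ∉ Set.range C.out → u w = v w then σ u v else 0

/-- The quantum channel computed by the circuit. -/
def run (ρ : Op I) : Op O :=
  C.traceOut (C.unitary * C.load ρ * C.unitary.conjTranspose)

/-- Probability that the circuit, run on the classical input `x`, yields the classical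
output `y`. -/
def prob [Fintype I] (x : Bits I) (y : Bits O) : ℝ := measure (C.run (ket x)) y

end Circuit

/-! ### Efficiency and negligibility -/

def PolyBounded (f : ℕ → ℕ) : Prop := ∃ p : Polynomial ℕ, ∀ n, f n ≤ p.eval n

/-- Negligible functions: `n^d * ε n → 0` for every `d`. -/
def Negligible (ε : ℕ → ℝ) : Prop := SuperpolynomialDecay atTop (fun n : ℕ => (n : ℝ)) ε

/-- A randomized function family with classical inputs and outputs (`f n x y` being the probability
of output `y` on input `x`) is a QPT algorithm: it is the input-output behaviour of a family of
circuits of polynomial size. -/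
def IsQPT {I O : ℕ → Type} [∀ n, Fintype (I n)] (f : ∀ n, Bits (I n) → Bits (O n) → ℝ) : Prop :=
  ∃ C : ∀ n, Circuit (I n) (O n), PolyBounded (fun n => (C n).size) ∧
    ∀ n x y, (C n).prob x y = f n x y

/-- The probability of each single element of `{0,1}^I` under the uniform distribution. -/
def unif (I : Type) [Fintype I] : ℝ := ((2 : ℝ) ^ Fintype.card I)⁻¹

/-- Non-uniform QPT algorithms with classical input and one output bit: polynomial-size circuits
with quantum advice. -/
structure Distinguisher (I : ℕ → Type) where
  advLen : ℕ → ℕ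
  circuit : ∀ n, Circuit (Fin (advLen n) ⊕ I n) Unit
  advice : ∀ n, Op (Fin (advLen n))
  polySize : PolyBounded fun n => (circuit n).size
  isDensity : ∀ n, IsDensity (advice n)

/-- Probability that the distinguisher outputs `1` on input `x`. -/
def Distinguisher.accept {I : ℕ → Type} [∀ n, Fintype (I n)] (A : Distinguisher I) (n : ℕ)
    (x : Bits (I n)) : ℝ :=
  measure ((A.circuit n).run (tensor (A.advice n) (ket x))) fun _ => true

/-! ### Selectively secure quantum pseudorandom functions -/

/-- Families of randomized functions `{0,1}^n × {0,1}^{m n} → {0,1}^{ℓ n}`: `F n k x y` is the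
probability that `F(k, x)` outputs `y`. -/
abbrev KeyedFun (m ℓ : ℕ → ℕ) : Type :=
  ∀ n, Bits (Fin n) → Bits (Fin (m n)) → Bits (Fin (ℓ n)) → ℝ

namespace KeyedFun

variable {m ℓ : ℕ → ℕ} (F : KeyedFun m ℓ)

def QPT : Prop :=
  IsQPT (I := fun n => Fin n ⊕ Fin (m n)) (O := fun n => Fin (ℓ n))
    fun n z y => F n (z ∘ Sum.inl) (z ∘ Sum.inr) y

/-- Pseudodeterminism `1 - O(n^{-c})` for some constant `c > 0`. -/
def Pseudodeterministic : Prop :=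
  ∃ c : ℝ, 0 < c ∧ ∃ μ : ℕ → ℝ, (μ =O[atTop] fun n : ℕ => (n : ℝ) ^ (-c)) ∧
    ∀ n, ∀ x : Bits (Fin (m n)), ∃ good : Finset (Bits (Fin n)),
      1 - μ n ≤ good.card * unif (Fin n) ∧
      ∀ k ∈ good, ∃ y : Bits (Fin (ℓ n)), 1 - μ n ≤ F n k x y

variable {q : ℕ → ℕ}

/-- What the distinguisher sees: the list of inputs and the list of outputs. -/
abbrev ViewReg (m ℓ q : ℕ → ℕ) (n : ℕ) : Type :=
  (Fin (q n) × Fin (m n)) ⊕ (Fin (q n) × Fin (ℓ n))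

def view {n : ℕ} (x : Fin (q n) → Bits (Fin (m n))) (y : Fin (q n) → Bits (Fin (ℓ n))) :
    Bits (ViewReg m ℓ q n) :=
  Sum.elim (fun p => x p.1 p.2) (fun p => y p.1 p.2)

/-- Acceptance probability when the outputs come from `F` under one uniform key, each evaluated
with fresh randomness. -/
def realAccept (A : Distinguisher (ViewReg m ℓ q)) (n : ℕ)
    (x : Fin (q n) → Bits (Fin (m n))) : ℝ :=
  ∑ k : Bits (Fin n), unif (Fin n) * ∑ y : Fin (q n) → Bits (Fin (ℓ n)),
    (∏ j, F n k (x j) (y j)) * A.accept n (view x y)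

/-- Acceptance probability when the outputs are independent uniform strings. -/
def idealAccept (A : Distinguisher (ViewReg m ℓ q)) (n : ℕ)
    (x : Fin (q n) → Bits (Fin (m n))) : ℝ :=
  ∑ y : Fin (q n) → Bits (Fin (ℓ n)), (∏ _j : Fin (q n), unif (Fin (ℓ n))) * A.accept n (view x y)

/-- Indistinguishability on every family of pairwise distinct inputs. Distinctness is asked for
each `n` separately, so that the finitely many `n` with `2 ^ m n < q n` do not make the
condition void. -/
def SelectivelySecure : Prop :=
  ∀ q : ℕ → ℕ, PolyBounded q → ∀ A : Distinguisher (ViewReg m ℓ q),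
    ∀ x : ∀ n, Fin (q n) → Bits (Fin (m n)), ∃ ε : ℕ → ℝ, Negligible ε ∧
      ∀ n, Function.Injective (x n) → |F.realAccept A n (x n) - idealAccept A n (x n)| ≤ ε n

/-- Selectively secure quantum pseudorandom functions. -/
structure IsSelectivelySecureQPRF : Prop where
  qpt : F.QPT
  pseudodeterministic : F.Pseudodeterministic
  selectivelySecure : F.SelectivelySecure

end KeyedFun

/-! ### Private-key encryption with classical ciphertexts -/

/-- Input-output behaviour of a triple `(Gen, Enc, Dec)`; keys, messages and ciphertexts for
security parameter `n` are bit strings with positions `K n`, `M n`, `C n`. The values are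
probabilities: `Gen n k` of key `k`, `Enc n k msg c` of ciphertext `c`, `Dec n k c msg` of
decrypting `c` to `msg`. -/
structure Scheme (K M C : ℕ → Type) where
  Gen : ∀ n, Bits (K n) → ℝ
  Enc : ∀ n, Bits (K n) → Bits (M n) → Bits (C n) → ℝ
  Dec : ∀ n, Bits (K n) → Bits (C n) → Bits (M n) → ℝ

/-- Non-uniform QPT adversaries in the non-adaptive CPA experiment with `q n` queries. The first
circuit, run on the advice, produces all message pairs (bit `t` of `m_j^b` is at position
`(j, b, t)`) and a quantum memory; the second one gets all ciphertexts and the memory and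
produces the guess. -/
structure CPAAdversary (q : ℕ → ℕ) (M C : ℕ → Type) where
  advLen : ℕ → ℕ
  memLen : ℕ → ℕ
  choose : ∀ n, Circuit (Fin (advLen n)) ((Fin (q n) × Bool × M n) ⊕ Fin (memLen n))
  guess : ∀ n, Circuit (Fin (memLen n) ⊕ (Fin (q n) × C n)) Unit
  advice : ∀ n, Op (Fin (advLen n))
  choose_polySize : PolyBounded fun n => (choose n).size
  guess_polySize : PolyBounded fun n => (guess n).size
  isDensity : ∀ n, IsDensity (advice n)

namespace Scheme

variable {K M C : ℕ → Type}
  [∀ n, Fintype (K n)] [∀ n, DecidableEq (K n)]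
  [∀ n, Fintype (M n)] [∀ n, DecidableEq (M n)]
  [∀ n, Fintype (C n)] [∀ n, DecidableEq (C n)]

/-- All three algorithms are QPT. -/
def QPT (S : Scheme K M C) : Prop :=
  IsQPT (I := fun _ => Empty) (O := K) (fun n _ k => S.Gen n k) ∧
  IsQPT (I := fun n => K n ⊕ M n) (O := C)
    (fun n z c => S.Enc n (z ∘ Sum.inl) (z ∘ Sum.inr) c) ∧
  IsQPT (I := fun n => K n ⊕ C n) (O := M)
    (fun n z msg => S.Dec n (z ∘ Sum.inl) (z ∘ Sum.inr) msg)

/-- Decryption recovers every message except with negligible probability over `Gen`, `Enc`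
and `Dec`. -/
def Correct (S : Scheme K M C) : Prop :=
  ∃ ε : ℕ → ℝ, Negligible ε ∧ ∀ n, ∀ msg : Bits (M n),
    1 - ε n ≤ ∑ k, S.Gen n k * ∑ c, S.Enc n k msg c * S.Dec n k c msg

/-- Probability that the adversary guesses the challenge bit. -/
def cpaWin (S : Scheme K M C) {q : ℕ → ℕ} (A : CPAAdversary q M C) (n : ℕ) : ℝ :=
  ∑ b : Bool, (1 / 2) * ∑ k : Bits (K n), S.Gen n k *
    ∑ msgs : Bits (Fin (q n) × Bool × M n), ∑ c : Fin (q n) → Bits (C n),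
      (∏ j, S.Enc n k (fun t => msgs (j, b, t)) (c j)) *
        measure ((A.guess n).run
          (tensor (afterOutcome ((A.choose n).run (A.advice n)) msgs)
            (ket fun p => c p.1 p.2))) fun _ => b

/-- Every adversary has negligible advantage in the non-adaptive CPA experiment. -/
def NonAdaptiveCPASecure (S : Scheme K M C) : Prop :=
  ∀ q : ℕ → ℕ, PolyBounded q → ∀ A : CPAAdversary q M C,
    ∃ ε : ℕ → ℝ, Negligible ε ∧ ∀ n, |S.cpaWin A n - 1 / 2| ≤ ε n

/-- Non-adaptive CPA-secure quantum private-key encryption schemes. -/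
structure IsNonAdaptiveCPASecureEncryption (S : Scheme K M C) : Prop where
  qpt : S.QPT
  correct : S.Correct
  secure : S.NonAdaptiveCPASecure

end Scheme

/-! ### The construction -/

/-- Bitwise exclusive or. -/
def xorBits {I : Type} (x y : Bits I) : Bits I := fun i => xor (x i) (y i)

open Classical in
/-- Majority vote: the string that occurs in more than half of the positions, and the all-zero
string if there is none. -/
def majority {n : ℕ} {I : Type} (v : Fin n → Bits I) : Bits I :=
  if h : ∃ w : Bits I, n < 2 * (Finset.univ.filter fun i => v i = w).card then h.choose
  else fun _ => false

/-- Positions of the key: `n` blocks of `n` bits, bit `j` of `k_i` being at `(i, j)`. -/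
abbrev KeyReg (n : ℕ) : Type := Fin n × Fin n

/-- Positions of the ciphertext: the nonce, followed by `n` blocks of the length of the message. -/
abbrev CtReg (m ℓ : ℕ → ℕ) (n : ℕ) : Type := Fin (m n) ⊕ (Fin n × Fin (ℓ n))

/-- The ciphertext `(r, c_1, …, c_n)`. -/
def mkCt {m ℓ : ℕ → ℕ} {n : ℕ} (r : Bits (Fin (m n))) (c : Fin n → Bits (Fin (ℓ n))) :
    Bits (CtReg m ℓ n) :=
  Sum.elim r fun p => c p.1 p.2

/-- The encryption scheme built from `F`. `Gen` outputs a uniform key `k_1, …, k_n`. `Enc` picks a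
uniform nonce `r`, evaluates `y_i ← F(k_i, r)` and outputs `(r, msg ⊕ y_1, …, msg ⊕ y_n)`. `Dec`
evaluates `y_i ← F(k_i, r)` afresh and outputs the majority of the strings `c_i ⊕ y_i`. -/
def ske {m ℓ : ℕ → ℕ} (F : KeyedFun m ℓ) :
    Scheme KeyReg (fun n => Fin (ℓ n)) (CtReg m ℓ) where
  Gen n _ := unif (KeyReg n)
  Enc n k msg c :=
    ∑ r : Bits (Fin (m n)), unif (Fin (m n)) * ∑ y : Fin n → Bits (Fin (ℓ n)),
      (∏ i, F n (fun j => k (i, j)) r (y i)) *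
        if c = mkCt r (fun i => xorBits msg (y i)) then 1 else 0
  Dec n k c msg :=
    ∑ y : Fin n → Bits (Fin (ℓ n)),
      (∏ i, F n (fun j => k (i, j)) (c ∘ Sum.inl) (y i)) *
        if msg = majority (fun i => xorBits (fun t => c (Sum.inr (i, t))) (y i)) then 1 else 0

end QCrypto

end

open Filter Asymptotics
open scoped ComplexOrder

noncomputable section

set_option linter.unusedSectionVars false

namespace QCrypto

/-! ### Operators on sub-registers -/

/-- The unitary of a list of gates, the head being applied first. -/
def gatesUnitary {W : Type} [Fintype W] [DecidableEq W] (gs : List (Gate W)) : Op W :=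
  gs.foldl (fun U g => g.unitary * U) 1

section GatesUnitary

variable {W : Type} [Fintype W] [DecidableEq W]

theorem foldl_gate_mul (gs : List (Gate W)) (A : Op W) :
    gs.foldl (fun U g => g.unitary * U) A = gatesUnitary gs * A := by
  induction gs generalizing A with
  | nil => simp [gatesUnitary]
  | cons g gs ih =>
    simp only [gatesUnitary, List.foldl_cons]
    rw [ih, ih (g.unitary * 1)]
    simp [Matrix.mul_assoc]

@[simp] theorem gatesUnitary_nil : gatesUnitary ([] : List (Gate W)) = 1 := rfl

theorem gatesUnitary_cons (g : Gate W) (gs : List (Gate W)) :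
    gatesUnitary (g :: gs) = gatesUnitary gs * g.unitary := by
  conv_lhs => rw [gatesUnitary, List.foldl_cons, foldl_gate_mul, Matrix.mul_one]

theorem gatesUnitary_append (gs hs : List (Gate W)) :
    gatesUnitary (gs ++ hs) = gatesUnitary hs * gatesUnitary gs := by
  induction gs with
  | nil => simp
  | cons g gs ih => rw [List.cons_append, gatesUnitary_cons, ih, gatesUnitary_cons, Matrix.mul_assoc]

theorem Circuit.unitary_eq {I O : Type} (C : Circuit I O) : C.unitary = gatesUnitary C.gates := rfl

end GatesUnitary

/-- `u` and `v` agree on the wires outside the range of `f`. -/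
def AgreeOff {V W : Type} (f : V ↪ W) (u v : Bits W) : Prop :=
  ∀ w, w ∉ Set.range f → u w = v w

theorem AgreeOff.trans {V W : Type} {f : V ↪ W} {u v w : Bits W} (h : AgreeOff f u v)
    (h' : AgreeOff f v w) : AgreeOff f u w := fun a ha => (h a ha).trans (h' a ha)

theorem AgreeOff.symm {V W : Type} {f : V ↪ W} {u v : Bits W} (h : AgreeOff f u v) :
    AgreeOff f v u := fun a ha => (h a ha).symm

theorem extend_comp {V W : Type} (f : V ↪ W) (z : Bits V) (v : Bits W) :
    Function.extend f z v ∘ f = z := by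
  funext a
  exact f.injective.extend_apply _ _ _

theorem agreeOff_extend {V W : Type} (f : V ↪ W) (z : Bits V) (v : Bits W) :
    AgreeOff f (Function.extend f z v) v := fun w hw =>
  Function.extend_apply' _ _ _ (by simpa using hw)

theorem eq_extend_iff {V W : Type} (f : V ↪ W) (z : Bits V) (u v : Bits W) :
    u = Function.extend f z v ↔ u ∘ f = z ∧ AgreeOff f u v := by
  constructor
  · rintro rfl
    exact ⟨extend_comp f z v, agreeOff_extend f z v⟩
  · rintro ⟨rfl, h⟩
    funext w
    by_cases hw : w ∈ Set.range f
    · obtain ⟨a, rfl⟩ := hw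
      simp [f.injective.extend_apply]
    · rw [h w hw, Function.extend_apply' _ _ _ (by simpa using hw)]

open Classical in
theorem sum_agreeOff {V W : Type} [Fintype V] [DecidableEq V] [Fintype W] [DecidableEq W] {R : Type*}
    [AddCommMonoid R] (f : V ↪ W) (v : Bits W) (g : Bits W → R) :
    ∑ w : Bits W, (if AgreeOff f w v then g w else 0)
      = ∑ z : Bits V, g (Function.extend f z v) := by
  rw [← Finset.sum_filter]
  refine Finset.sum_nbij' (fun w => w ∘ f) (fun z => Function.extend f z v) ?_ ?_ ?_ ?_ ?_
  · simp
  · intro z _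
    simpa using agreeOff_extend f z v
  · intro w hw
    exact ((eq_extend_iff f _ w v).2 ⟨rfl, by simpa using hw⟩).symm
  · intro z _
    exact extend_comp f z v
  · intro w hw
    rw [← (eq_extend_iff f _ w v).2 ⟨rfl, by simpa using hw⟩]

open Classical in
/-- The operator `A` acting on the wires in the range of `f`, as the identity on the others. -/
def extendOp {V W : Type} (f : V ↪ W) (A : Op V) : Op W :=
  Matrix.of fun u v => if AgreeOff f u v then A (u ∘ f) (v ∘ f) else 0

section ExtendOp

variable {V W : Type} [Fintype V] [DecidableEq V] [Fintype W] [DecidableEq W] (f : V ↪ W)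

theorem extendOp_mul (A B : Op V) : extendOp f (A * B) = extendOp f A * extendOp f B := by
  classical
  ext u v
  simp only [extendOp, Matrix.of_apply, Matrix.mul_apply]
  by_cases h : AgreeOff f u v
  · rw [if_pos h]
    have : ∀ w : Bits W, (if AgreeOff f u w then A (u ∘ f) (w ∘ f) else 0) *
        (if AgreeOff f w v then B (w ∘ f) (v ∘ f) else 0)
        = if AgreeOff f w v then A (u ∘ f) (w ∘ f) * B (w ∘ f) (v ∘ f) else 0 := by
      intro w
      by_cases hw : AgreeOff f w v
      · simp [hw, h.trans hw.symm]
      · simp [hw]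
    simp_rw [this]
    rw [sum_agreeOff f v (fun w => A (u ∘ f) (w ∘ f) * B (w ∘ f) (v ∘ f))]
    simp_rw [extend_comp]
  · rw [if_neg h, Finset.sum_eq_zero]
    intro w _
    by_cases hw : AgreeOff f w v
    · rw [if_neg (fun h' : AgreeOff f u w => h (h'.trans hw)), zero_mul]
    · rw [if_neg hw, mul_zero]

theorem extendOp_one : extendOp f (1 : Op V) = 1 := by
  classical
  ext u v
  simp only [extendOp, Matrix.of_apply, Matrix.one_apply]
  by_cases h : u = v
  · subst h
    simp [AgreeOff]
  · rw [if_neg h]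
    split_ifs with h1 h2
    · exact absurd (((eq_extend_iff f _ u v).2 ⟨h2, h1⟩).trans
        ((eq_extend_iff f _ v v).2 ⟨rfl, fun _ _ => rfl⟩).symm) h
    · rfl
    · rfl

theorem extendOp_conjTranspose (A : Op V) :
    (extendOp f A).conjTranspose = extendOp f A.conjTranspose := by
  classical
  ext u v
  simp only [extendOp, Matrix.of_apply, Matrix.conjTranspose_apply]
  by_cases h : AgreeOff f u v
  · rw [if_pos h, if_pos h.symm]
  · rw [if_neg h, if_neg (fun h' => h h'.symm), star_zero]

end ExtendOp

/-- Relabelling of the wires of a gate. -/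
def Gate.map {V W : Type} (f : V ↪ W) : Gate V → Gate W
  | .H v => .H (f v)
  | .T v => .T (f v)
  | .CNOT c t h => .CNOT (f c) (f t) (fun e => h (f.injective e))

section Map

variable {V W : Type} [Fintype V] [DecidableEq V] [Fintype W] [DecidableEq W] (f : V ↪ W)

theorem Gate.unitary_map (g : Gate V) : (g.map f).unitary = extendOp f g.unitary := by
  classical
  ext u v
  cases g with
  | H a =>
    simp only [Gate.map, Gate.unitary, extendOp, Matrix.of_apply, Function.comp]
    have : (∀ w, w ≠ f a → u w = v w) ↔ AgreeOff f u v ∧ ∀ b, b ≠ a → u (f b) = v (f b) := by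
      constructor
      · intro h
        exact ⟨fun w hw => h w (by rintro rfl; exact hw ⟨a, rfl⟩),
          fun b hb => h _ (fun e => hb (f.injective e))⟩
      · rintro ⟨h1, h2⟩ w hw
        by_cases hr : w ∈ Set.range f
        · obtain ⟨b, rfl⟩ := hr
          exact h2 b (fun e => hw (e ▸ rfl))
        · exact h1 w hr
    by_cases h1 : AgreeOff f u v <;> simp [this, h1]
  | T a =>
    simp only [Gate.map, Gate.unitary, extendOp, Matrix.of_apply, Matrix.diagonal_apply]
    by_cases h : u = v
    · subst h
      simp [AgreeOff]
    · rw [if_neg h]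
      split_ifs with h1 h2 <;> first | rfl | skip
      all_goals
        exact absurd (((eq_extend_iff f _ u v).2 ⟨h2, h1⟩).trans
          ((eq_extend_iff f _ v v).2 ⟨rfl, fun _ _ => rfl⟩).symm) h
  | CNOT c t hct =>
    simp only [Gate.map, Gate.unitary, extendOp, Matrix.of_apply]
    have : u = Function.update v (f t) (xor (v (f t)) (v (f c))) ↔
        u ∘ f = Function.update (v ∘ f) t (xor ((v ∘ f) t) ((v ∘ f) c)) ∧ AgreeOff f u v := by
      rw [← eq_extend_iff]
      have e : Function.update v (f t) (xor (v (f t)) (v (f c))) =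
          Function.extend f (Function.update (v ∘ f) t (xor ((v ∘ f) t) ((v ∘ f) c))) v := by
        rw [eq_extend_iff]
        constructor
        · rw [Function.update_comp_eq_of_injective _ f.injective]
          rfl
        · intro w hw
          rw [Function.update_of_ne]
          rintro rfl
          exact hw ⟨t, rfl⟩
      rw [e]
    by_cases h1 : AgreeOff f u v <;> simp [this, h1]

theorem gatesUnitary_map (gs : List (Gate V)) :
    gatesUnitary (gs.map (Gate.map f)) = extendOp f (gatesUnitary gs) := by
  induction gs with
  | nil => simp [extendOp_one]
  | cons g gs ih =>
    rw [List.map_cons, gatesUnitary_cons, gatesUnitary_cons, ih, Gate.unitary_map, extendOp_mul]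

end Map

/-! ### Gates are unitary -/

theorem exp_quarter_pow_four : Complex.exp (Complex.I * Real.pi / 4) ^ 4 = -1 := by
  rw [← Complex.exp_nat_mul, ← Complex.exp_pi_mul_I]
  congr 1
  push_cast
  ring

theorem exp_quarter_star_mul :
    (starRingEnd ℂ) (Complex.exp (Complex.I * Real.pi / 4)) * Complex.exp (Complex.I * Real.pi / 4)
      = 1 := by
  rw [← Complex.exp_conj, ← Complex.exp_add]
  have : (starRingEnd ℂ) (Complex.I * Real.pi / 4) + Complex.I * Real.pi / 4 = 0 := by
    rw [map_div₀, map_mul, Complex.conj_I, Complex.conj_ofReal, Complex.conj_ofNat]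
    ring
  rw [this, Complex.exp_zero]

theorem inv_sqrt_two_mul_self : ((Real.sqrt 2 : ℂ))⁻¹ * ((Real.sqrt 2 : ℂ))⁻¹ = 1 / 2 := by
  rw [← mul_inv, ← Complex.ofReal_mul, Real.mul_self_sqrt (by norm_num)]
  norm_num

theorem sum_bits_unit {R : Type*} [AddCommMonoid R] (g : Bits Unit → R) :
    ∑ z : Bits Unit, g z = g (fun _ => true) + g (fun _ => false) := by
  rw [Fintype.sum_equiv (Equiv.funUnique Unit Bool) g (fun b => g (fun _ => b))]
  · simp
  · intro x
    rfl

section Unitary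

variable {W : Type} [Fintype W] [DecidableEq W]

theorem update_xor_involutive {c t : W} (h : c ≠ t) (y : Bits W) :
    Function.update (Function.update y t (xor (y t) (y c))) t
      (xor ((Function.update y t (xor (y t) (y c))) t) ((Function.update y t (xor (y t) (y c))) c))
      = y := by
  funext w
  by_cases hw : w = t
  · subst hw
    simp [h]
  · simp [hw]

theorem Gate.unitary_H_unit_star_mul :
    (Gate.H () : Gate Unit).unitary.conjTranspose * (Gate.H () : Gate Unit).unitary = 1 := by
  have h2 := inv_sqrt_two_mul_self
  have hb : ∀ u : Bits Unit, u = (fun _ => true) ∨ u = (fun _ => false) := by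
    intro u
    cases h : u ()
    · exact Or.inr (funext fun _ => h)
    · exact Or.inl (funext fun _ => h)
  have hne : (fun _ : Unit => true) ≠ fun _ => false := fun e => by simpa using congrFun e ()
  ext u v
  rw [Matrix.mul_apply, sum_bits_unit]
  rcases hb u with rfl | rfl <;> rcases hb v with rfl | rfl <;>
    simp [Gate.unitary, hne, hne.symm, div_eq_mul_inv, h2] <;> norm_num

theorem Gate.unitary_star_mul (g : Gate W) : g.unitary.conjTranspose * g.unitary = 1 := by
  cases g with
  | H v =>
    have : (Gate.H v) = (Gate.H () : Gate Unit).map ⟨fun _ => v, fun _ _ _ => rfl⟩ := rfl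
    rw [this, Gate.unitary_map, extendOp_conjTranspose, ← extendOp_mul,
      Gate.unitary_H_unit_star_mul, extendOp_one]
  | T v =>
    simp only [Gate.unitary, Matrix.diagonal_conjTranspose, Matrix.diagonal_mul_diagonal]
    rw [← Matrix.diagonal_one]
    congr 1
    funext u
    by_cases h : u v = true
    · simpa [h] using exp_quarter_star_mul
    · simp [h]
  | CNOT c t hct =>
    ext u v
    have key : ∀ a b : Bits W, a = Function.update b t (xor (b t) (b c)) ↔
        b = Function.update a t (xor (a t) (a c)) := by
      intro a b
      constructor
      · rintro rfl
        exact (update_xor_involutive hct b).symm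
      · rintro rfl
        exact (update_xor_involutive hct a).symm
    simp only [Gate.unitary, Matrix.mul_apply, Matrix.conjTranspose_apply, Matrix.of_apply,
      Matrix.one_apply]
    rw [Finset.sum_eq_single (Function.update v t (xor (v t) (v c)))]
    · simp only [if_true, mul_one, key _ u, update_xor_involutive hct v]
      by_cases h : u = v
      · simp [h]
      · simp [h]
    · intro b _ hb
      simp [hb]
    · simp

theorem gatesUnitary_star_mul (gs : List (Gate W)) :
    (gatesUnitary gs).conjTranspose * gatesUnitary gs = 1 := by
  induction gs with
  | nil => simp
  | cons g gs ih =>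
    rw [gatesUnitary_cons, Matrix.conjTranspose_mul, Matrix.mul_assoc,
      ← Matrix.mul_assoc _ (gatesUnitary gs), ih, Matrix.one_mul, Gate.unitary_star_mul]

end Unitary

/-! ### Output probabilities of a circuit -/

namespace Circuit

variable {I O : Type} (C : Circuit I O)

/-- The initial assignment of the wires on a classical input. -/
def init (x : Bits I) : Bits C.Wire := Function.extend C.inp x fun _ => false

theorem eq_init_iff (u : Bits C.Wire) (x : Bits I) :
    u = C.init x ↔ u ∘ C.inp = x ∧ ∀ w, w ∉ Set.range C.inp → u w = false :=
  eq_extend_iff C.inp x u _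

theorem load_ket [Fintype I] (x : Bits I) :
    C.load (ket x) = Matrix.single (C.init x) (C.init x) 1 := by
  classical
  ext u v
  simp only [load, ket, Matrix.of_apply, Matrix.single_apply]
  simp only [eq_comm (a := C.init x), eq_init_iff, eq_comm (a := x)]
  by_cases h : (∀ w, w ∉ Set.range C.inp → u w = false ∧ v w = false)
  · have h1 : ∀ w, w ∉ Set.range C.inp → u w = false := fun w hw => (h w hw).1
    have h2 : ∀ w, w ∉ Set.range C.inp → v w = false := fun w hw => (h w hw).2
    rw [if_pos h]
    refine if_congr ?_ rfl rfl
    exact ⟨fun e => ⟨⟨e.1, h1⟩, e.2, h2⟩, fun e => ⟨e.1.1, e.2.1⟩⟩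
  · rw [if_neg h, if_neg]
    rintro ⟨⟨-, h1⟩, -, h2⟩
    exact h fun w hw => ⟨h1 w hw, h2 w hw⟩

theorem traceOut_diag (σ : Op C.Wire) (y : Bits O) :
    C.traceOut σ y y = ∑ u : Bits C.Wire, open Classical in if u ∘ C.out = y then σ u u else 0 := by
  classical
  simp only [traceOut, Matrix.of_apply]
  refine Finset.sum_congr rfl fun u _ => ?_
  rw [Finset.sum_eq_single u]
  · simp
  · intro v _ hv
    rw [if_neg]
    rintro ⟨h1, h2, h3⟩
    have e : u = Function.extend C.out y v := (eq_extend_iff C.out y u v).2 ⟨h1, h3⟩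
    have e' : v = Function.extend C.out y v := (eq_extend_iff C.out y v v).2 ⟨h2, fun _ _ => rfl⟩
    exact hv (e'.trans e.symm)
  · simp

theorem prob_eq [Fintype I] [DecidableEq (Bits O)] (x : Bits I) (y : Bits O) :
    C.prob x y = ∑ u : Bits C.Wire,
      if u ∘ C.out = y then Complex.normSq (gatesUnitary C.gates u (C.init x)) else 0 := by
  rw [prob, measure, run, traceOut_diag, Complex.re_sum]
  refine Finset.sum_congr rfl fun u _ => ?_
  split_ifs
  · rw [load_ket, unitary_eq, Matrix.mul_apply, Finset.sum_eq_single (C.init x)]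
    · rw [Matrix.mul_single_apply_same, Matrix.conjTranspose_apply, mul_one]
      simp [Complex.mul_conj]
    · intro v _ hv
      rw [Matrix.mul_single_apply_of_ne _ _ _ _ _ hv, zero_mul]
    · simp
  · rfl

theorem prob_nonneg [Fintype I] (x : Bits I) (y : Bits O) : 0 ≤ C.prob x y := by
  classical
  rw [prob_eq]
  refine Finset.sum_nonneg fun u _ => ?_
  split_ifs
  · exact Complex.normSq_nonneg _
  · exact le_rfl

theorem sum_prob [Fintype I] [Fintype O] [DecidableEq O] (x : Bits I) :
    ∑ y, C.prob x y = 1 := by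
  classical
  simp_rw [prob_eq]
  rw [Finset.sum_comm]
  have hs : ∀ u : Bits C.Wire, ∑ y : Bits O,
      (if u ∘ C.out = y then Complex.normSq (gatesUnitary C.gates u (C.init x)) else 0)
        = Complex.normSq (gatesUnitary C.gates u (C.init x)) := by
    intro u
    rw [Finset.sum_eq_single (u ∘ C.out)]
    · rw [if_pos rfl]
    · intro y _ hy
      rw [if_neg hy.symm]
    · simp
  rw [Finset.sum_congr rfl fun u _ => hs u]
  have h := congrFun (congrFun (gatesUnitary_star_mul C.gates) (C.init x)) (C.init x)
  rw [Matrix.mul_apply, Matrix.one_apply_eq] at h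
  have h' := congrArg Complex.re h
  rw [Complex.re_sum] at h'
  rw [← Complex.one_re, ← h']
  refine Finset.sum_congr rfl fun u _ => ?_
  rw [Matrix.conjTranspose_apply, mul_comm]
  simp [Complex.mul_conj]

end Circuit

/-! ### Gate lists acting on basis states -/

section Maps

variable {W : Type} [Fintype W] [DecidableEq W]

/-- The gates send the basis state `u` to `φ` times the basis state `u'`. -/
def Maps (gs : List (Gate W)) (φ : ℂ) (u u' : Bits W) : Prop :=
  ∀ v, gatesUnitary gs v u = if v = u' then φ else 0

theorem Maps.nil (u : Bits W) : Maps [] 1 u u := fun v => by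
  simp [Matrix.one_apply]

theorem Maps.append {gs hs : List (Gate W)} {φ ψ : ℂ} {u u' u'' : Bits W} (h : Maps gs φ u u')
    (h' : Maps hs ψ u' u'') : Maps (gs ++ hs) (φ * ψ) u u'' := fun v => by
  rw [gatesUnitary_append, Matrix.mul_apply, Finset.sum_eq_single u']
  · rw [h, h', if_pos rfl]
    split_ifs
    · ring
    · simp
  · intro w _ hw
    rw [h, if_neg hw, mul_zero]
  · simp

theorem Maps.append_one {gs hs : List (Gate W)} {u u' u'' : Bits W} (h : Maps gs 1 u u')
    (h' : Maps hs 1 u' u'') : Maps (gs ++ hs) 1 u u'' := by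
  simpa using h.append h'

theorem gatesUnitary_singleton (g : Gate W) : gatesUnitary [g] = g.unitary := by
  simp [gatesUnitary_cons]

theorem maps_CNOT (c t : W) (h : c ≠ t) (u : Bits W) :
    Maps [.CNOT c t h] 1 u (Function.update u t (xor (u t) (u c))) := fun v => by
  rw [gatesUnitary_singleton]
  rfl

theorem maps_T_pow (t : W) (k : ℕ) (u : Bits W) :
    Maps (List.replicate k (.T t))
      (if u t = true then Complex.exp (Complex.I * Real.pi / 4) ^ k else 1) u u := by
  induction k with
  | zero => simpa using Maps.nil u
  | succ k ih =>
    have h1 : Maps [Gate.T t]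
        (if u t = true then Complex.exp (Complex.I * Real.pi / 4) else 1) u u := fun v => by
      rw [gatesUnitary_singleton, Gate.unitary, Matrix.diagonal_apply]
      by_cases h : v = u
      · subst h; simp
      · simp [h]
    have h2 := ih.append h1
    rw [List.replicate_succ']
    split_ifs at h2 ⊢
    · rwa [pow_succ]
    · simpa using h2

/-- Gates for the doubly controlled phase flip. -/
def cczGates (a b t : W) (hab : a ≠ b) (hat : a ≠ t) (hbt : b ≠ t) : List (Gate W) :=
  List.replicate 1 (Gate.T a) ++ List.replicate 1 (Gate.T b) ++ List.replicate 1 (Gate.T t) ++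
  [Gate.CNOT a b hab] ++ List.replicate 7 (Gate.T b) ++ [Gate.CNOT b t hbt] ++ List.replicate 1 (Gate.T t) ++
  [Gate.CNOT a b hab] ++ [Gate.CNOT b t hbt] ++ List.replicate 7 (Gate.T t) ++ [Gate.CNOT a t hat] ++
  [Gate.CNOT b t hbt] ++ List.replicate 7 (Gate.T t) ++ [Gate.CNOT b t hbt]

theorem maps_ccz (a b t : W) (hab : a ≠ b) (hat : a ≠ t) (hbt : b ≠ t) (u : Bits W) :
    Maps (cczGates a b t hab hat hbt) (if (u t && (u a && u b)) = true then -1 else 1) u u := by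
  set S : Bool → Bool → Bits W := fun x y => Function.update (Function.update u b x) t y with hS
  set ω : ℂ := Complex.exp (Complex.I * Real.pi / 4) with hω
  have Sa : ∀ x y, S x y a = u a := fun x y => by simp [hS, hab, hat]
  have Sb : ∀ x y, S x y b = x := fun x y => by simp [hS, hbt]
  have St : ∀ x y, S x y t = y := fun x y => by simp [hS]
  have ub : ∀ x y z, Function.update (S x y) b z = S z y := fun x y z => by
    simp only [hS]
    rw [Function.update_comm hbt.symm, Function.update_idem]
  have ut : ∀ x y z, Function.update (S x y) t z = S x z := fun x y z => by
    simp only [hS, Function.update_idem]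
  have hu : S (u b) (u t) = u := by simp [hS]
  have Ta : ∀ k x y, Maps (List.replicate k (.T a)) (if u a = true then ω ^ k else 1)
      (S x y) (S x y) := fun k x y => by simpa [Sa] using maps_T_pow a k (S x y)
  have Tb : ∀ k x y, Maps (List.replicate k (.T b)) (if x = true then ω ^ k else 1)
      (S x y) (S x y) := fun k x y => by simpa [Sb] using maps_T_pow b k (S x y)
  have Tt : ∀ k x y, Maps (List.replicate k (.T t)) (if y = true then ω ^ k else 1)
      (S x y) (S x y) := fun k x y => by simpa [St] using maps_T_pow t k (S x y)
  have Cab : ∀ x y, Maps [.CNOT a b hab] 1 (S x y) (S (xor x (u a)) y) := fun x y => by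
    simpa [Sa, Sb, ub] using maps_CNOT a b hab (S x y)
  have Cat : ∀ x y, Maps [.CNOT a t hat] 1 (S x y) (S x (xor y (u a))) := fun x y => by
    simpa [Sa, St, ut] using maps_CNOT a t hat (S x y)
  have Cbt : ∀ x y, Maps [.CNOT b t hbt] 1 (S x y) (S x (xor y x)) := fun x y => by
    simpa [Sb, St, ut] using maps_CNOT b t hbt (S x y)
  clear_value S
  have h := (Ta 1 (u b) (u t)).append (Tb 1 _ _)
  replace h := h.append (Tt 1 _ _)
  replace h := h.append (Cab _ _)
  replace h := h.append (Tb 7 _ _)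
  replace h := h.append (Cbt _ _)
  replace h := h.append (Tt 1 _ _)
  replace h := h.append (Cab _ _)
  replace h := h.append (Cbt _ _)
  replace h := h.append (Tt 7 _ _)
  replace h := h.append (Cat _ _)
  replace h := h.append (Cbt _ _)
  replace h := h.append (Tt 7 _ _)
  replace h := h.append (Cbt _ _)
  have hst : S (((u b).xor (u a)).xor (u a)) ((((((u t).xor ((u b).xor (u a))).xor
      (((u b).xor (u a)).xor (u a))).xor (u a)).xor (((u b).xor (u a)).xor (u a))).xor
      (((u b).xor (u a)).xor (u a))) = u := by
    rw [← hu, Sa, Sb, St]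
    congr 1
    · cases u a <;> cases u b <;> rfl
    · cases u a <;> cases u b <;> cases u t <;> rfl
  rw [hu, hst] at h
  unfold cczGates
  have h4 : ω ^ 4 = -1 := exp_quarter_pow_four
  have h7 : ω ^ 7 = -ω ^ 3 := by linear_combination ω ^ 3 * h4
  clear_value ω
  convert h using 1
  cases u a <;> cases u b <;> cases u t <;> simp [h7] <;>
    first
    | linear_combination h4
    | linear_combination -h4
    | linear_combination (1 - ω ^ 4) * h4

/-- A phase flip controlled on `t` and on a predicate of the other wires becomes a bit flip of `t`
when conjugated by Hadamard gates. -/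
theorem maps_hadamard_conj (t : W) (p : Bits W → Bool)
    (hp : ∀ u c, p (Function.update u t c) = p u) (gs : List (Gate W))
    (hgs : ∀ u, Maps gs (if (u t && p u) = true then -1 else 1) u u) (u : Bits W) :
    Maps ([.H t] ++ gs ++ [.H t]) 1 u (Function.update u t (xor (u t) (p u))) := by
  classical
  intro v
  have h2 := inv_sqrt_two_mul_self
  let f : Unit ↪ W := ⟨fun _ => t, fun _ _ _ => rfl⟩
  have hext : ∀ z : Bits Unit, Function.extend f z u = Function.update u t (z ()) := by
    intro z
    symm
    rw [eq_extend_iff]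
    constructor
    · funext a
      change Function.update u t (z ()) t = z a
      rw [Function.update_self]
    · intro w hw
      rw [Function.update_of_ne]
      rintro rfl
      exact hw ⟨(), rfl⟩
  have hagree : ∀ a b : Bits W, (∀ w, w ≠ t → a w = b w) ↔ AgreeOff f a b := by
    intro a b
    refine forall_congr' fun w => imp_congr (not_congr ?_) Iff.rfl
    exact ⟨fun h => ⟨(), h.symm⟩, fun ⟨_, h⟩ => h.symm⟩
  have hG : gatesUnitary gs = Matrix.diagonal fun u => if (u t && p u) = true then -1 else 1 := by
    ext a b
    rw [hgs b a, Matrix.diagonal_apply]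
    by_cases h : a = b
    · subst h; simp
    · simp [h]
  rw [gatesUnitary_append, gatesUnitary_append, gatesUnitary_singleton, hG, Matrix.mul_apply]
  simp_rw [Matrix.diagonal_mul]
  have step : ∀ w : Bits W, (Gate.H t).unitary v w *
      ((if (w t && p w) = true then -1 else 1) * (Gate.H t).unitary w u) =
      if AgreeOff f w u then (Gate.H t).unitary v w *
        ((if (w t && p w) = true then -1 else 1) *
          ((if w t = true ∧ u t = true then -1 else 1) / (Real.sqrt 2 : ℂ))) else 0 := by
    intro w
    by_cases h : AgreeOff f w u
    · rw [if_pos h]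
      congr 2
      simp only [Gate.unitary, Matrix.of_apply]
      rw [if_pos ((hagree _ _).2 h)]
    · rw [if_neg h]
      have : (Gate.H t).unitary w u = 0 := by
        simp only [Gate.unitary, Matrix.of_apply]
        rw [if_neg (fun h' => h ((hagree _ _).1 h'))]
      rw [this]
      simp
  rw [Finset.sum_congr rfl fun w _ => step w, sum_agreeOff f u, sum_bits_unit, hext, hext]
  simp only [hp, Function.update_self, Gate.unitary, Matrix.of_apply]
  by_cases hv : AgreeOff f v u
  · have hv' : v = Function.update u t (v t) := by
      rw [← hext (fun _ => v t), eq_extend_iff]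
      exact ⟨rfl, hv⟩
    have hc : ∀ c : Bool, ∀ w, w ≠ t → v w = Function.update u t c w := by
      intro c w hw
      rw [Function.update_of_ne hw]
      exact (hagree _ _).2 hv w hw
    have hiff : v = Function.update u t (xor (u t) (p u)) ↔ v t = xor (u t) (p u) := by
      constructor
      · intro h
        rw [h, Function.update_self]
      · intro h
        rw [← h]
        exact hv'
    rw [if_pos (hc true), if_pos (hc false)]
    simp only [hiff]
    cases v t <;> cases u t <;> cases p u <;> simp [div_eq_mul_inv, h2] <;> norm_num
  · have hc : ∀ c : Bool, ¬ ∀ w, w ≠ t → v w = Function.update u t c w := by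
      intro c h
      apply hv
      rw [← hagree]
      intro w hw
      rw [h w hw, Function.update_of_ne hw]
    have hv' : v ≠ Function.update u t (xor (u t) (p u)) := fun h =>
      hc _ fun w _ => congrFun h w
    rw [if_neg (hc true), if_neg (hc false), if_neg hv']
    simp

/-- Gates for a bit flip. -/
def notGates (t : W) : List (Gate W) := [.H t] ++ List.replicate 4 (.T t) ++ [.H t]

theorem maps_not (t : W) (u : Bits W) : Maps (notGates t) 1 u (Function.update u t (!u t)) := by
  have h := maps_hadamard_conj t (fun _ => true) (fun _ _ => rfl) (List.replicate 4 (.T t))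
    (fun u => by
      have h := maps_T_pow t 4 u
      rw [exp_quarter_pow_four] at h
      simpa using h) u
  simpa [notGates] using h

/-- Gates for the Toffoli gate. -/
def toffoliGates (a b t : W) (hab : a ≠ b) (hat : a ≠ t) (hbt : b ≠ t) : List (Gate W) :=
  [.H t] ++ cczGates a b t hab hat hbt ++ [.H t]

theorem maps_toffoli (a b t : W) (hab : a ≠ b) (hat : a ≠ t) (hbt : b ≠ t) (u : Bits W) :
    Maps (toffoliGates a b t hab hat hbt) 1 u (Function.update u t (xor (u t) (u a && u b))) :=
  maps_hadamard_conj t (fun u => u a && u b) (fun u c => by simp [hat, hbt])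
    (cczGates a b t hab hat hbt) (maps_ccz a b t hab hat hbt) u

end Maps

theorem sum_bits_sum {A B : Type} [Fintype A] [DecidableEq A] [Fintype B] [DecidableEq B]
    {R : Type*} [AddCommMonoid R] (g : Bits (A ⊕ B) → R) :
    ∑ w : Bits (A ⊕ B), g w = ∑ u : Bits A, ∑ v : Bits B, g (Sum.elim u v) := by
  rw [← Fintype.sum_prod_type']
  exact Fintype.sum_equiv (Equiv.sumArrowEquivProdArrow A B Bool) _ _ fun w => by
    simp [Equiv.sumArrowEquivProdArrow]

theorem sum_bits_prod {A B : Type} [Fintype A] [DecidableEq A] [Fintype B] [DecidableEq B]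
    {R : Type*} [AddCommMonoid R] (g : Bits (A × B) → R) :
    ∑ w : Bits (A × B), g w = ∑ u : A → Bits B, g fun p => u p.1 p.2 :=
  Fintype.sum_equiv (Equiv.curry A B Bool) _ _ fun _ => rfl

/-! ### Sequential composition -/

namespace Circuit

theorem prob_mk {I O W : Type} [Fintype I] [DecidableEq (Bits O)] [Fintype W] [DecidableEq W]
    (gs : List (Gate W)) (inp : I ↪ W) (out : O ↪ W) (x : Bits I) (y : Bits O) :
    (Circuit.mk W gs inp out).prob x y = ∑ u : Bits W,
      if u ∘ out = y then
        Complex.normSq (gatesUnitary gs u (Function.extend inp x fun _ => false)) else 0 :=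
  prob_eq _ _ _

section Seq

variable {I J O : Type} [Fintype J] (A : Circuit I J) (B : Circuit J O)

/-- The gate copying the output bit `j` of `A` to the input wire `j` of `B`. -/
def copyGate (j : J) : Gate (A.Wire ⊕ B.Wire) :=
  .CNOT (Sum.inl (A.out j)) (Sum.inr (B.inp j)) Sum.inl_ne_inr

/-- The gates of the sequential composition. -/
def seqGates : List (Gate (A.Wire ⊕ B.Wire)) :=
  A.gates.map (Gate.map .inl) ++ Finset.univ.toList.map (copyGate A B) ++
    B.gates.map (Gate.map .inr)

/-- Run `A`, measure its output and run `B` on the outcome. -/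
def seq : Circuit I O where
  Wire := A.Wire ⊕ B.Wire
  gates := seqGates A B
  inp := A.inp.trans .inl
  out := B.out.trans .inr

theorem maps_copyGates (js : List J) (hjs : js.Nodup) (u : Bits A.Wire) (v : Bits B.Wire)
    (h0 : ∀ j ∈ js, v (B.inp j) = false)
    (h1 : ∀ w, (∀ j ∈ js, B.inp j ≠ w) → v w = B.init (u ∘ A.out) w) :
    Maps (js.map (copyGate A B)) 1 (Sum.elim u v) (Sum.elim u (B.init (u ∘ A.out))) := by
  induction js generalizing v with
  | nil =>
    have : v = B.init (u ∘ A.out) := funext fun w => h1 w (by simp)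
    rw [this]
    exact Maps.nil _
  | cons j js ih =>
    rw [List.nodup_cons] at hjs
    rw [List.map_cons, ← List.singleton_append]
    have hB : ∀ j, B.init (u ∘ A.out) (B.inp j) = u (A.out j) := fun j =>
      B.inp.injective.extend_apply _ _ _
    have hstep : Maps [copyGate A B j] 1 (Sum.elim u v)
        (Sum.elim u (Function.update v (B.inp j) (u (A.out j)))) := by
      have h := maps_CNOT (Sum.inl (A.out j)) (Sum.inr (B.inp j)) Sum.inl_ne_inr (Sum.elim u v)
      rwa [Sum.elim_inr, Sum.elim_inl, h0 j (List.mem_cons_self ..), Bool.false_xor,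
        Sum.update_elim_inr] at h
    refine hstep.append_one (ih hjs.2 _ (fun i hi => ?_) (fun w hw => ?_))
    · rw [Function.update_of_ne]
      · exact h0 i (List.mem_cons_of_mem _ hi)
      · exact fun e => hjs.1 (B.inp.injective e ▸ hi)
    · by_cases e : w = B.inp j
      · subst e
        rw [Function.update_self, hB]
      · rw [Function.update_of_ne e]
        refine h1 w fun i hi => ?_
        rcases List.mem_cons.1 hi with rfl | hi
        · exact fun e' => e e'.symm
        · exact hw i hi

theorem extend_trans_inl (x : Bits I) :
    Function.extend (A.inp.trans (Function.Embedding.inl : A.Wire ↪ A.Wire ⊕ B.Wire)) x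
      (fun _ => false) = Sum.elim (A.init x) fun _ => false := by
  refine ((eq_extend_iff _ _ _ _).2 ⟨?_, ?_⟩).symm
  · funext i
    exact A.inp.injective.extend_apply x (fun _ => false) i
  · rintro (w | w) hw
    · refine Function.extend_apply' x (fun _ => false) w ?_
      rintro ⟨i, rfl⟩
      exact hw ⟨i, rfl⟩
    · rfl

theorem seq_unitary_apply (x : Bits I) (u : Bits A.Wire) (v : Bits B.Wire) :
    gatesUnitary (seqGates A B) (Sum.elim u v) (Sum.elim (A.init x) fun _ => false) =
      gatesUnitary A.gates u (A.init x) * gatesUnitary B.gates v (B.init (u ∘ A.out)) := by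
  classical
  have hl : ∀ a b : Bits (A.Wire ⊕ B.Wire), AgreeOff .inl a b ↔ a ∘ Sum.inr = b ∘ Sum.inr := by
    intro a b
    constructor
    · intro h
      funext w
      exact h (Sum.inr w) (by rintro ⟨_, h⟩; cases h)
    · rintro h (w | w) hw
      · exact absurd ⟨w, rfl⟩ hw
      · exact congrFun h w
  have hr : ∀ a b : Bits (A.Wire ⊕ B.Wire), AgreeOff .inr a b ↔ a ∘ Sum.inl = b ∘ Sum.inl := by
    intro a b
    constructor
    · intro h
      funext w
      exact h (Sum.inl w) (by rintro ⟨_, h⟩; cases h)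
    · rintro h (w | w) hw
      · exact congrFun h w
      · exact absurd ⟨w, rfl⟩ hw
  have hA : ∀ a : Bits (A.Wire ⊕ B.Wire),
      extendOp .inl (gatesUnitary A.gates) a (Sum.elim (A.init x) fun _ => false) =
        if a ∘ Sum.inr = (fun _ => false) then gatesUnitary A.gates (a ∘ Sum.inl) (A.init x)
        else 0 := by
    intro a
    simp only [extendOp, Matrix.of_apply, hl]
    rfl
  have hC : ∀ a : Bits A.Wire, Maps (Finset.univ.toList.map (copyGate A B)) 1
      (Sum.elim a fun _ => false) (Sum.elim a (B.init (a ∘ A.out))) := fun a =>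
    maps_copyGates A B _ (Finset.nodup_toList _) a _ (fun _ _ => rfl) fun w hw =>
      (Function.extend_apply' (a ∘ A.out) (fun _ => false) w (by
        rintro ⟨j, hj⟩
        exact hw j (Finset.mem_toList.2 (Finset.mem_univ _)) hj)).symm
  have hB : ∀ a : Bits A.Wire, ∀ b : Bits B.Wire,
      extendOp .inr (gatesUnitary B.gates) (Sum.elim u v) (Sum.elim a b) =
        if u = a then gatesUnitary B.gates v b else 0 := by
    intro a b
    simp only [extendOp, Matrix.of_apply, hr]
    rfl
  rw [seqGates, gatesUnitary_append, gatesUnitary_append, gatesUnitary_map, gatesUnitary_map,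
    ← Matrix.mul_assoc, Matrix.mul_apply, sum_bits_sum, Finset.sum_eq_single u]
  · rw [Finset.sum_eq_single fun _ => false]
    · rw [hA, Matrix.mul_apply, Finset.sum_eq_single (Sum.elim u (B.init (u ∘ A.out)))]
      · rw [hC, hB, if_pos rfl, if_pos rfl, mul_one, Sum.elim_comp_inr, if_pos rfl,
          Sum.elim_comp_inl, mul_comm]
      · intro b _ hb
        rw [hC, if_neg hb, mul_zero]
      · simp
    · intro b _ hb
      rw [hA, Sum.elim_comp_inr, if_neg hb, mul_zero]
    · simp
  · intro a _ ha
    refine Finset.sum_eq_zero fun b _ => ?_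
    rw [hA, Sum.elim_comp_inr]
    split_ifs with hb
    · subst hb
      rw [Matrix.mul_apply, Finset.sum_eq_single (Sum.elim a (B.init (a ∘ A.out)))]
      · rw [hB, if_neg ha.symm]
        simp
      · intro c _ hc
        rw [hC, if_neg hc, mul_zero]
      · simp
    · simp
  · simp

theorem seq_prob [Fintype I] [DecidableEq J] (x : Bits I) (z : Bits O) :
    (seq A B).prob x z = ∑ y, A.prob x y * B.prob y z := by
  classical
  rw [seq, prob_mk, extend_trans_inl, sum_bits_sum]
  simp_rw [seq_unitary_apply, A.prob_eq, Finset.sum_mul]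
  conv_rhs => rw [Finset.sum_comm]
  refine Finset.sum_congr rfl fun u _ => ?_
  rw [Finset.sum_eq_single (u ∘ A.out)]
  · rw [if_pos rfl, B.prob_eq, Finset.mul_sum]
    refine Finset.sum_congr rfl fun v _ => ?_
    have : (Sum.elim u v ∘ B.out.trans .inr) = v ∘ B.out := rfl
    rw [this, Complex.normSq_mul]
    split_ifs <;> simp
  · intro y _ hy
    rw [if_neg hy.symm, zero_mul]
  · simp

theorem card_out_le : Fintype.card J ≤ Fintype.card A.Wire :=
  Fintype.card_le_of_embedding A.out

theorem seq_size : (seq A B).size ≤ 2 * A.size + B.size := by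
  have h := card_out_le A
  have h1 : Fintype.card (seq A B).Wire = Fintype.card A.Wire + Fintype.card B.Wire :=
    Fintype.card_sum
  have h2 : (seq A B).gates.length = A.gates.length + Fintype.card J + B.gates.length := by
    simp [seq, seqGates, add_assoc]
  simp only [size, h1, h2]
  omega

end Seq

/-! ### Parallel composition -/

section Par

variable {I O : Type} (C : Circuit I O) (ι J : Type) [Fintype ι] [DecidableEq ι] [Fintype J]
  [DecidableEq J]

/-- The wires of the `i`-th copy. -/
def parEmb (i : ι) : C.Wire ↪ (ι × C.Wire) ⊕ J :=
  ⟨fun w => Sum.inl (i, w), fun _ _ h => (Prod.mk.inj (Sum.inl.inj h)).2⟩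

/-- The gates of the copies listed in `l`. -/
def parGates (l : List ι) : List (Gate ((ι × C.Wire) ⊕ J)) :=
  l.flatMap fun i => C.gates.map (Gate.map (parEmb C ι J i))

/-- Copies of `C` indexed by `ι`, next to untouched wires `J`. -/
def par : Circuit ((ι × I) ⊕ J) ((ι × O) ⊕ J) where
  Wire := (ι × C.Wire) ⊕ J
  gates := parGates C ι J Finset.univ.toList
  inp := ((Function.Embedding.refl ι).prodMap C.inp).sumMap (.refl J)
  out := ((Function.Embedding.refl ι).prodMap C.out).sumMap (.refl J)

variable {ι J}

theorem agreeOff_parEmb (i : ι) (u v : Bits ((ι × C.Wire) ⊕ J)) :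
    AgreeOff (parEmb C ι J i) u v ↔
      (∀ j, j ≠ i → ∀ w, u (.inl (j, w)) = v (.inl (j, w))) ∧ u ∘ Sum.inr = v ∘ Sum.inr := by
  constructor
  · intro h
    refine ⟨fun j hj w => h _ ?_, funext fun w => h _ ?_⟩
    · rintro ⟨w', e⟩
      exact hj (Prod.mk.inj (Sum.inl.inj e)).1.symm
    · rintro ⟨w', e⟩
      cases e
  · rintro ⟨h1, h2⟩ (⟨j, w⟩ | w) hw
    · refine h1 j ?_ w
      rintro rfl
      exact hw ⟨w, rfl⟩
    · exact congrFun h2 w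

open Classical in
theorem parGates_unitary_apply (l : List ι) (hl : l.Nodup) (u v : Bits ((ι × C.Wire) ⊕ J)) :
    gatesUnitary (parGates C ι J l) u v =
      if (∀ i, i ∉ l → ∀ w, u (.inl (i, w)) = v (.inl (i, w))) ∧ u ∘ Sum.inr = v ∘ Sum.inr then
        (l.map fun i => gatesUnitary C.gates (fun w => u (.inl (i, w)))
          fun w => v (.inl (i, w))).prod
      else 0 := by
  induction l generalizing v with
  | nil =>
    simp only [parGates, List.flatMap_nil, gatesUnitary_nil, Matrix.one_apply, List.map_nil,
      List.prod_nil]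
    refine if_congr ?_ rfl rfl
    constructor
    · rintro rfl
      exact ⟨fun _ _ _ => rfl, rfl⟩
    · rintro ⟨h1, h2⟩
      funext w
      rcases w with ⟨i, w⟩ | w
      · exact h1 i (by simp) w
      · exact congrFun h2 w
  | cons i l ih =>
    rw [List.nodup_cons] at hl
    have hcons : parGates C ι J (i :: l) =
        C.gates.map (Gate.map (parEmb C ι J i)) ++ parGates C ι J l := by
      simp [parGates]
    rw [hcons, gatesUnitary_append, gatesUnitary_map, Matrix.mul_apply]
    have hterm : ∀ a : Bits ((ι × C.Wire) ⊕ J), gatesUnitary (parGates C ι J l) u a *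
        extendOp (parEmb C ι J i) (gatesUnitary C.gates) a v =
        if AgreeOff (parEmb C ι J i) a v then gatesUnitary (parGates C ι J l) u a *
          gatesUnitary C.gates (a ∘ parEmb C ι J i) (v ∘ parEmb C ι J i) else 0 := by
      intro a
      simp only [extendOp, Matrix.of_apply]
      split_ifs <;> simp
    rw [Finset.sum_congr rfl fun a _ => hterm a, sum_agreeOff (parEmb C ι J i) v
      (fun a => gatesUnitary (parGates C ι J l) u a *
        gatesUnitary C.gates (a ∘ parEmb C ι J i) (v ∘ parEmb C ι J i))]
    simp_rw [extend_comp]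
    have hself : ∀ z : Bits C.Wire, ∀ w,
        Function.extend (parEmb C ι J i) z v (.inl (i, w)) = z w := fun z w =>
      congrFun (extend_comp (parEmb C ι J i) z v) w
    have hoff : ∀ z : Bits C.Wire, ∀ j, j ≠ i → ∀ w,
        Function.extend (parEmb C ι J i) z v (.inl (j, w)) = v (.inl (j, w)) := fun z =>
      ((agreeOff_parEmb C i _ _).1 (agreeOff_extend (parEmb C ι J i) z v)).1
    have hinr : ∀ z : Bits C.Wire,
        Function.extend (parEmb C ι J i) z v ∘ Sum.inr = v ∘ Sum.inr := fun z =>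
      ((agreeOff_parEmb C i _ _).1 (agreeOff_extend (parEmb C ι J i) z v)).2
    rw [Finset.sum_eq_single fun w => u (.inl (i, w))]
    · rw [ih hl.2]
      have hiff : ((∀ j, j ∉ l → ∀ w, u (.inl (j, w)) =
          Function.extend (parEmb C ι J i) (fun w => u (.inl (i, w))) v (.inl (j, w))) ∧
          u ∘ Sum.inr = Function.extend (parEmb C ι J i) (fun w => u (.inl (i, w))) v ∘ Sum.inr) ↔
          (∀ j, j ∉ i :: l → ∀ w, u (.inl (j, w)) = v (.inl (j, w))) ∧
            u ∘ Sum.inr = v ∘ Sum.inr := by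
        rw [hinr]
        refine and_congr ⟨fun h j hj w => ?_, fun h j hj w => ?_⟩ Iff.rfl
        · rw [List.mem_cons, not_or] at hj
          rw [h j hj.2 w, hoff _ j hj.1]
        · by_cases e : j = i
          · subst e
            rw [hself]
          · rw [hoff _ j e]
            exact h j (by simp [e, hj]) w
      rw [if_congr hiff rfl rfl]
      split_ifs
      · rw [List.map_cons, List.prod_cons, mul_comm]
        congr 1
        refine congrArg List.prod (List.map_congr_left fun j hj => ?_)
        have e : j ≠ i := fun e => hl.1 (e ▸ hj)
        congr 1
        funext w
        exact hoff _ j e w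
      · simp
    · intro z _ hz
      rw [ih hl.2, if_neg, zero_mul]
      rintro ⟨h, -⟩
      exact hz (funext fun w => ((h i hl.1 w).trans (hself z w)).symm)
    · simp

theorem par_inp_extend (x : Bits ((ι × I) ⊕ J)) :
    Function.extend (((Function.Embedding.refl ι).prodMap C.inp).sumMap (.refl J)) x
      (fun _ => false) = Sum.elim (fun p : ι × C.Wire => C.init (fun a => x (.inl (p.1, a))) p.2)
        (x ∘ Sum.inr) := by
  refine ((eq_extend_iff _ _ _ _).2 ⟨?_, ?_⟩).symm
  · funext a
    rcases a with ⟨i, a⟩ | a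
    · exact C.inp.injective.extend_apply (fun a => x (.inl (i, a))) (fun _ => false) a
    · rfl
  · rintro (⟨i, w⟩ | w) hw
    · refine Function.extend_apply' (fun a => x (.inl (i, a))) (fun _ => false) w ?_
      rintro ⟨a, rfl⟩
      exact hw ⟨.inl (i, a), rfl⟩
    · exact absurd ⟨.inr w, rfl⟩ hw

theorem par_prob [Fintype I] (x : Bits ((ι × I) ⊕ J)) (y : Bits ((ι × O) ⊕ J)) :
    (par C ι J).prob x y = (∏ i, C.prob (fun a => x (.inl (i, a))) fun a => y (.inl (i, a))) *
      if x ∘ Sum.inr = y ∘ Sum.inr then 1 else 0 := by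
  classical
  rw [par, prob_mk, par_inp_extend, sum_bits_sum, sum_bits_prod]
  simp_rw [parGates_unitary_apply C _ (Finset.nodup_toList _)]
  have hout : ∀ (a : ι → Bits C.Wire) (b : Bits J),
      Sum.elim (fun p : ι × C.Wire => a p.1 p.2) b ∘
        (((Function.Embedding.refl ι).prodMap C.out).sumMap (.refl J)) = y ↔
      (∀ i, a i ∘ C.out = fun o => y (.inl (i, o))) ∧ b = y ∘ Sum.inr := by
    intro a b
    constructor
    · rintro rfl
      exact ⟨fun i => rfl, rfl⟩
    · rintro ⟨h1, rfl⟩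
      funext o
      rcases o with ⟨i, o⟩ | o
      · exact congrFun (h1 i) o
      · rfl
  have hprod : ∀ f : ι → ℂ, ((Finset.univ.toList : List ι).map f).prod = ∏ i, f i := fun f =>
    Finset.prod_map_toList Finset.univ f
  simp only [hout, hprod, Sum.elim_inl, Sum.elim_comp_inr, Finset.mem_toList, Finset.mem_univ,
    not_true_eq_false, false_imp_iff, implies_true, true_and]
  simp_rw [C.prob_eq, Finset.prod_univ_sum, Fintype.piFinset_univ, Finset.sum_mul]
  refine Finset.sum_congr rfl fun a _ => ?_
  rw [Finset.sum_eq_single (x ∘ Sum.inr)]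
  · rw [if_pos rfl]
    by_cases h1 : ∀ i, a i ∘ C.out = fun o => y (.inl (i, o))
    · rw [Finset.prod_congr rfl fun i _ => if_pos (h1 i)]
      simp [h1]
    · obtain ⟨i, hi⟩ := not_forall.1 h1
      rw [if_neg (fun h => h1 h.1), Finset.prod_eq_zero (Finset.mem_univ i) (if_neg hi), zero_mul]
  · intro b _ hb
    rw [if_neg hb]
    simp
  · simp

theorem par_size : (par C ι J).size = Fintype.card ι * C.size + 2 * Fintype.card J := by
  have h1 : Fintype.card (par C ι J).Wire
      = Fintype.card ι * Fintype.card C.Wire + Fintype.card J := by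
    change Fintype.card ((ι × C.Wire) ⊕ J) = _
    rw [Fintype.card_sum, Fintype.card_prod]
  have h2 : (par C ι J).gates.length = Fintype.card ι * C.gates.length := by
    simp [par, parGates, List.length_flatMap]
  simp only [size, h1, h2]
  ring

end Par

/-! ### Relabelling of the inputs, and random bits -/

section Reindex

variable {I I' O : Type}

/-- Relabelling of the input wires. -/
def reindexInp (C : Circuit I O) (e : I' ≃ I) : Circuit I' O where
  Wire := C.Wire
  gates := C.gates
  inp := e.toEmbedding.trans C.inp
  out := C.out

theorem reindexInp_prob [Fintype I] [Fintype I'] (C : Circuit I O) (e : I' ≃ I) (x : Bits I')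
    (y : Bits O) : (C.reindexInp e).prob x y = C.prob (x ∘ e.symm) y := by
  classical
  rw [reindexInp, prob_mk, prob_eq]
  have : Function.extend (e.toEmbedding.trans C.inp) x (fun _ => false) = C.init (x ∘ e.symm) := by
    rw [eq_init_iff]
    constructor
    · funext i
      have h := (e.toEmbedding.trans C.inp).injective.extend_apply x (fun _ => false) (e.symm i)
      simpa using h
    · intro w hw
      refine Function.extend_apply' _ _ _ ?_
      rintro ⟨i, rfl⟩
      exact hw ⟨e i, rfl⟩
  rw [this]

/-- One uniform bit. -/
def coin : Circuit Empty Unit where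
  Wire := Unit
  gates := [.H ()]
  inp := Function.Embedding.ofIsEmpty
  out := .refl Unit

theorem coin_prob (x : Bits Empty) (y : Bits Unit) : coin.prob x y = 1 / 2 := by
  classical
  rw [coin, prob_mk, Finset.sum_eq_single y]
  · have h0 : Function.extend (Function.Embedding.ofIsEmpty : Empty ↪ Unit) x (fun _ => false)
        = fun _ => false := funext fun _ => Function.extend_apply' _ _ _ (by simp)
    rw [if_pos (by rfl), gatesUnitary_singleton, h0]
    simp [Gate.unitary, Complex.normSq_ofReal]
  · intro u _ hu
    exact if_neg hu
  · simp

end Reindex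

end Circuit

/-! ### Boolean circuits -/

/-- Monomials of degree at most two in the values of wires. -/
inductive Monomial (W : Type) : Type
  | one : Monomial W
  | var (a : W) : Monomial W
  | and (a b : W) : Monomial W

namespace Monomial

variable {W : Type}

def eval (u : Bits W) : Monomial W → Bool
  | one => true
  | var a => u a
  | and a b => u a && u b

/-- All wires occurring in the monomial satisfy `p`. -/
def All (p : W → Prop) : Monomial W → Prop
  | one => True
  | var a => p a
  | and a b => p a ∧ p b

theorem eval_congr {T : Monomial W} {p : W → Prop} (hT : T.All p) {u v : Bits W}
    (h : ∀ a, p a → u a = v a) : T.eval u = T.eval v := by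
  cases T with
  | one => rfl
  | var a => exact h a hT
  | and a b => simp only [eval, h a hT.1, h b hT.2]

theorem All.mono {T : Monomial W} {p p' : W → Prop} (hT : T.All p) (h : ∀ a, p a → p' a) :
    T.All p' := by
  cases T with
  | one => trivial
  | var a => exact h a hT
  | and a b => exact ⟨h a hT.1, h b hT.2⟩

variable [Fintype W] [DecidableEq W]

/-- Gates adding the value of the monomial to the wire `t`. -/
def gates (t : W) : Monomial W → List (Gate W)
  | one => notGates t
  | var a => if h : a ≠ t then [.CNOT a t h] else []
  | and a b =>
    if h : a ≠ t ∧ b ≠ t then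
      if hab : a = b then [.CNOT a t h.1] else toffoliGates a b t hab h.1 h.2
    else []

theorem maps_gates (T : Monomial W) (t : W) (hT : T.All (· ≠ t)) (u : Bits W) :
    Maps (T.gates t) 1 u (Function.update u t (xor (u t) (T.eval u))) := by
  cases T with
  | one => simpa [gates, eval] using maps_not t u
  | var a =>
    have h : a ≠ t := hT
    simpa [gates, eval, h] using maps_CNOT a t h u
  | and a b =>
    have h : a ≠ t ∧ b ≠ t := hT
    by_cases hab : a = b
    · subst hab
      simpa [gates, eval, h.1] using maps_CNOT a t h.1 u
    · simpa [gates, eval, h.1, h.2, hab] using maps_toffoli a b t hab h.1 h.2 u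

theorem length_gates_le (T : Monomial W) (t : W) : (T.gates t).length ≤ 34 := by
  cases T with
  | one => simp [gates, notGates]
  | var a =>
    simp only [gates]
    split_ifs <;> simp
  | and a b =>
    simp only [gates]
    split_ifs <;> simp [toffoliGates, cczGates]

end Monomial

/-- The value of a sum of monomials. -/
def evalSum {W : Type} (u : Bits W) (l : List (Monomial W)) : Bool :=
  l.foldr (fun T b => xor (T.eval u) b) false

section Netlist

variable {W : Type}

@[simp] theorem evalSum_nil (u : Bits W) : evalSum u [] = false := rfl

@[simp] theorem evalSum_cons (u : Bits W) (T : Monomial W) (l : List (Monomial W)) :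
    evalSum u (T :: l) = xor (T.eval u) (evalSum u l) := rfl

theorem evalSum_congr {l : List (Monomial W)} {p : W → Prop} (hl : ∀ T ∈ l, T.All p) {u v : Bits W}
    (h : ∀ a, p a → u a = v a) : evalSum u l = evalSum v l := by
  induction l with
  | nil => rfl
  | cons T l ih =>
    rw [evalSum_cons, evalSum_cons, Monomial.eval_congr (hl T (by simp)) h,
      ih fun T' hT' => hl T' (by simp [hT'])]

variable [Fintype W] [DecidableEq W]

theorem maps_flatMap_gates (t : W) (l : List (Monomial W)) (hl : ∀ T ∈ l, T.All (· ≠ t))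
    (u : Bits W) :
    Maps (l.flatMap (Monomial.gates t)) 1 u (Function.update u t (xor (u t) (evalSum u l))) := by
  induction l generalizing u with
  | nil => simpa using Maps.nil u
  | cons T l ih =>
    rw [List.flatMap_cons]
    have hl' : ∀ T ∈ l, T.All (· ≠ t) := fun T' hT' => hl T' (by simp [hT'])
    have h := (T.maps_gates t (hl T (by simp)) u).append_one (ih hl' _)
    rw [Function.update_idem, Function.update_self] at h
    rw [evalSum_congr hl' (u := Function.update u t _) (v := u)
      (fun a ha => Function.update_of_ne ha _ _)] at h
    rw [evalSum_cons, ← Bool.xor_assoc]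
    exact h

theorem maps_netlist (rk : W → ℕ) (terms : W → List (Monomial W))
    (hrk : ∀ w, ∀ T ∈ terms w, T.All fun a => rk a < rk w) (u₀ v : Bits W)
    (hv : ∀ w, v w = xor (u₀ w) (evalSum v (terms w))) (ws : List W) (hnd : ws.Nodup)
    (hws : ws.Pairwise fun a b => rk a ≤ rk b) (u : Bits W) (h1 : ∀ w ∈ ws, u w = u₀ w)
    (h2 : ∀ w, w ∉ ws → u w = v w) :
    Maps (ws.flatMap fun w => (terms w).flatMap (Monomial.gates w)) 1 u v := by
  induction ws generalizing u with
  | nil =>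
    have : u = v := funext fun w => h2 w (by simp)
    subst this
    exact Maps.nil u
  | cons w ws ih =>
    rw [List.nodup_cons] at hnd
    rw [List.pairwise_cons] at hws
    rw [List.flatMap_cons]
    have hne : ∀ T ∈ terms w, T.All (· ≠ w) := fun T hT =>
      (hrk w T hT).mono fun a ha e => by simp [e] at ha
    refine (maps_flatMap_gates w (terms w) hne u).append_one (ih hnd.2 hws.2 _ ?_ ?_)
    · intro a ha
      rw [Function.update_of_ne]
      · exact h1 a (by simp [ha])
      · rintro rfl
        exact hnd.1 ha
    · intro a ha
      by_cases e : a = w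
      · subst e
        rw [Function.update_self, hv, h1 a (by simp)]
        congr 1
        refine evalSum_congr (hrk a) fun b hb => h2 b ?_
        rw [List.mem_cons, not_or]
        exact ⟨fun e => by simp [e] at hb, fun hb' => absurd (hws.1 b hb') (by omega)⟩
      · rw [Function.update_of_ne e]
        exact h2 a (by simp [e, ha])

theorem exists_sorted_list (rk : W → ℕ) :
    ∃ ws : List W, ws.Nodup ∧ (∀ w, w ∈ ws) ∧ ws.Pairwise (fun a b => rk a ≤ rk b) ∧
      ws.length = Fintype.card W := by
  let r : W → W → Prop := fun a b => rk a ≤ rk b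
  have : Std.Total r := ⟨fun a b => le_total (rk a) (rk b)⟩
  have : IsTrans W r := ⟨fun a b c => le_trans⟩
  have : DecidableRel r := fun a b => Nat.decLe _ _
  refine ⟨Finset.univ.toList.insertionSort r, ?_, ?_, List.pairwise_insertionSort r _, ?_⟩
  · exact (List.perm_insertionSort r _).nodup_iff.2 (Finset.nodup_toList _)
  · intro w
    simp [List.mem_insertionSort]
  · simp [List.length_insertionSort]

/-- Boolean functions given by a network of sums of monomials are computed by circuits of
linear size. -/
theorem exists_netlist_circuit {I O : Type} [Fintype I] [DecidableEq (Bits O)] (inp : I ↪ W)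
    (out : O ↪ W) (rk : W → ℕ) (terms : W → List (Monomial W)) (L : ℕ)
    (hL : ∀ w, (terms w).length ≤ L)
    (hrk : ∀ w, ∀ T ∈ terms w, T.All fun a => rk a < rk w) (val : Bits I → Bits W)
    (hval : ∀ x w, val x w =
      xor (Function.extend inp x (fun _ => false) w) (evalSum (val x) (terms w))) :
    ∃ C : Circuit I O, C.size ≤ Fintype.card W * (34 * L + 2) ∧
      ∀ x y, C.prob x y = if y = val x ∘ out then 1 else 0 := by
  obtain ⟨ws, hnd, hmem, hsort, hlen⟩ := exists_sorted_list rk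
  let gs := ws.flatMap fun w => (terms w).flatMap (Monomial.gates w)
  have hgs : gs.length ≤ Fintype.card W * (34 * L) := by
    rw [← hlen, List.length_flatMap]
    refine (List.sum_le_card_nsmul _ (34 * L) fun n hn => ?_).trans (by simp)
    obtain ⟨w, -, rfl⟩ := List.mem_map.1 hn
    rw [List.length_flatMap]
    refine (List.sum_le_card_nsmul _ 34 fun n hn => ?_).trans ?_
    · obtain ⟨T, -, rfl⟩ := List.mem_map.1 hn
      exact T.length_gates_le w
    · rw [List.length_map, smul_eq_mul, mul_comm]
      exact Nat.mul_le_mul_left _ (hL w)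
  refine ⟨Circuit.mk W gs inp out, ?_, fun x y => ?_⟩
  · simp only [Circuit.size]
    nlinarith
  · have h := maps_netlist rk terms hrk _ (val x) (hval x) ws hnd hsort _ (fun _ _ => rfl)
      fun w hw => absurd (hmem w) hw
    rw [Circuit.prob_mk, Finset.sum_eq_single (val x)]
    · rw [h, if_pos rfl]
      simp [eq_comm]
    · intro u _ hu
      rw [h, if_neg hu]
      simp
    · simp

end Netlist

/-! ### Closure properties of polynomial bounds and of QPT algorithms -/

section PolyBounded

theorem PolyBounded.mono {f g : ℕ → ℕ} (hg : PolyBounded g) (h : ∀ n, f n ≤ g n) :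
    PolyBounded f := by
  obtain ⟨p, hp⟩ := hg
  exact ⟨p, fun n => (h n).trans (hp n)⟩

theorem PolyBounded.add {f g : ℕ → ℕ} (hf : PolyBounded f) (hg : PolyBounded g) :
    PolyBounded fun n => f n + g n := by
  obtain ⟨p, hp⟩ := hf
  obtain ⟨p', hp'⟩ := hg
  exact ⟨p + p', fun n => by simpa using add_le_add (hp n) (hp' n)⟩

theorem PolyBounded.mul {f g : ℕ → ℕ} (hf : PolyBounded f) (hg : PolyBounded g) :
    PolyBounded fun n => f n * g n := by
  obtain ⟨p, hp⟩ := hf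
  obtain ⟨p', hp'⟩ := hg
  exact ⟨p * p', fun n => by simpa using Nat.mul_le_mul (hp n) (hp' n)⟩

theorem PolyBounded.const (c : ℕ) : PolyBounded fun _ => c := ⟨Polynomial.C c, fun n => by simp⟩

theorem PolyBounded.id : PolyBounded fun n => n := ⟨Polynomial.X, fun n => by simp⟩

end PolyBounded

section IsQPT

variable {I J O : ℕ → Type}

theorem IsQPT.comp [∀ n, Fintype (I n)] [∀ n, Fintype (J n)] [∀ n, DecidableEq (J n)]
    {f : ∀ n, Bits (I n) → Bits (J n) → ℝ} {g : ∀ n, Bits (J n) → Bits (O n) → ℝ}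
    (hf : IsQPT f) (hg : IsQPT g) : IsQPT fun n x z => ∑ y, f n x y * g n y z := by
  obtain ⟨A, hA, hA'⟩ := hf
  obtain ⟨B, hB, hB'⟩ := hg
  refine ⟨fun n => (A n).seq (B n),
    (((PolyBounded.const 2).mul hA).add hB).mono fun n => (A n).seq_size (B n), fun n x z => ?_⟩
  rw [Circuit.seq_prob]
  simp_rw [hA', hB']

theorem IsQPT.par [∀ n, Fintype (I n)] {ι : ℕ → Type} [∀ n, Fintype (ι n)] [∀ n, DecidableEq (ι n)]
    [∀ n, Fintype (J n)] [∀ n, DecidableEq (J n)] {f : ∀ n, Bits (I n) → Bits (O n) → ℝ}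
    (hf : IsQPT f) (hι : PolyBounded fun n => Fintype.card (ι n))
    (hJ : PolyBounded fun n => Fintype.card (J n)) :
    IsQPT (I := fun n => (ι n × I n) ⊕ J n) (O := fun n => (ι n × O n) ⊕ J n) fun n x y =>
      (∏ i, f n (fun a => x (.inl (i, a))) fun a => y (.inl (i, a))) *
        if x ∘ Sum.inr = y ∘ Sum.inr then 1 else 0 := by
  obtain ⟨C, hC, hC'⟩ := hf
  refine ⟨fun n => (C n).par (ι n) (J n), ((hι.mul hC).add ((PolyBounded.const 2).mul hJ)).mono
    fun n => ((C n).par_size).le, fun n x y => ?_⟩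
  rw [Circuit.par_prob]
  simp_rw [hC']

/-- Adding uniform random bits to the input is QPT. -/
theorem isQPT_coins {R : ℕ → Type} [∀ n, Fintype (I n)] [∀ n, DecidableEq (I n)]
    [∀ n, Fintype (R n)] [∀ n, DecidableEq (R n)] (hI : PolyBounded fun n => Fintype.card (I n))
    (hR : PolyBounded fun n => Fintype.card (R n)) :
    IsQPT (I := I) (O := fun n => (R n × Unit) ⊕ I n) fun n x y =>
      unif (R n) * if x = y ∘ Sum.inr then 1 else 0 := by
  let e : ∀ n, I n ≃ (R n × Empty) ⊕ I n := fun n => (Equiv.emptySum (R n × Empty) (I n)).symm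
  refine ⟨fun n => (Circuit.coin.par (R n) (I n)).reindexInp (e n),
    ((hR.mul (PolyBounded.const Circuit.coin.size)).add ((PolyBounded.const 2).mul hI)).mono
      fun n => (Circuit.par_size (ι := R n) (J := I n) Circuit.coin).le, fun n x y => ?_⟩
  rw [Circuit.reindexInp_prob, Circuit.par_prob]
  simp_rw [Circuit.coin_prob]
  have : (x ∘ (e n).symm) ∘ Sum.inr = x := rfl
  rw [this]
  simp [unif]

/-- Functions each of whose output bits is a sum of few input bits are QPT. -/
theorem isQPT_of_linear [∀ n, Fintype (I n)] [∀ n, DecidableEq (I n)] [∀ n, Fintype (O n)]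
    [∀ n, DecidableEq (O n)] (hI : PolyBounded fun n => Fintype.card (I n))
    (hO : PolyBounded fun n => Fintype.card (O n)) (L : ℕ)
    (vars : ∀ n, O n → List (I n)) (hL : ∀ n o, (vars n o).length ≤ L) :
    IsQPT fun n (x : Bits (I n)) (y : Bits (O n)) =>
      if y = (fun o => (vars n o).foldr (fun a b => xor (x a) b) false) then 1 else 0 := by
  have key : ∀ n, ∃ C : Circuit (I n) (O n),
      C.size ≤ Fintype.card (I n ⊕ O n) * (34 * L + 2) ∧ ∀ x y, C.prob x y =
        if y = (fun o => (vars n o).foldr (fun a b => xor (x a) b) false) then 1 else 0 := by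
    intro n
    refine exists_netlist_circuit (W := I n ⊕ O n) .inl .inr (Sum.elim (fun _ => 0) fun _ => 1)
      (Sum.elim (fun _ => []) fun o => (vars n o).map fun a => .var (.inl a)) L ?_ ?_
      (fun x => Sum.elim x fun o => (vars n o).foldr (fun a b => xor (x a) b) false) ?_
    · rintro (a | o)
      · simp
      · simpa using hL n o
    · rintro (a | o) T hT
      · simp at hT
      · obtain ⟨a, -, rfl⟩ := List.mem_map.1 hT
        exact Nat.zero_lt_one
    · rintro x (a | o)
      · have h := (Function.Embedding.inl (β := O n)).injective.extend_apply x (fun _ => false) a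
        have h' : Function.extend (Function.Embedding.inl : I n ↪ I n ⊕ O n) x (fun _ => false)
          (Sum.inl a) = x a := h
        rw [h']
        simp
      · rw [Function.extend_apply' _ _ _ (by rintro ⟨a, ha⟩; cases ha), Sum.elim_inr, Sum.elim_inr,
          Bool.false_xor]
        induction vars n o with
        | nil => rfl
        | cons a l ih => rw [List.foldr_cons, List.map_cons, evalSum_cons, ih]; rfl
  choose C hC hC' using key
  refine ⟨C, ((hI.add hO).mul (PolyBounded.const (34 * L + 2))).mono fun n => ?_, hC'⟩
  simpa using hC n

theorem IsQPT.congr [∀ n, Fintype (I n)] {f g : ∀ n, Bits (I n) → Bits (O n) → ℝ} (hf : IsQPT f)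
    (h : ∀ n x y, f n x y = g n x y) : IsQPT g := by
  obtain ⟨C, hC, hC'⟩ := hf
  exact ⟨C, hC, fun n x y => (hC' n x y).trans (h n x y)⟩

end IsQPT

/-! ### A network for the majority vote -/

section Majority

variable {n ℓ : ℕ}

/-- The number of positions `j' < j` at which `v` takes the same value as at `i`. -/
def matchCount (v : Fin n → Bits (Fin ℓ)) (i : Fin n) (j : ℕ) : ℕ :=
  (Finset.univ.filter fun j' : Fin n => j'.val < j ∧ v j' = v i).card

theorem matchCount_zero (v : Fin n → Bits (Fin ℓ)) (i : Fin n) : matchCount v i 0 = 0 := by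
  simp [matchCount]

theorem matchCount_succ (v : Fin n → Bits (Fin ℓ)) (i j : Fin n) :
    matchCount v i (j.val + 1) = matchCount v i j.val + if v i = v j then 1 else 0 := by
  have hsplit : (Finset.univ.filter fun j' : Fin n => j'.val < j.val + 1 ∧ v j' = v i) =
      (Finset.univ.filter fun j' : Fin n => j'.val < j.val ∧ v j' = v i) ∪
        (if v i = v j then {j} else ∅) := by
    ext a
    by_cases h : v i = v j
    · simp only [h, if_true, Finset.mem_filter, Finset.mem_univ, true_and, Finset.mem_union,
        Finset.mem_singleton]
      constructor
      · rintro ⟨h1, h2⟩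
        by_cases e : a = j
        · exact Or.inr e
        · exact Or.inl ⟨by have := fun e' => e (Fin.ext e'); omega, h2⟩
      · rintro (⟨h1, h2⟩ | rfl)
        · exact ⟨by omega, h2⟩
        · exact ⟨by omega, rfl⟩
    · simp only [h, if_false, Finset.mem_filter, Finset.mem_univ, true_and, Finset.union_empty]
      constructor
      · rintro ⟨h1, h2⟩
        refine ⟨?_, h2⟩
        have : a ≠ j := fun e => h (e ▸ h2.symm)
        have := fun e' => this (Fin.ext e')
        omega
      · rintro ⟨h1, h2⟩
        exact ⟨by omega, h2⟩
  rw [matchCount, hsplit, Finset.card_union_of_disjoint]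
  · rw [matchCount]
    split_ifs <;> simp
  · split_ifs
    · simp
    · simp

theorem matchCount_mono (v : Fin n → Bits (Fin ℓ)) (i : Fin n) {j k : ℕ} (h : j ≤ k) :
    matchCount v i j ≤ matchCount v i k := by
  refine Finset.card_le_card fun a ha => ?_
  simp only [Finset.mem_filter, Finset.mem_univ, true_and] at ha ⊢
  exact ⟨by omega, ha.2⟩

theorem matchCount_congr (v : Fin n → Bits (Fin ℓ)) {i i' : Fin n} (h : v i = v i') (j : ℕ) :
    matchCount v i j = matchCount v i' j := by
  simp [matchCount, h]

theorem matchCount_top (v : Fin n → Bits (Fin ℓ)) (i : Fin n) :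
    matchCount v i n = (Finset.univ.filter fun j => v j = v i).card := by
  simp [matchCount]

theorem two_mul_card_le (v : Fin n → Bits (Fin ℓ)) {w w' : Bits (Fin ℓ)} (h : w ≠ w') :
    (Finset.univ.filter fun i => v i = w).card + (Finset.univ.filter fun i => v i = w').card
      ≤ n := by
  rw [← Finset.card_union_of_disjoint]
  · exact (Finset.card_le_univ _).trans (by simp)
  · rw [Finset.disjoint_filter]
    rintro i - rfl
    exact h

theorem majority_eq (v : Fin n → Bits (Fin ℓ)) (w : Bits (Fin ℓ))
    (h : n < 2 * (Finset.univ.filter fun i => v i = w).card) : majority v = w := by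
  classical
  have hex : ∃ w : Bits (Fin ℓ), n < 2 * (Finset.univ.filter fun i => v i = w).card := ⟨w, h⟩
  have hm : n < 2 * (Finset.univ.filter fun i => v i = majority v).card := by
    have : ∃ w : Bits (Fin ℓ), n < 2 * (@Finset.filter _ (fun i => v i = w)
      (fun i => Classical.propDecidable _) Finset.univ).card := by
      convert hex
    rw [majority, dif_pos this]
    convert this.choose_spec
  by_contra hne
  have := two_mul_card_le v hne
  omega

theorem majority_eq_false (v : Fin n → Bits (Fin ℓ))
    (h : ¬ ∃ w : Bits (Fin ℓ), n < 2 * (Finset.univ.filter fun i => v i = w).card) :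
    majority v = fun _ => false := by
  rw [majority, dif_neg]
  convert h

/-- The position with exactly `n / 2` earlier matches, if any, carries the majority. -/
theorem majority_eq_of_matchCount (v : Fin n → Bits (Fin ℓ)) (i : Fin n)
    (h : matchCount v i i = n / 2) : majority v = v i := by
  refine majority_eq v _ ?_
  rw [← matchCount_top]
  have h1 := matchCount_succ v i i
  have h2 := matchCount_mono v i (j := i.val + 1) (k := n) (by omega)
  simp at h1
  omega

theorem matchCount_self_injective (v : Fin n → Bits (Fin ℓ)) (i j : Fin n)
    (hi : matchCount v i i = n / 2) (hj : matchCount v j j = n / 2) : i = j := by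
  have e : v i = v j :=
    (majority_eq_of_matchCount v i hi).symm.trans (majority_eq_of_matchCount v j hj)
  have hlt : ∀ a b : Fin n, v a = v b → a < b → matchCount v a a < matchCount v b b := by
    intro a b hab h
    have h1 := matchCount_succ v a a
    have h2 := matchCount_mono v a (j := a.val + 1) (k := b) (by omega)
    rw [matchCount_congr v hab b] at h2
    simp at h1
    omega
  rcases lt_trichotomy i j with h | h | h
  · have := hlt i j e h
    omega
  · exact h
  · have := hlt j i e.symm h
    omega

theorem exists_matchCount_eq (v : Fin n → Bits (Fin ℓ)) (a : Fin n) (h : ℕ) (k : ℕ) (hk : k ≤ n)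
    (hlt : h < matchCount v a k) : ∃ i : Fin n, matchCount v i i = h := by
  induction k with
  | zero => simp [matchCount_zero] at hlt
  | succ k ih =>
    by_cases h' : h < matchCount v a k
    · exact ih (by omega) h'
    · have hs := matchCount_succ v a ⟨k, hk⟩
      simp only at hs
      by_cases e : v a = v ⟨k, hk⟩
      · refine ⟨⟨k, hk⟩, ?_⟩
        rw [← matchCount_congr v e]
        simp only [e, if_true] at hs
        change matchCount v a k = h
        omega
      · rw [if_neg e] at hs
        omega

theorem evalSum_map_eq_false {W α : Type} (u : Bits W) (l : List α) (f : α → Monomial W)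
    (h : ∀ i ∈ l, (f i).eval u = false) : evalSum u (l.map f) = false := by
  induction l with
  | nil => rfl
  | cons a l ih =>
    rw [List.map_cons, evalSum_cons, h a (by simp), ih fun i hi => h i (by simp [hi])]
    rfl

theorem evalSum_map_eq_single {W α : Type} (u : Bits W) (l : List α) (hl : l.Nodup)
    (f : α → Monomial W) (i₀ : α) (h₀ : i₀ ∈ l)
    (h : ∀ i ∈ l, i ≠ i₀ → (f i).eval u = false) : evalSum u (l.map f) = (f i₀).eval u := by
  induction l with
  | nil => simp at h₀
  | cons a l ih =>
    rw [List.nodup_cons] at hl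
    rw [List.map_cons, evalSum_cons]
    by_cases e : a = i₀
    · subst e
      rw [evalSum_map_eq_false u l f fun i hi => h i (by simp [hi]) (fun e => hl.1 (e ▸ hi)),
        Bool.xor_false]
    · rw [h a (by simp) e, ih hl.2 (by simpa [Ne.symm e] using h₀) fun i hi => h i (by simp [hi]),
        Bool.false_xor]

variable (n ℓ)

/-- Wires: the strings, the agreement of two strings on a prefix, the number of matches among an
initial segment, and the result. -/
abbrev MajWire : Type :=
  (Fin n × Fin ℓ) ⊕ (Fin n × Fin n × Fin (ℓ + 1)) ⊕ (Fin n × Fin (n + 1) × Fin (n + 1)) ⊕ Fin ℓ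

variable {n ℓ}

/-- The wire for bit `t` of string `i`. -/
abbrev MajWire.str (i : Fin n) (t : Fin ℓ) : MajWire n ℓ := .inl (i, t)

/-- The wire for the agreement of strings `i` and `j` on the first `t` bits. -/
abbrev MajWire.agree (i j : Fin n) (t : Fin (ℓ + 1)) : MajWire n ℓ := .inr (.inl (i, j, t))

/-- The wire stating that exactly `s` of the first `j` strings agree with string `i`. -/
abbrev MajWire.count (i : Fin n) (j s : Fin (n + 1)) : MajWire n ℓ := .inr (.inr (.inl (i, j, s)))

/-- The wire for bit `t` of the result. -/
abbrev MajWire.res (t : Fin ℓ) : MajWire n ℓ := .inr (.inr (.inr t))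

def agreeTerms (i j : Fin n) : Fin (ℓ + 1) → List (Monomial (MajWire n ℓ)) :=
  Fin.cases [.one] fun t => [.var (.agree i j t.castSucc),
    .and (.agree i j t.castSucc) (.str i t), .and (.agree i j t.castSucc) (.str j t)]

def countTerms (i : Fin n) (j s : Fin (n + 1)) : List (Monomial (MajWire n ℓ)) :=
  Fin.cases (if s = 0 then [.one] else [])
    (fun j => [.var (.count i j.castSucc s),
      .and (.agree i j (Fin.last ℓ)) (.count i j.castSucc s)] ++
      (Fin.cases [] (fun s => [.and (.agree i j (Fin.last ℓ)) (.count i j.castSucc s.castSucc)]) s :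
        List (Monomial (MajWire n ℓ)))) j

/-- The position of the middle in the count register. -/
def halfIdx (n : ℕ) : Fin (n + 1) := ⟨n / 2, by omega⟩

def resTerms (t : Fin ℓ) : List (Monomial (MajWire n ℓ)) :=
  (List.finRange n).map fun i => .and (.count i i.castSucc (halfIdx n)) (.str i t)

def majTerms : MajWire n ℓ → List (Monomial (MajWire n ℓ)) :=
  Sum.elim (fun _ => []) <| Sum.elim (fun p => agreeTerms p.1 p.2.1 p.2.2) <|
    Sum.elim (fun p => countTerms p.1 p.2.1 p.2.2) resTerms

def majRank : MajWire n ℓ → ℕ :=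
  Sum.elim (fun _ => 0) <| Sum.elim (fun p => 1 + p.2.2.val) <|
    Sum.elim (fun p => ℓ + 2 + p.2.1.val) fun _ => ℓ + n + 4

def majVal (v : Fin n → Bits (Fin ℓ)) : Bits (MajWire n ℓ) :=
  Sum.elim (fun p => v p.1 p.2) <|
    Sum.elim (fun p => decide (∀ t : Fin ℓ, t.val < p.2.2.val → v p.1 t = v p.2.1 t)) <|
      Sum.elim (fun p => decide (matchCount v p.1 p.2.1.val = p.2.2.val)) (majority v)

theorem majVal_agree_last (v : Fin n → Bits (Fin ℓ)) (i j : Fin n) :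
    majVal v (.agree i j (Fin.last ℓ)) = decide (v i = v j) := by
  simp [majVal, funext_iff]

theorem majVal_agree (v : Fin n → Bits (Fin ℓ)) (i j : Fin n) (t : Fin (ℓ + 1)) :
    majVal v (.agree i j t) = evalSum (majVal v) (agreeTerms i j t) := by
  induction t using Fin.cases with
  | zero => simp [majVal, agreeTerms, Monomial.eval]
  | succ t =>
    have h : (∀ t' : Fin ℓ, t'.val < t.val + 1 → v i t' = v j t') ↔
        (∀ t' : Fin ℓ, t'.val < t.val → v i t' = v j t') ∧ v i t = v j t := by
      constructor
      · intro h
        exact ⟨fun t' ht' => h t' (by omega), h t (by omega)⟩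
      · rintro ⟨h1, h2⟩ t' ht'
        by_cases e : t' = t
        · rw [e, h2]
        · exact h1 t' (by have := fun e' => e (Fin.ext e'); omega)
    simp only [majVal, agreeTerms, Monomial.eval, Fin.cases_succ, evalSum_cons, evalSum_nil,
      Sum.elim_inl, Sum.elim_inr, Fin.val_succ, Fin.val_castSucc, h, Bool.decide_and]
    generalize decide (∀ t' : Fin ℓ, t'.val < t.val → v i t' = v j t') = b
    cases b <;> cases v i t <;> cases v j t <;> rfl

theorem majVal_count (v : Fin n → Bits (Fin ℓ)) (i : Fin n) (j s : Fin (n + 1)) :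
    majVal v (.count i j s) = evalSum (majVal v) (countTerms i j s) := by
  induction j using Fin.cases with
  | zero =>
    simp only [majVal, countTerms, Sum.elim_inl, Sum.elim_inr, Fin.val_zero, matchCount_zero,
      Fin.cases_zero]
    by_cases h : s = 0
    · subst h
      simp [Monomial.eval]
    · have h' : ¬ 0 = s.val := fun e => h (Fin.ext e.symm)
      simp [h, h']
  | succ j =>
    have hc : ∀ (k s : Fin (n + 1)), majVal v (.count i k s) =
      decide (matchCount v i k.val = s.val) := fun _ _ => rfl
    induction s using Fin.cases with
    | zero =>
      simp only [countTerms, Fin.cases_succ, Fin.cases_zero, List.append_nil, evalSum_cons,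
        evalSum_nil, Monomial.eval, majVal_agree_last, hc, Fin.val_succ, Fin.val_castSucc,
        matchCount_succ, Fin.val_zero]
      by_cases e : v i = v j
      · simp [e]
      · simp only [e, if_false, add_zero, decide_false, Bool.false_and, Bool.xor_false]
        rfl
    | succ s =>
      simp only [countTerms, Fin.cases_succ, List.cons_append, List.nil_append, evalSum_cons,
        evalSum_nil, Monomial.eval, majVal_agree_last, hc, Fin.val_succ, Fin.val_castSucc,
        matchCount_succ]
      by_cases e : v i = v j <;> simp [e]

theorem majVal_res (v : Fin n → Bits (Fin ℓ)) (t : Fin ℓ) :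
    majVal v (.res t) = evalSum (majVal v) (resTerms t) := by
  have hev : ∀ i : Fin n, (Monomial.and (.count i i.castSucc (halfIdx n)) (.str i t) :
      Monomial (MajWire n ℓ)).eval (majVal v) = (decide (matchCount v i i = n / 2) && v i t) :=
    fun _ => rfl
  change majority v t = _
  by_cases h : ∃ i : Fin n, matchCount v i i = n / 2
  · obtain ⟨i, hi⟩ := h
    rw [resTerms, evalSum_map_eq_single _ _ (List.nodup_finRange n) _ i (List.mem_finRange i), hev,
      majority_eq_of_matchCount v i hi]
    · simp [hi]
    · intro j _ hj
      rw [hev]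
      have : matchCount v j j ≠ n / 2 := fun e => hj (matchCount_self_injective v j i e hi)
      simp [this]
  · rw [resTerms, evalSum_map_eq_false, majority_eq_false]
    · rintro ⟨w, hw⟩
      have hpos : 0 < (Finset.univ.filter fun i => v i = w).card := by omega
      obtain ⟨a, ha⟩ := Finset.card_pos.1 hpos
      have ha' : v a = w := by simpa using ha
      subst ha'
      rw [← matchCount_top] at hw
      exact h (exists_matchCount_eq v a (n / 2) n le_rfl (by omega))
    · intro i _
      rw [hev]
      have : matchCount v i i ≠ n / 2 := fun e => h ⟨i, e⟩
      simp [this]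

theorem majTerms_length (w : MajWire n ℓ) : (majTerms w).length ≤ n + 3 := by
  rcases w with p | ⟨i, j, t⟩ | ⟨i, j, s⟩ | t
  · simp [majTerms]
  · change (agreeTerms i j t).length ≤ _
    induction t using Fin.cases <;> simp [agreeTerms]
  · change (countTerms i j s).length ≤ _
    induction j using Fin.cases
    · simp only [countTerms, Fin.cases_zero]
      split_ifs <;> simp
    · induction s using Fin.cases <;> simp [countTerms]
  · change (resTerms t).length ≤ _
    simp [resTerms]

theorem majTerms_rank (w : MajWire n ℓ) : ∀ T ∈ majTerms w, T.All fun a => majRank a < majRank w := by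
  rcases w with p | ⟨i, j, t⟩ | ⟨i, j, s⟩ | t
  · simp [majTerms]
  · change ∀ T ∈ agreeTerms i j t, _
    induction t using Fin.cases <;> simp [agreeTerms, Monomial.All, majRank]
  · change ∀ T ∈ countTerms i j s, _
    induction j using Fin.cases
    · simp only [countTerms, Fin.cases_zero]
      split_ifs <;> simp [Monomial.All]
    · induction s using Fin.cases <;> simp [countTerms, Monomial.All, majRank] <;> omega
  · change ∀ T ∈ resTerms t, _
    intro T hT
    obtain ⟨i, -, rfl⟩ := List.mem_map.1 hT
    have := i.isLt
    simp only [Monomial.All, majRank, Sum.elim_inl, Sum.elim_inr, Fin.val_castSucc]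
    omega

theorem isQPT_majority (ℓ : ℕ → ℕ) (hℓ : PolyBounded ℓ) :
    IsQPT (I := fun n => Fin n × Fin (ℓ n)) (O := fun n => Fin (ℓ n)) fun _ x y =>
      if y = majority (fun i t => x (i, t)) then 1 else 0 := by
  have key : ∀ n, ∃ C : Circuit (Fin n × Fin (ℓ n)) (Fin (ℓ n)),
      C.size ≤ Fintype.card (MajWire n (ℓ n)) * (34 * (n + 3) + 2) ∧ ∀ x y, C.prob x y =
        if y = majority (fun i t => x (i, t)) then 1 else 0 := by
    intro n
    refine exists_netlist_circuit (W := MajWire n (ℓ n)) .inl ⟨.res, fun a b h => by simpa using h⟩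
      majRank majTerms (n + 3) majTerms_length majTerms_rank (fun x => majVal fun i t => x (i, t)) ?_
    have hoff : ∀ x : Bits (Fin n × Fin (ℓ n)), ∀ w, Function.extend
        (Function.Embedding.inl : Fin n × Fin (ℓ n) ↪ MajWire n (ℓ n)) x (fun _ => false)
        (Sum.inr w) = false := fun x w =>
      Function.extend_apply' _ _ _ (by rintro ⟨a, ha⟩; cases ha)
    rintro x (p | ⟨i, j, t⟩ | ⟨i, j, s⟩ | t)
    · have h : Function.extend (Function.Embedding.inl : Fin n × Fin (ℓ n) ↪ MajWire n (ℓ n)) x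
          (fun _ => false) (Sum.inl p) = x p :=
        Function.Embedding.inl.injective.extend_apply x (fun _ => false) p
      rw [h]
      simp [majTerms, majVal]
    · rw [hoff, Bool.false_xor]
      exact majVal_agree _ i j t
    · rw [hoff, Bool.false_xor]
      exact majVal_count _ i j s
    · rw [hoff, Bool.false_xor]
      exact majVal_res _ t
  choose C hC hC' using key
  refine ⟨C, PolyBounded.mono ?_ hC, hC'⟩
  simp only [Fintype.card_sum, Fintype.card_prod, Fintype.card_fin]
  have h1 := PolyBounded.const 1
  have hid := PolyBounded.id
  exact ((hid.mul hℓ).add ((hid.mul (hid.mul (hℓ.add h1))).add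
    ((hid.mul ((hid.add h1).mul (hid.add h1))).add hℓ))).mul
    (((PolyBounded.const 34).mul (hid.add (PolyBounded.const 3))).add (PolyBounded.const 2))

end Majority

/-! ### The algorithms of the scheme are QPT -/

theorem sum_det_mul {α : Type*} [Fintype α] [DecidableEq α] (a : α) (h : α → ℝ) :
    ∑ y, (if y = a then 1 else 0) * h y = h a := by
  simp

/-- A deterministic step followed by a randomized one. -/
theorem IsQPT.comp_det {I J O : ℕ → Type} [∀ n, Fintype (I n)] [∀ n, Fintype (J n)]
    [∀ n, DecidableEq (J n)] {f : ∀ n, Bits (I n) → Bits (J n)}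
    {g : ∀ n, Bits (J n) → Bits (O n) → ℝ} (hg : IsQPT g)
    (hf : IsQPT fun n (x : Bits (I n)) (y : Bits (J n)) => if y = f n x then (1 : ℝ) else 0) :
    IsQPT fun n x z => g n (f n x) z :=
  (hf.comp hg).congr fun n x z => sum_det_mul (f n x) fun y => g n y z

theorem sum_bits_sum_mul_eq {A B : Type} [Fintype A] [DecidableEq A] [Fintype B] [DecidableEq B]
    (b : Bits B) (g : Bits (A ⊕ B) → ℝ) :
    ∑ y : Bits (A ⊕ B), (if b = y ∘ Sum.inr then 1 else 0) * g y
      = ∑ a : Bits A, g (Sum.elim a b) := by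
  rw [sum_bits_sum]
  refine Finset.sum_congr rfl fun a _ => ?_
  rw [Finset.sum_eq_single b]
  · simp
  · intro b' _ hb'
    simp [hb'.symm]
  · simp

/-- Supplying uniform random bits to an algorithm. -/
theorem IsQPT.withCoins {I R O : ℕ → Type} [∀ n, Fintype (I n)] [∀ n, DecidableEq (I n)]
    [∀ n, Fintype (R n)] [∀ n, DecidableEq (R n)]
    {g : ∀ n, Bits ((R n × Unit) ⊕ I n) → Bits (O n) → ℝ} (hg : IsQPT g)
    (hI : PolyBounded fun n => Fintype.card (I n))
    (hR : PolyBounded fun n => Fintype.card (R n)) :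
    IsQPT fun n x z => ∑ r : Bits (R n),
      unif (R n) * g n (Sum.elim (fun p => r p.1) x) z := by
  refine ((isQPT_coins hI hR).comp hg).congr fun n x z => ?_
  simp_rw [mul_assoc, ← Finset.mul_sum]
  congr 1
  rw [sum_bits_sum_mul_eq x fun y => g n y z, sum_bits_prod]
  exact Fintype.sum_equiv (Equiv.arrowCongr (Equiv.refl (R n)) (Equiv.funUnique Unit Bool)) _ _
    fun u => rfl

namespace KeyedFun

variable {m ℓ : ℕ → ℕ} {F : KeyedFun m ℓ}

theorem QPT.polyBounded (hF : F.QPT) : PolyBounded m ∧ PolyBounded ℓ := by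
  obtain ⟨C, hC, -⟩ := hF
  constructor
  · refine hC.mono fun n => ?_
    have h := Fintype.card_le_of_embedding (C n).inp
    simp only [Fintype.card_sum, Fintype.card_fin] at h
    simp only [Circuit.size]
    omega
  · refine hC.mono fun n => ?_
    have h := Fintype.card_le_of_embedding (C n).out
    simp only [Fintype.card_fin] at h
    simp only [Circuit.size]
    omega

theorem QPT.nonneg (hF : F.QPT) (n : ℕ) (k : Bits (Fin n)) (x : Bits (Fin (m n)))
    (y : Bits (Fin (ℓ n))) : 0 ≤ F n k x y := by
  obtain ⟨C, -, hC⟩ := hF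
  have h := hC n (Sum.elim k x) y
  simp only [Sum.elim_comp_inl, Sum.elim_comp_inr] at h
  exact h ▸ (C n).prob_nonneg _ _

theorem QPT.sum_eq_one (hF : F.QPT) (n : ℕ) (k : Bits (Fin n)) (x : Bits (Fin (m n))) :
    ∑ y, F n k x y = 1 := by
  obtain ⟨C, -, hC⟩ := hF
  have h := hC n (Sum.elim k x)
  simp only [Sum.elim_comp_inl, Sum.elim_comp_inr] at h
  simp_rw [← h]
  exact (C n).sum_prob _

/-- Evaluation of `F` on all key blocks, followed by a deterministic step. -/
theorem QPT.blocks (hF : F.QPT) {J O : ℕ → Type} [∀ n, Fintype (J n)] [∀ n, DecidableEq (J n)]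
    [∀ n, Fintype (O n)] (hJ : PolyBounded fun n => Fintype.card (J n))
    {g : ∀ n, Bits ((Fin n × Fin (ℓ n)) ⊕ J n) → Bits (O n)}
    (hg : IsQPT fun n (x : Bits ((Fin n × Fin (ℓ n)) ⊕ J n)) (y : Bits (O n)) =>
      if y = g n x then (1 : ℝ) else 0) :
    IsQPT (I := fun n => (Fin n × (Fin n ⊕ Fin (m n))) ⊕ J n) fun n x z =>
      ∑ y : Fin n → Bits (Fin (ℓ n)), (∏ i, F n (fun j => x (.inl (i, .inl j)))
        (fun t => x (.inl (i, .inr t))) (y i)) *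
        if z = g n (Sum.elim (fun p => y p.1 p.2) (x ∘ Sum.inr)) then 1 else 0 := by
  have hpar := IsQPT.par (ι := fun n => Fin n) (J := J) hF (by simpa using PolyBounded.id) hJ
  refine (hpar.comp hg).congr fun n x z => ?_
  have : ∀ y : Bits ((Fin n × Fin (ℓ n)) ⊕ J n), ∀ p q : ℝ,
      p * (if x ∘ Sum.inr = y ∘ Sum.inr then 1 else 0) * q
        = (if x ∘ Sum.inr = y ∘ Sum.inr then 1 else 0) * (p * q) := fun y p q => by ring
  simp_rw [this]
  rw [sum_bits_sum_mul_eq, sum_bits_prod]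
  rfl

end KeyedFun

variable {m ℓ : ℕ → ℕ} {F : KeyedFun m ℓ}

theorem polyBounded_keyReg : PolyBounded fun n => Fintype.card (KeyReg n) :=
  (PolyBounded.id.mul PolyBounded.id).mono fun n => by simp

theorem polyBounded_ctReg (hm : PolyBounded m) (hℓ : PolyBounded ℓ) :
    PolyBounded fun n => Fintype.card (CtReg m ℓ n) :=
  (hm.add (PolyBounded.id.mul hℓ)).mono fun n => by simp

theorem polyBounded_blocks (hm : PolyBounded m) :
    PolyBounded fun n => Fintype.card (Fin n × (Fin n ⊕ Fin (m n))) :=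
  (PolyBounded.id.mul (PolyBounded.id.add hm)).mono fun n => by simp

theorem polyBounded_card_sum {A B : ℕ → Type} [∀ n, Fintype (A n)] [∀ n, Fintype (B n)]
    (hA : PolyBounded fun n => Fintype.card (A n)) (hB : PolyBounded fun n => Fintype.card (B n)) :
    PolyBounded fun n => Fintype.card (A n ⊕ B n) :=
  (hA.add hB).mono fun n => by simp

theorem isQPT_gen : IsQPT (I := fun _ => Empty) (O := KeyReg) (fun n _ k => (ske F).Gen n k) := by
  have hE : PolyBounded fun _ => Fintype.card Empty := PolyBounded.const _
  have hR : PolyBounded fun n => Fintype.card (KeyReg n × Unit) :=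
    polyBounded_keyReg.mono fun n => by simp
  have hlin := isQPT_of_linear (I := fun n => (KeyReg n × Unit) ⊕ Empty) (O := KeyReg)
    (polyBounded_card_sum hR hE) polyBounded_keyReg 1 (fun n o => [.inl (o, ())]) (by simp)
  refine (hlin.withCoins (R := KeyReg) hE polyBounded_keyReg).congr fun n x k => ?_
  simp [ske]

theorem isQPT_enc (hF : F.QPT) : IsQPT (I := fun n => KeyReg n ⊕ Fin (ℓ n)) (O := CtReg m ℓ)
    (fun n z c => (ske F).Enc n (z ∘ Sum.inl) (z ∘ Sum.inr) c) := by
  obtain ⟨hm, hℓ⟩ := hF.polyBounded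
  have hm' : PolyBounded fun n => Fintype.card (Fin (m n)) := hm.mono fun n => by simp
  have hℓ' : PolyBounded fun n => Fintype.card (Fin (ℓ n)) := hℓ.mono fun n => by simp
  have hmu : PolyBounded fun n => Fintype.card (Fin (m n) × Unit) := hm.mono fun n => by simp
  have hnl : PolyBounded fun n => Fintype.card (Fin n × Fin (ℓ n)) :=
    (PolyBounded.id.mul hℓ).mono fun n => by simp
  have hJ := polyBounded_card_sum hm' hℓ'
  have hI := polyBounded_card_sum polyBounded_keyReg hℓ'
  have hout := isQPT_of_linear (I := fun n => (Fin n × Fin (ℓ n)) ⊕ (Fin (m n) ⊕ Fin (ℓ n)))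
    (O := CtReg m ℓ) (polyBounded_card_sum hnl hJ) (polyBounded_ctReg hm hℓ) 2
    (fun n => Sum.elim (fun t => [.inr (.inl t)]) fun p => [.inr (.inr p.2), .inl p])
    (by rintro n (t | p) <;> simp)
  have hcopy := isQPT_of_linear (I := fun n => (Fin (m n) × Unit) ⊕ (KeyReg n ⊕ Fin (ℓ n)))
    (O := fun n => (Fin n × (Fin n ⊕ Fin (m n))) ⊕ (Fin (m n) ⊕ Fin (ℓ n)))
    (polyBounded_card_sum hmu hI) (polyBounded_card_sum (polyBounded_blocks hm) hJ) 1
    (fun n => Sum.elim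
      (fun p => Sum.elim (fun j => [.inr (.inl (p.1, j))]) (fun t => [.inl (t, ())]) p.2)
      (Sum.elim (fun t => [.inl (t, ())]) fun t => [.inr (.inr t)]))
    (by rintro n (⟨i, j | t⟩ | t | t) <;> simp)
  refine ((((hF.blocks hJ hout).comp_det hcopy).withCoins (R := fun n => Fin (m n)) hI hm').congr
    fun n z c => ?_)
  simp only [ske, Sum.elim_inl, Sum.elim_inr, List.foldr_cons, List.foldr_nil, Bool.xor_false,
    Function.comp_apply]
  refine Finset.sum_congr rfl fun r _ => ?_
  congr 1
  refine Finset.sum_congr rfl fun y _ => ?_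
  congr 1
  refine if_congr (Eq.congr_right ?_) rfl rfl
  funext o
  rcases o with t | p
  · simp [mkCt]
  · simp [mkCt, xorBits]

theorem isQPT_dec (hF : F.QPT) : IsQPT (I := fun n => KeyReg n ⊕ CtReg m ℓ n)
    (O := fun n => Fin (ℓ n))
    (fun n z msg => (ske F).Dec n (z ∘ Sum.inl) (z ∘ Sum.inr) msg) := by
  obtain ⟨hm, hℓ⟩ := hF.polyBounded
  have hJ : PolyBounded fun n => Fintype.card (Fin n × Fin (ℓ n)) :=
    (PolyBounded.id.mul hℓ).mono fun n => by simp
  have hxor := isQPT_of_linear (I := fun n => (Fin n × Fin (ℓ n)) ⊕ (Fin n × Fin (ℓ n)))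
    (O := fun n => Fin n × Fin (ℓ n)) (polyBounded_card_sum hJ hJ) hJ 2
    (fun n p => [.inr p, .inl p]) (by simp)
  have hcopy := isQPT_of_linear (I := fun n => KeyReg n ⊕ CtReg m ℓ n)
    (O := fun n => (Fin n × (Fin n ⊕ Fin (m n))) ⊕ (Fin n × Fin (ℓ n)))
    (polyBounded_card_sum polyBounded_keyReg (polyBounded_ctReg hm hℓ))
    (polyBounded_card_sum (polyBounded_blocks hm) hJ) 1
    (fun n => Sum.elim
      (fun p => Sum.elim (fun j => [.inl (p.1, j)]) (fun t => [.inr (.inl t)]) p.2)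
      fun p => [.inr (.inr p)])
    (by rintro n (⟨i, j | t⟩ | p) <;> simp)
  have hmaj := (isQPT_majority ℓ hℓ).comp_det hxor
  refine ((hF.blocks hJ hmaj).comp_det hcopy).congr fun n z msg => ?_
  simp only [ske, Sum.elim_inl, Sum.elim_inr, List.foldr_cons, List.foldr_nil, Bool.xor_false,
    Function.comp_apply]
  refine Finset.sum_congr rfl fun y _ => ?_
  rfl

theorem ske_qpt (hF : F.QPT) : (ske F).QPT := ⟨isQPT_gen, isQPT_enc hF, isQPT_dec hF⟩

/-! ### Correctness -/

theorem sum_unif (I : Type) [Fintype I] [DecidableEq I] : ∑ _x : Bits I, unif I = 1 := by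
  simp [unif]

theorem unif_nonneg (I : Type) [Fintype I] : 0 ≤ unif I := by
  unfold unif
  positivity

theorem unif_prod (I J : Type) [Fintype I] [Fintype J] :
    unif (I × J) = ∏ _i : I, unif J := by
  simp [unif, ← pow_mul, mul_comm]

theorem sum_pi_prod {ι α : Type*} [Fintype ι] [DecidableEq ι] [Fintype α] (f : ι → α → ℝ) :
    ∑ a : ι → α, ∏ i, f i (a i) = ∏ i, ∑ x, f i x := by
  rw [Finset.prod_univ_sum, Fintype.piFinset_univ]

theorem Negligible.const_pow {r : ℝ} (h : |r| < 1) : Negligible fun n => r ^ n := fun k =>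
  tendsto_pow_const_mul_const_pow_of_abs_lt_one k h

theorem Negligible.congr' {f g : ℕ → ℝ} (hf : Negligible f) (h : f =ᶠ[atTop] g) : Negligible g :=
  SuperpolynomialDecay.congr' hf h

theorem KeyedFun.Pseudodeterministic.tendsto {μ : ℕ → ℝ} {c : ℝ} (hc : 0 < c)
    (hμ : μ =O[atTop] fun n : ℕ => (n : ℝ) ^ (-c)) : Tendsto μ atTop (nhds 0) :=
  hμ.trans_tendsto ((tendsto_rpow_neg_atTop hc).comp tendsto_natCast_atTop_atTop)

section

variable {m ℓ : ℕ → ℕ} {F : KeyedFun m ℓ}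

theorem enc_sum {n : ℕ} (k : Bits (KeyReg n)) (msg : Bits (Fin (ℓ n)))
    (h : Bits (CtReg m ℓ n) → ℝ) :
    ∑ c, (ske F).Enc n k msg c * h c = ∑ r : Bits (Fin (m n)), unif (Fin (m n)) *
      ∑ y : Fin n → Bits (Fin (ℓ n)), (∏ i, F n (fun j => k (i, j)) r (y i)) *
        h (mkCt r fun i => xorBits msg (y i)) := by
  simp only [ske, Finset.sum_mul]
  rw [Finset.sum_comm]
  refine Finset.sum_congr rfl fun r _ => ?_
  simp only [mul_assoc, ← Finset.mul_sum, Finset.sum_mul]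
  rw [Finset.sum_comm]
  congr 1
  refine Finset.sum_congr rfl fun y _ => ?_
  rw [← Finset.mul_sum, sum_det_mul]

/-- Weight of a pair of evaluations: large if they differ. -/
def mismatchWeight {α : Type*} [DecidableEq α] (y y' : α) : ℝ := if y = y' then 1 / 4 else 4

theorem mismatchWeight_nonneg {α : Type*} [DecidableEq α] (y y' : α) : 0 ≤ mismatchWeight y y' := by
  unfold mismatchWeight
  split_ifs <;> norm_num

theorem xorBits_xorBits {I : Type} (x y : Bits I) : xorBits (xorBits x y) y = x := by
  funext i
  simp [xorBits]

theorem indicator_majority_le {n ℓ : ℕ} (msg : Bits (Fin ℓ)) (y y' : Fin n → Bits (Fin ℓ)) :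
    (if msg = majority (fun i => xorBits (xorBits msg (y i)) (y' i)) then 0 else 1 : ℝ)
      ≤ ∏ i, mismatchWeight (y i) (y' i) := by
  split_ifs with h
  · exact Finset.prod_nonneg fun i _ => mismatchWeight_nonneg _ _
  · have hle : 2 * (Finset.univ.filter fun i => y i = y' i).card ≤ n := by
      by_contra hlt
      refine h (majority_eq _ msg (lt_of_lt_of_le (not_le.1 hlt) ?_)).symm
      refine Nat.mul_le_mul_left 2 (Finset.card_le_card fun i hi => ?_)
      simp only [Finset.mem_filter, Finset.mem_univ, true_and] at hi ⊢
      rw [hi, xorBits_xorBits]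
    have hcard : (Finset.univ.filter fun i => y i = y' i).card +
        (Finset.univ.filter fun i => ¬ y i = y' i).card = n := by
      simpa using Finset.card_filter_add_card_filter_not (s := (Finset.univ : Finset (Fin n)))
        (fun i => y i = y' i)
    simp only [mismatchWeight]
    rw [Finset.prod_ite, Finset.prod_const, Finset.prod_const]
    set a := (Finset.univ.filter fun i => y i = y' i).card
    set b := (Finset.univ.filter fun i => ¬ y i = y' i).card
    obtain ⟨d, hd⟩ : ∃ d, b = a + d := ⟨b - a, by omega⟩
    rw [hd, pow_add, ← mul_assoc, ← mul_pow]
    norm_num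
    exact one_le_pow₀ (by norm_num)

/-- The expected mismatch weight of one block. -/
def blockWeight (F : KeyedFun m ℓ) (n : ℕ) (r : Bits (Fin (m n))) : ℝ :=
  ∑ k : Bits (Fin n), unif (Fin n) * ∑ y, ∑ y', F n k r y * F n k r y' * mismatchWeight y y'

theorem sum_pair_le (hF : F.QPT) {n : ℕ} (k : Bits (Fin n)) (r : Bits (Fin (m n)))
    (y₀ : Bits (Fin (ℓ n))) :
    ∑ y, ∑ y', F n k r y * F n k r y' * mismatchWeight y y'
      ≤ 1 / 4 + 15 / 2 * (1 - F n k r y₀) := by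
  have hs := hF.sum_eq_one n k r
  have hpt : ∀ y y', F n k r y * F n k r y' * mismatchWeight y y' ≤
      F n k r y * F n k r y' * (31 / 4) - 15 / 4 * (F n k r y * (if y' = y₀ then F n k r y' else 0))
        - 15 / 4 * ((if y = y₀ then F n k r y else 0) * F n k r y') := by
    intro y y'
    have h := mul_nonneg (hF.nonneg n k r y) (hF.nonneg n k r y')
    unfold mismatchWeight
    split_ifs
    all_goals first | linarith | (exfalso; simp_all)
  refine (Finset.sum_le_sum fun y _ => Finset.sum_le_sum fun y' _ => hpt y y').trans ?_
  simp only [Finset.sum_sub_distrib, ← Finset.mul_sum, ← Finset.sum_mul, hs, Finset.sum_ite_eq',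
    Finset.mem_univ, if_true]
  linarith

theorem blockWeight_le (hF : F.QPT) {n : ℕ} (r : Bits (Fin (m n))) (μ : ℝ)
    (good : Finset (Bits (Fin n))) (hgood : 1 - μ ≤ good.card * unif (Fin n))
    (h : ∀ k ∈ good, ∃ y : Bits (Fin (ℓ n)), 1 - μ ≤ F n k r y) :
    blockWeight F n r ≤ 1 / 4 + 23 / 2 * μ := by
  have hu := unif_nonneg (Fin n)
  have hcard : (good.card : ℝ) * unif (Fin n) ≤ 1 := by
    rw [← sum_unif (Fin n), ← nsmul_eq_mul, ← Finset.sum_const]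
    exact Finset.sum_le_univ_sum_of_nonneg fun _ => hu
  have hμ : 0 ≤ μ := by linarith
  have hpt : ∀ k : Bits (Fin n), unif (Fin n) * ∑ y, ∑ y', F n k r y * F n k r y' *
      mismatchWeight y y' ≤ unif (Fin n) * (1 / 4 + 15 / 2 * μ + 4) -
        (if k ∈ good then unif (Fin n) * 4 else 0) := by
    intro k
    split_ifs with hk
    · obtain ⟨y, hy⟩ := h k hk
      have := mul_le_mul_of_nonneg_left ((sum_pair_le hF k r y).trans
        (by linarith : _ ≤ 1 / 4 + 15 / 2 * μ)) hu
      linarith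
    · have hb : ∑ y, ∑ y', F n k r y * F n k r y' * mismatchWeight y y' ≤ 4 := by
        calc _ ≤ ∑ y, ∑ y', F n k r y * F n k r y' * 4 := by
              refine Finset.sum_le_sum fun y _ => Finset.sum_le_sum fun y' _ => ?_
              refine mul_le_mul_of_nonneg_left ?_
                (mul_nonneg (hF.nonneg n k r y) (hF.nonneg n k r y'))
              unfold mismatchWeight
              split_ifs <;> norm_num
          _ = 4 := by
              simp only [← Finset.mul_sum, ← Finset.sum_mul, hF.sum_eq_one, one_mul]
      have := mul_le_mul_of_nonneg_left (hb.trans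
        (by linarith : _ ≤ 1 / 4 + 15 / 2 * μ + 4)) hu
      linarith
  refine (Finset.sum_le_sum fun k _ => hpt k).trans ?_
  rw [Finset.sum_sub_distrib, ← Finset.sum_mul, sum_unif, Finset.sum_ite_mem, Finset.univ_inter,
    Finset.sum_const, nsmul_eq_mul]
  linarith

/-- Expectations over the keys and two evaluations of all blocks factorize. -/
theorem sum_blocks_prod {n : ℕ} (r : Bits (Fin (m n)))
    (w : Bits (Fin (ℓ n)) → Bits (Fin (ℓ n)) → ℝ) :
    ∑ k : Bits (KeyReg n), unif (KeyReg n) * ∑ y : Fin n → Bits (Fin (ℓ n)),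
      ∑ y' : Fin n → Bits (Fin (ℓ n)), ∏ i, (F n (fun j => k (i, j)) r (y i) *
        F n (fun j => k (i, j)) r (y' i) * w (y i) (y' i)) =
    (∑ k : Bits (Fin n), unif (Fin n) * ∑ y, ∑ y', F n k r y * F n k r y' * w y y') ^ n := by
  rw [sum_bits_prod]
  simp only
  have h1 : ∀ κ : Fin n → Bits (Fin n), ∑ y : Fin n → Bits (Fin (ℓ n)),
      ∑ y' : Fin n → Bits (Fin (ℓ n)), ∏ i, (F n (κ i) r (y i) *
        F n (κ i) r (y' i) * w (y i) (y' i)) =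
      ∏ i, ∑ y, ∑ y', F n (κ i) r y * F n (κ i) r y' * w y y' := by
    intro κ
    rw [← sum_pi_prod fun i y => ∑ y', F n (κ i) r y * F n (κ i) r y' * w y y']
    refine Finset.sum_congr rfl fun y _ => ?_
    exact sum_pi_prod fun i y' => F n (κ i) r (y i) * F n (κ i) r y' * w (y i) y'
  have h2 : ∀ κ : Fin n → Bits (Fin n), unif (KeyReg n) * ∏ i, ∑ y, ∑ y',
      F n (κ i) r y * F n (κ i) r y' * w y y' =
      ∏ i, unif (Fin n) * ∑ y, ∑ y', F n (κ i) r y * F n (κ i) r y' * w y y' := by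
    intro κ
    rw [unif_prod, Finset.prod_mul_distrib]
  simp_rw [h1, h2]
  rw [sum_pi_prod fun (_ : Fin n) k =>
    unif (Fin n) * ∑ y, ∑ y', F n k r y * F n k r y' * w y y', Finset.prod_const]
  simp

theorem decryption_prob_eq {n : ℕ} (msg : Bits (Fin (ℓ n))) :
    ∑ k, (ske F).Gen n k * ∑ c, (ske F).Enc n k msg c * (ske F).Dec n k c msg =
    ∑ r : Bits (Fin (m n)), unif (Fin (m n)) * ∑ k : Bits (KeyReg n), unif (KeyReg n) *
      ∑ y : Fin n → Bits (Fin (ℓ n)), ∑ y' : Fin n → Bits (Fin (ℓ n)),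
        (∏ i, (F n (fun j => k (i, j)) r (y i) * F n (fun j => k (i, j)) r (y' i))) *
          if msg = majority (fun i => xorBits (xorBits msg (y i)) (y' i)) then 1 else 0 := by
  simp_rw [enc_sum, Finset.mul_sum]
  rw [Finset.sum_comm]
  refine Finset.sum_congr rfl fun r _ => Finset.sum_congr rfl fun k _ =>
    Finset.sum_congr rfl fun y _ => ?_
  simp only [ske, Finset.mul_sum]
  refine Finset.sum_congr rfl fun y' _ => ?_
  rw [Finset.prod_mul_distrib]
  have e1 : (mkCt r (fun i => xorBits msg (y i)) : Bits (CtReg m ℓ n)) ∘ Sum.inl = r := rfl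
  have e2 : ∀ i, (fun t => (mkCt r (fun i => xorBits msg (y i)) : Bits (CtReg m ℓ n))
    (Sum.inr (i, t))) = xorBits msg (y i) := fun _ => rfl
  simp only [e1, e2]
  ring

theorem decryption_prob_ge (hF : F.QPT) {n : ℕ} (msg : Bits (Fin (ℓ n)))
    (hw : ∀ r, blockWeight F n r ≤ 1 / 2) :
    1 - (1 / 2) ^ n ≤ ∑ k, (ske F).Gen n k * ∑ c, (ske F).Enc n k msg c * (ske F).Dec n k c msg := by
  rw [decryption_prob_eq]
  have hnn : ∀ (k : Bits (KeyReg n)) (r : Bits (Fin (m n))) (y y' : Fin n → Bits (Fin (ℓ n))),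
      0 ≤ ∏ i, (F n (fun j => k (i, j)) r (y i) * F n (fun j => k (i, j)) r (y' i)) :=
    fun k r y y' => Finset.prod_nonneg fun i _ => mul_nonneg (hF.nonneg _ _ _ _) (hF.nonneg _ _ _ _)
  have hW : ∀ r : Bits (Fin (m n)), 0 ≤ blockWeight F n r := fun r =>
    Finset.sum_nonneg fun k _ => mul_nonneg (unif_nonneg _) <| Finset.sum_nonneg fun y _ =>
      Finset.sum_nonneg fun y' _ => mul_nonneg (mul_nonneg (hF.nonneg _ _ _ _) (hF.nonneg _ _ _ _))
        (mismatchWeight_nonneg _ _)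
  have hone : ∀ r : Bits (Fin (m n)), ∑ k : Bits (KeyReg n), unif (KeyReg n) *
      ∑ y : Fin n → Bits (Fin (ℓ n)), ∑ y' : Fin n → Bits (Fin (ℓ n)),
        ∏ i, (F n (fun j => k (i, j)) r (y i) * F n (fun j => k (i, j)) r (y' i)) = 1 := by
    intro r
    have h := sum_blocks_prod (F := F) r fun _ _ => 1
    simp only [mul_one] at h
    rw [h]
    simp only [← Finset.mul_sum, hF.sum_eq_one, mul_one, sum_unif, one_pow]
  have hblock : ∀ r : Bits (Fin (m n)), 1 - (1 / 2) ^ n ≤ ∑ k : Bits (KeyReg n), unif (KeyReg n) *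
      ∑ y : Fin n → Bits (Fin (ℓ n)), ∑ y' : Fin n → Bits (Fin (ℓ n)),
        (∏ i, (F n (fun j => k (i, j)) r (y i) * F n (fun j => k (i, j)) r (y' i))) *
          if msg = majority (fun i => xorBits (xorBits msg (y i)) (y' i)) then 1 else 0 := by
    intro r
    have hpow : blockWeight F n r ^ n ≤ (1 / 2) ^ n := pow_le_pow_left₀ (hW r) (hw r) n
    rw [blockWeight, ← sum_blocks_prod] at hpow
    have hle : ∑ k : Bits (KeyReg n), unif (KeyReg n) * ∑ y : Fin n → Bits (Fin (ℓ n)),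
        ∑ y' : Fin n → Bits (Fin (ℓ n)), (
          ∏ i, (F n (fun j => k (i, j)) r (y i) * F n (fun j => k (i, j)) r (y' i)) -
          ∏ i, (F n (fun j => k (i, j)) r (y i) * F n (fun j => k (i, j)) r (y' i) *
            mismatchWeight (y i) (y' i))) ≤
        ∑ k : Bits (KeyReg n), unif (KeyReg n) * ∑ y : Fin n → Bits (Fin (ℓ n)),
          ∑ y' : Fin n → Bits (Fin (ℓ n)),
          (∏ i, (F n (fun j => k (i, j)) r (y i) * F n (fun j => k (i, j)) r (y' i))) *
            if msg = majority (fun i => xorBits (xorBits msg (y i)) (y' i)) then 1 else 0 := by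
      refine Finset.sum_le_sum fun k _ => mul_le_mul_of_nonneg_left ?_ (unif_nonneg _)
      refine Finset.sum_le_sum fun y _ => Finset.sum_le_sum fun y' _ => ?_
      have h := mul_le_mul_of_nonneg_left (indicator_majority_le msg y y') (hnn k r y y')
      rw [Finset.prod_mul_distrib (f := fun i => F n (fun j => k (i, j)) r (y i) *
        F n (fun j => k (i, j)) r (y' i))]
      split_ifs at h ⊢ <;> linarith
    refine le_trans ?_ hle
    simp only [Finset.sum_sub_distrib, mul_sub]
    rw [hone r]
    linarith
  calc 1 - (1 / 2) ^ n = ∑ _r : Bits (Fin (m n)), unif (Fin (m n)) * (1 - (1 / 2) ^ n) := by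
        rw [← Finset.sum_mul, sum_unif, one_mul]
    _ ≤ _ := Finset.sum_le_sum fun r _ => mul_le_mul_of_nonneg_left (hblock r) (unif_nonneg _)

theorem ske_correct (hF : F.QPT) (hd : F.Pseudodeterministic) : (ske F).Correct := by
  classical
  obtain ⟨c, hc, μ, hμ, hgood⟩ := hd
  have hev : ∀ᶠ n in atTop, μ n ≤ 1 / 46 :=
    ((KeyedFun.Pseudodeterministic.tendsto hc hμ).eventually (gt_mem_nhds (by norm_num))).mono
      fun n hn => hn.le
  refine ⟨fun n => if μ n ≤ 1 / 46 then (1 / 2) ^ n else 1, ?_, fun n msg => ?_⟩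
  · refine (Negligible.const_pow (r := 1 / 2) (by norm_num [abs_of_pos])).congr' ?_
    filter_upwards [hev] with n hn
    rw [if_pos hn]
  · simp only
    split_ifs with h
    · refine decryption_prob_ge hF msg fun r => ?_
      obtain ⟨good, h1, h2⟩ := hgood n r
      have := blockWeight_le hF r (μ n) good h1 h2
      linarith
    · rw [decryption_prob_eq, sub_self]
      refine Finset.sum_nonneg fun r _ => mul_nonneg (unif_nonneg _) <| Finset.sum_nonneg fun k _ =>
        mul_nonneg (unif_nonneg _) <| Finset.sum_nonneg fun y _ => Finset.sum_nonneg fun y' _ =>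
          mul_nonneg (Finset.prod_nonneg fun i _ =>
            mul_nonneg (hF.nonneg _ _ _ _) (hF.nonneg _ _ _ _)) ?_
      split_ifs <;> norm_num

end

/-! ### Circuits as quantum channels -/

theorem ite_eq_ite {α : Type*} {p q : Prop} {dp : Decidable p} {dq : Decidable q} {a b c : α}
    (h : p ↔ q) (hab : a = b) : @ite α p dp a c = @ite α q dq b c := by
  subst hab
  by_cases hp : p
  · rw [if_pos hp, if_pos (h.1 hp)]
  · rw [if_neg hp, if_neg fun hq => hp (h.2 hq)]

theorem posSemidef_of_indicator {α β : Type*} [Fintype α] [DecidableEq α] [Fintype β]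
    {M : Matrix β β ℂ} (hM : M.PosSemidef) (f : α → β) (p : α → Prop) [DecidablePred p] :
    (Matrix.of fun u v => if p u ∧ p v then M (f u) (f v) else 0 : Matrix α α ℂ).PosSemidef := by
  have h := (hM.submatrix f).mul_mul_conjTranspose_same
    (Matrix.diagonal fun u => if p u then (1 : ℂ) else 0)
  convert h using 1
  ext u v
  rw [Matrix.diagonal_conjTranspose, Matrix.mul_diagonal, Matrix.diagonal_mul]
  by_cases hu : p u <;> by_cases hv : p v <;> simp [hu, hv]

theorem tensor_ket_apply {I J : Type} [Fintype J] (ρ : Op I) (x : Bits J) (u v : Bits (I ⊕ J)) :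
    tensor ρ (ket x) u v = if u ∘ Sum.inr = x ∧ v ∘ Sum.inr = x then
      ρ (u ∘ Sum.inl) (v ∘ Sum.inl) else 0 := by
  simp only [tensor, ket, Matrix.of_apply, Matrix.single_apply, eq_comm (a := x)]
  split_ifs <;> simp

theorem tensor_ket_posSemidef {I J : Type} [Fintype I] [DecidableEq I] [Fintype J] [DecidableEq J]
    {ρ : Op I} (hρ : ρ.PosSemidef) (x : Bits J) : (tensor ρ (ket x)).PosSemidef := by
  have h := posSemidef_of_indicator hρ (fun u : Bits (I ⊕ J) => u ∘ Sum.inl)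
    (fun u => u ∘ Sum.inr = x)
  convert h using 1
  ext u v
  exact tensor_ket_apply ρ x u v

theorem tensor_ket_trace {I J : Type} [Fintype I] [DecidableEq I] [Fintype J] [DecidableEq J]
    (ρ : Op I) (x : Bits J) : (tensor ρ (ket x)).trace = ρ.trace := by
  simp only [Matrix.trace, Matrix.diag_apply]
  rw [sum_bits_sum]
  refine Finset.sum_congr rfl fun u _ => ?_
  simp [tensor_ket_apply]

theorem afterOutcome_posSemidef {I J : Type} {σ : Op (I ⊕ J)} (hσ : σ.PosSemidef) (x : Bits I) :
    (afterOutcome σ x).PosSemidef :=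
  hσ.submatrix fun u => Sum.elim x u

theorem sum_afterOutcome_trace {I J : Type} [Fintype I] [DecidableEq I] [Fintype J] [DecidableEq J]
    (σ : Op (I ⊕ J)) : ∑ x, (afterOutcome σ x).trace = σ.trace := by
  simp only [Matrix.trace, Matrix.diag_apply]
  rw [sum_bits_sum]
  rfl

theorem measure_nonneg {I : Type} {ρ : Op I} (hρ : ρ.PosSemidef) (y : Bits I) : 0 ≤ measure ρ y :=
  (Complex.le_def.1 hρ.diag_nonneg).1

theorem measure_smul {I : Type} (c : ℝ) (ρ : Op I) (y : Bits I) :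
    measure ((c : ℂ) • ρ) y = c * measure ρ y := by
  simp [measure]

theorem measure_true_add_false (ρ : Op Unit) :
    measure ρ (fun _ => true) + measure ρ (fun _ => false) = ρ.trace.re := by
  simp only [Matrix.trace, Matrix.diag_apply]
  rw [sum_bits_unit, Complex.add_re]
  rfl

theorem tensor_smul {I J : Type} (c : ℂ) (ρ : Op I) (σ : Op J) :
    tensor (c • ρ) σ = c • tensor ρ σ := by
  ext u v
  simp [tensor, mul_assoc]

namespace Circuit

variable {I O : Type} (C : Circuit I O)

theorem load_apply (ρ : Op I) (u v : Bits C.Wire) : open Classical in C.load ρ u v =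
    if (∀ w, w ∉ Set.range C.inp → u w = false) ∧ (∀ w, w ∉ Set.range C.inp → v w = false) then
      ρ (u ∘ C.inp) (v ∘ C.inp) else 0 := by
  classical
  simp only [load, Matrix.of_apply]
  refine if_congr ?_ rfl rfl
  exact ⟨fun h => ⟨fun w hw => (h w hw).1, fun w hw => (h w hw).2⟩,
    fun h w hw => ⟨h.1 w hw, h.2 w hw⟩⟩

theorem load_posSemidef [Fintype I] [DecidableEq I] {ρ : Op I} (hρ : ρ.PosSemidef) :
    (C.load ρ).PosSemidef := by
  classical
  have h := posSemidef_of_indicator hρ (fun u : Bits C.Wire => u ∘ C.inp)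
    (fun u => ∀ w, w ∉ Set.range C.inp → u w = false)
  convert h using 1
  ext u v
  exact (C.load_apply ρ u v).trans (ite_eq_ite Iff.rfl rfl)

theorem load_trace [Fintype I] [DecidableEq I] (ρ : Op I) : (C.load ρ).trace = ρ.trace := by
  classical
  simp only [Matrix.trace, Matrix.diag_apply, load_apply, and_self]
  have h := sum_agreeOff C.inp (fun _ => false) (fun u => ρ (u ∘ C.inp) (u ∘ C.inp))
  simp_rw [extend_comp] at h
  rw [← h]
  exact Finset.sum_congr rfl fun u _ => if_congr Iff.rfl rfl rfl

theorem traceOut_eq_sum [DecidableEq (Bits O)] (σ : Op C.Wire) : C.traceOut σ =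
    ∑ z ∈ (Finset.univ : Finset (Bits C.Wire)).filter (fun z => z ∘ C.out = fun _ => false),
      σ.submatrix (fun i => Function.extend C.out i z) (fun i => Function.extend C.out i z) := by
  classical
  ext i j
  rw [Matrix.sum_apply]
  simp only [traceOut, Matrix.of_apply, Matrix.submatrix_apply]
  have hidem : ∀ (a b : Bits O) (u : Bits C.Wire),
      Function.extend C.out a (Function.extend C.out b u) = Function.extend C.out a u := by
    intro a b u
    rw [eq_extend_iff]
    exact ⟨extend_comp _ _ _, (agreeOff_extend C.out a _).trans (agreeOff_extend C.out b u)⟩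
  have hself : ∀ (a : Bits O) (u : Bits C.Wire), u ∘ C.out = a → Function.extend C.out a u = u :=
    fun a u h => ((eq_extend_iff C.out a u u).2 ⟨h, fun _ _ => rfl⟩).symm
  have hinner : ∀ u : Bits C.Wire, ∑ v : Bits C.Wire,
      (if u ∘ C.out = i ∧ v ∘ C.out = j ∧ ∀ w, w ∉ Set.range C.out → u w = v w then σ u v else 0) =
      if u ∘ C.out = i then σ u (Function.extend C.out j u) else 0 := by
    intro u
    rw [Finset.sum_eq_single (Function.extend C.out j u)]
    · refine if_congr ?_ rfl rfl
      exact ⟨fun h => h.1, fun h => ⟨h, extend_comp _ _ _, (agreeOff_extend C.out j u).symm⟩⟩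
    · intro v _ hv
      rw [if_neg]
      rintro ⟨-, h1, h2⟩
      exact hv ((eq_extend_iff C.out j v u).2 ⟨h1, fun w hw => (h2 w hw).symm⟩)
    · simp
  refine (Finset.sum_congr rfl fun u _ => (Finset.sum_congr rfl fun v _ =>
    ite_eq_ite Iff.rfl rfl).trans (hinner u)).trans ?_
  rw [← Finset.sum_filter]
  refine Finset.sum_nbij' (fun u => Function.extend C.out (fun _ => false) u)
    (fun z => Function.extend C.out i z) ?_ ?_ ?_ ?_ ?_
  · intro u _
    simp [extend_comp]
  · intro u _
    simp [extend_comp]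
  · intro u hu
    simp only [Finset.mem_filter, Finset.mem_univ, true_and] at hu
    rw [hidem, hself i u hu]
  · intro u hu
    simp only [Finset.mem_filter, Finset.mem_univ, true_and] at hu
    rw [hidem, hself _ u hu]
  · intro u hu
    simp only [Finset.mem_filter, Finset.mem_univ, true_and] at hu
    rw [hidem, hidem, hself i u hu]

theorem run_posSemidef [Fintype I] [DecidableEq I] {ρ : Op I} (hρ : ρ.PosSemidef) :
    (C.run ρ).PosSemidef := by
  classical
  rw [run, traceOut_eq_sum]
  exact Matrix.posSemidef_sum _ fun z _ =>
    ((C.load_posSemidef hρ).mul_mul_conjTranspose_same _).submatrix _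

theorem run_trace [Fintype I] [DecidableEq I] [Fintype O] [DecidableEq O] (ρ : Op I) :
    (C.run ρ).trace = ρ.trace := by
  classical
  rw [← C.load_trace ρ]
  have h1 : ∀ σ : Op C.Wire, (C.traceOut σ).trace = σ.trace := by
    intro σ
    simp only [Matrix.trace, Matrix.diag_apply, traceOut_diag]
    rw [Finset.sum_comm]
    refine Finset.sum_congr rfl fun u _ => ?_
    rw [Finset.sum_eq_single (u ∘ C.out)]
    · rw [if_pos rfl]
    · intro y _ hy
      rw [if_neg hy.symm]
    · simp
  rw [run, h1, Matrix.trace_mul_cycle, unitary_eq, gatesUnitary_star_mul, Matrix.one_mul]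

theorem run_smul (c : ℂ) (ρ : Op I) : C.run (c • ρ) = c • C.run ρ := by
  classical
  have h1 : C.load (c • ρ) = c • C.load ρ := by
    ext u v
    simp only [load, Matrix.of_apply, Matrix.smul_apply]
    split_ifs <;> simp
  have h2 : ∀ σ : Op C.Wire, C.traceOut (c • σ) = c • C.traceOut σ := by
    intro σ
    rw [traceOut_eq_sum, traceOut_eq_sum, Finset.smul_sum]
    rfl
  rw [run, run, h1, Matrix.mul_smul, Matrix.smul_mul, h2]

/-! ### Feeding a circuit with partly fixed and masked inputs -/

section Mask

variable {M K V : Type} [Fintype K] [DecidableEq K]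

/-- The gates flipping the inputs selected by `mask`. -/
def maskGates (G : Circuit (M ⊕ K) O) (mask : Bits K) : List (Gate G.Wire) :=
  (Finset.univ.filter fun a => mask a = true).toList.flatMap fun a => notGates (G.inp (.inr a))

/-- The circuit `G`, the inputs `K` of which are taken from the smaller register `V`, padded with
zeros and added to `mask`. -/
def maskInput (G : Circuit (M ⊕ K) O) (f : V ↪ K) (mask : Bits K) : Circuit (M ⊕ V) O where
  Wire := G.Wire
  gates := maskGates G mask ++ G.gates
  inp := ((Function.Embedding.refl M).sumMap f).trans G.inp
  out := G.out

variable (G : Circuit (M ⊕ K) O)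

/-- The assignment of all wires adding `mask` to the inputs `K`. -/
def maskShift (mask : Bits K) (u : Bits G.Wire) : Bits G.Wire :=
  xorBits u (Function.extend (Function.Embedding.inr.trans G.inp : K ↪ G.Wire) mask fun _ => false)

theorem maskShift_inr (mask : Bits K) (u : Bits G.Wire) (a : K) :
    maskShift G mask u (G.inp (.inr a)) = xor (u (G.inp (.inr a))) (mask a) := by
  have h := (Function.Embedding.inr.trans G.inp : K ↪ G.Wire).injective.extend_apply mask
    (fun _ => false) a
  rw [maskShift, xorBits]
  exact congrArg _ h

theorem maskShift_of_ne (mask : Bits K) (u : Bits G.Wire) (w : G.Wire)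
    (hw : ∀ a, G.inp (.inr a) ≠ w) : maskShift G mask u w = u w := by
  rw [maskShift, xorBits, Function.extend_apply' _ _ _ (by rintro ⟨a, ha⟩; exact hw a ha),
    Bool.xor_false]

theorem maskShift_maskShift (mask : Bits K) (u : Bits G.Wire) :
    maskShift G mask (maskShift G mask u) = u := xorBits_xorBits _ _

theorem maps_flatMap_not (l : List K) (hl : l.Nodup) (u : Bits G.Wire) :
    Maps (l.flatMap fun a => notGates (G.inp (.inr a))) 1 u
      (maskShift G (fun a => decide (a ∈ l)) u) := by
  induction l generalizing u with
  | nil =>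
    have : maskShift G (fun a => decide (a ∈ ([] : List K))) u = u := by
      funext w
      by_cases hw : ∃ a, G.inp (.inr a) = w
      · obtain ⟨a, rfl⟩ := hw
        simp [maskShift_inr]
      · exact maskShift_of_ne G _ u w (not_exists.1 hw)
    rw [this]
    exact Maps.nil u
  | cons a l ih =>
    rw [List.nodup_cons] at hl
    rw [List.flatMap_cons]
    have h := (maps_not (G.inp (.inr a)) u).append_one (ih hl.2 _)
    convert h using 1
    funext w
    by_cases hw : ∃ b, G.inp (.inr b) = w
    · obtain ⟨b, rfl⟩ := hw
      rw [maskShift_inr, maskShift_inr]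
      by_cases e : b = a
      · subst e
        simp [hl.1]
      · rw [Function.update_of_ne fun h => e (Sum.inr_injective (G.inp.injective h))]
        simp [e]
    · rw [maskShift_of_ne G _ _ w (not_exists.1 hw), maskShift_of_ne G _ _ w (not_exists.1 hw),
        Function.update_of_ne fun h => hw ⟨a, h.symm⟩]

theorem maps_maskGates (mask : Bits K) (u : Bits G.Wire) :
    Maps (maskGates G mask) 1 u (maskShift G mask u) := by
  have h := maps_flatMap_not G _ (Finset.nodup_toList (Finset.univ.filter fun a => mask a = true)) u
  have e : (fun a => decide (a ∈ (Finset.univ.filter fun a => mask a = true).toList)) = mask := by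
    funext a
    simp
  rwa [e] at h

theorem maskGates_conj (mask : Bits K) (A : Op G.Wire) :
    gatesUnitary (maskGates G mask) * A * (gatesUnitary (maskGates G mask)).conjTranspose =
      A.submatrix (maskShift G mask) (maskShift G mask) := by
  have hflip : ∀ u v : Bits G.Wire, u = maskShift G mask v ↔ v = maskShift G mask u := by
    intro u v
    constructor
    · rintro rfl
      exact (maskShift_maskShift G mask v).symm
    · rintro rfl
      exact (maskShift_maskShift G mask u).symm
  ext u v
  rw [Matrix.mul_apply, Finset.sum_eq_single (maskShift G mask v)]
  · rw [Matrix.conjTranspose_apply, maps_maskGates G mask, if_pos (by rw [maskShift_maskShift]),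
      star_one, mul_one, Matrix.mul_apply, Finset.sum_eq_single (maskShift G mask u)]
    · rw [maps_maskGates G mask, if_pos (by rw [maskShift_maskShift]), one_mul]
      rfl
    · intro w _ hw
      rw [maps_maskGates G mask, if_neg fun h => hw ((hflip _ _).1 h), zero_mul]
    · simp
  · intro w _ hw
    rw [Matrix.conjTranspose_apply, maps_maskGates G mask, if_neg fun h => hw ((hflip _ _).1 h),
      star_zero, mul_zero]
  · simp

open Classical in
theorem load_tensor_ket {V : Type} [Fintype V] (C : Circuit (M ⊕ V) O) (ρ : Op M) (x : Bits V)
    (u v : Bits C.Wire) : C.load (tensor ρ (ket x)) u v =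
      if ((∀ w, w ∉ Set.range C.inp → u w = false) ∧ ∀ a, u (C.inp (.inr a)) = x a) ∧
        ((∀ w, w ∉ Set.range C.inp → v w = false) ∧ ∀ a, v (C.inp (.inr a)) = x a) then
        ρ (fun a => u (C.inp (.inl a))) fun a => v (C.inp (.inl a)) else 0 := by
  rw [load_apply, tensor_ket_apply, ← ite_and]
  refine if_congr ?_ rfl rfl
  simp only [funext_iff, Function.comp_apply]
  tauto

theorem maskInput_run [Fintype V] (f : V ↪ K) (mask : Bits K) (ρ : Op M) (x : Bits V) :
    (maskInput G f mask).run (tensor ρ (ket x)) =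
      G.run (tensor ρ (ket (xorBits (Function.extend f x fun _ => false) mask))) := by
  classical
  have hU : gatesUnitary (maskGates G mask ++ G.gates) =
      G.unitary * gatesUnitary (maskGates G mask) := gatesUnitary_append _ _
  let σ : Op G.Wire := (maskInput G f mask).load (tensor ρ (ket x))
  have hkey : gatesUnitary (maskGates G mask) * σ * (gatesUnitary (maskGates G mask)).conjTranspose =
      G.load (tensor ρ (ket (xorBits (Function.extend f x fun _ => false) mask))) := by
    refine (maskGates_conj G mask _).trans ?_
    ext u v
    rw [Matrix.submatrix_apply]
    refine (load_tensor_ket (maskInput G f mask) ρ x _ _).trans ?_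
    rw [load_tensor_ket]
    have hfit : ∀ u : Bits G.Wire,
        ((∀ w, w ∉ Set.range (maskInput G f mask).inp → maskShift G mask u w = false) ∧
          ∀ a, maskShift G mask u ((maskInput G f mask).inp (.inr a)) = x a) ↔
        ((∀ w, w ∉ Set.range G.inp → u w = false) ∧
          ∀ a, u (G.inp (.inr a)) = xorBits (Function.extend f x fun _ => false) mask a) := by
      intro u
      constructor
      · rintro ⟨h1, h2⟩
        constructor
        · intro w hw
          have h := h1 w (by rintro ⟨a, rfl⟩; exact hw ⟨_, rfl⟩)
          rwa [maskShift_of_ne G mask u w (by rintro a rfl; exact hw ⟨_, rfl⟩)] at h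
        · intro a
          have h3 : maskShift G mask u (G.inp (.inr a)) = Function.extend f x (fun _ => false) a := by
            by_cases ha : ∃ b, f b = a
            · obtain ⟨b, rfl⟩ := ha
              rw [f.injective.extend_apply]
              exact h2 b
            · rw [Function.extend_apply' _ _ _ ha]
              refine h1 _ ?_
              rintro ⟨b | b, hb⟩
              · have := G.inp.injective hb
                cases this
              · exact ha ⟨b, Sum.inr_injective (G.inp.injective hb)⟩
          rw [maskShift_inr] at h3
          rw [xorBits, ← h3, Bool.xor_assoc, Bool.xor_self, Bool.xor_false]
      · rintro ⟨h1, h2⟩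
        have h3 : ∀ a, maskShift G mask u (G.inp (.inr a))
            = Function.extend f x (fun _ => false) a := by
          intro a
          rw [maskShift_inr, h2, xorBits, Bool.xor_assoc, Bool.xor_self, Bool.xor_false]
        constructor
        · intro w hw
          by_cases hw' : w ∈ Set.range G.inp
          · obtain ⟨a | a, rfl⟩ := hw'
            · exact absurd ⟨.inl a, rfl⟩ hw
            · rw [h3]
              refine Function.extend_apply' _ _ _ ?_
              rintro ⟨b, rfl⟩
              exact hw ⟨.inr b, rfl⟩
          · rw [maskShift_of_ne G mask u w (by rintro a rfl; exact hw' ⟨_, rfl⟩)]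
            exact h1 w hw'
        · intro b
          exact (h3 (f b)).trans (f.injective.extend_apply _ _ _)
    have hmem : ∀ u : Bits G.Wire,
        (fun a => maskShift G mask u ((maskInput G f mask).inp (.inl a))) =
          fun a => u (G.inp (.inl a)) := by
      intro u
      funext a
      exact maskShift_of_ne G mask u _ fun b h => by
        have := G.inp.injective h
        cases this
    exact ite_eq_ite (and_congr (hfit u) (hfit v)) (congr (congrArg ρ (hmem u)) (hmem v))
  have hrun : (maskInput G f mask).run (tensor ρ (ket x)) =
      G.traceOut (gatesUnitary (maskGates G mask ++ G.gates) * σ *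
        (gatesUnitary (maskGates G mask ++ G.gates)).conjTranspose) := rfl
  rw [hrun, hU, run, ← hkey, Matrix.conjTranspose_mul]
  simp only [Matrix.mul_assoc]

theorem maskInput_size [Fintype M] (f : V ↪ K) (mask : Bits K) :
    (maskInput G f mask).size ≤ 7 * G.size := by
  have h1 : Fintype.card (maskInput G f mask).Wire = Fintype.card G.Wire := rfl
  have h2 : (maskInput G f mask).gates.length ≤ 6 * Fintype.card K + G.gates.length := by
    have : (maskGates G mask).length ≤ 6 * Fintype.card K := by
      simp only [maskGates, List.length_flatMap, notGates, List.length_append, List.length_singleton,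
        List.length_replicate, List.map_const', List.sum_replicate, Finset.length_toList, smul_eq_mul]
      have := Finset.card_le_univ (Finset.univ.filter fun a => mask a = true)
      omega
    rw [maskInput, List.length_append]
    omega
  have h3 : Fintype.card K ≤ Fintype.card G.Wire :=
    Fintype.card_le_of_embedding (Function.Embedding.inr.trans G.inp)
  simp only [size, h1]
  omega

end Mask

end Circuit

/-! ### Negligible functions -/

theorem Negligible.of_abs_le {f g : ℕ → ℝ} (hg : Negligible g) (h : ∀ n, |f n| ≤ |g n|) :
    Negligible f :=
  SuperpolynomialDecay.trans_abs_le hg h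

theorem Negligible.abs {f : ℕ → ℝ} (hf : Negligible f) : Negligible fun n => |f n| :=
  hf.of_abs_le fun n => by simp

theorem Negligible.add {f g : ℕ → ℝ} (hf : Negligible f) (hg : Negligible g) :
    Negligible fun n => f n + g n :=
  SuperpolynomialDecay.add hf hg

theorem Negligible.natCast_mul {f : ℕ → ℝ} (hf : Negligible f) : Negligible fun n => n * f n :=
  SuperpolynomialDecay.param_mul hf

theorem Negligible.polyBounded_mul {f : ℕ → ℝ} {q : ℕ → ℕ} (hf : Negligible f)
    (hq : PolyBounded q) : Negligible fun n => q n * f n := by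
  obtain ⟨p, hp⟩ := hq
  refine (SuperpolynomialDecay.polynomial_mul hf (p.map (Nat.castRingHom ℝ))).trans_abs_le
    fun n => ?_
  rw [abs_mul, abs_mul]
  refine mul_le_mul_of_nonneg_right ?_ (abs_nonneg _)
  have h : (p.map (Nat.castRingHom ℝ)).eval (n : ℝ) = ((p.eval n : ℕ) : ℝ) := by
    simp
  rw [h, Nat.abs_cast, Nat.abs_cast]
  exact_mod_cast hp n

theorem negligible_unif {m : ℕ → ℕ}
    (hm : (fun n : ℕ => Real.log n) =o[atTop] fun n : ℕ => (m n : ℝ)) :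
    Negligible fun n => unif (Fin (m n)) := by
  intro d
  have hlog2 : 0 < Real.log 2 := Real.log_pos (by norm_num)
  have hev := hm.bound (c := Real.log 2 / (d + 1)) (by positivity)
  refine squeeze_zero' (Eventually.of_forall fun n => ?_) ?_
    (tendsto_inv_atTop_zero.comp (tendsto_natCast_atTop_atTop (R := ℝ)))
  · exact mul_nonneg (by positivity) (unif_nonneg _)
  · filter_upwards [hev, eventually_ge_atTop 1] with n hn h1
    have hn0 : (0 : ℝ) < n := by exact_mod_cast h1
    have hlog : 0 ≤ Real.log n := Real.log_natCast_nonneg n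
    rw [Real.norm_of_nonneg hlog, Real.norm_of_nonneg (by positivity), div_mul_eq_mul_div,
      le_div_iff₀ (by positivity)] at hn
    have hpow : (n : ℝ) ^ (d + 1) ≤ 2 ^ (m n) := by
      rw [← Real.log_le_log_iff (by positivity) (by positivity), Real.log_pow, Real.log_pow]
      push_cast
      linarith
    simp only [Function.comp_apply, unif, Fintype.card_fin]
    rw [← div_eq_mul_inv, div_le_iff₀ (by positivity), inv_mul_eq_div, le_div_iff₀ hn0,
      ← pow_succ]
    exact hpow

/-- If the values along every family of choices are negligibly bounded, then so are all values,
uniformly in the choices. -/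
theorem exists_negligible_of_families {α : ℕ → Type} [∀ n, Finite (α n)] (v : ∀ n, α n → ℝ)
    (h : ∀ c : ∀ n, Option (α n), ∃ ε, Negligible ε ∧ ∀ n a, c n = some a → v n a ≤ ε n) :
    ∃ ε, Negligible ε ∧ (∀ n, 0 ≤ ε n) ∧ ∀ n a, v n a ≤ ε n := by
  have hmax : ∀ n, ∃ c : Option (α n), ∀ a, ∃ a', c = some a' ∧ v n a ≤ v n a' := by
    intro n
    by_cases hne : Nonempty (α n)
    · obtain ⟨a', ha'⟩ := Finite.exists_max (v n)
      exact ⟨some a', fun a => ⟨a', rfl, ha' a⟩⟩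
    · exact ⟨none, fun a => absurd ⟨a⟩ hne⟩
  choose c hc using hmax
  obtain ⟨ε, hε, hle⟩ := h c
  refine ⟨fun n => |ε n|, hε.abs, fun n => abs_nonneg _, fun n a => ?_⟩
  obtain ⟨a', h1, h2⟩ := hc n a
  exact h2.trans ((hle n a' h1).trans (le_abs_self _))

/-! ### Hybrids and collisions -/

theorem sum_fin_cons {α : Type*} [Fintype α] {n : ℕ} (f : (Fin (n + 1) → α) → ℝ) :
    ∑ Y, f Y = ∑ z : α, ∑ Y : Fin n → α, f (Fin.cons z Y) := by
  rw [← Fintype.sum_prod_type']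
  exact (Equiv.sum_comp (Fin.consEquiv fun _ => α) f).symm

/-- Hybrid argument: if replacing a single factor changes the expectation by at most `B`, then
replacing all `n` factors changes it by at most `n * B`. -/
theorem abs_sum_prod_sub_le {α : Type*} [Fintype α] (P U : α → ℝ) (hP : ∀ a, 0 ≤ P a)
    (hU : ∀ a, 0 ≤ U a) (sP : ∑ a, P a = 1) (sU : ∑ a, U a = 1) (B : ℝ) {n : ℕ}
    (g : (Fin n → α) → ℝ)
    (hg : ∀ i Y, |∑ z, (P z - U z) * g (Function.update Y i z)| ≤ B) :
    |∑ Y : Fin n → α, (∏ i, P (Y i) - ∏ i, U (Y i)) * g Y| ≤ n * B := by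
  induction n with
  | zero => simp
  | succ n ih =>
    have hsplit : ∑ Y : Fin (n + 1) → α, (∏ i, P (Y i) - ∏ i, U (Y i)) * g Y =
        ∑ Y : Fin n → α, (∏ i, P (Y i)) * ∑ z, (P z - U z) * g (Fin.cons z Y) +
        ∑ z, U z * ∑ Y : Fin n → α, (∏ i, P (Y i) - ∏ i, U (Y i)) * g (Fin.cons z Y) := by
      rw [sum_fin_cons]
      simp_rw [Finset.mul_sum]
      rw [Finset.sum_comm (s := (Finset.univ : Finset (Fin n → α))), ← Finset.sum_add_distrib]
      refine Finset.sum_congr rfl fun z _ => ?_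
      rw [← Finset.sum_add_distrib]
      refine Finset.sum_congr rfl fun Y _ => ?_
      simp only [Fin.prod_univ_succ, Fin.cons_zero, Fin.cons_succ]
      ring
    have h1 : |∑ Y : Fin n → α, (∏ i, P (Y i)) * ∑ z, (P z - U z) * g (Fin.cons z Y)| ≤ B := by
      have hsum : ∑ Y : Fin n → α, ∏ i, P (Y i) = 1 := by
        rw [sum_pi_prod fun _ => P]
        simp [sP]
      calc _ ≤ ∑ Y : Fin n → α, (∏ i, P (Y i)) * B := by
            refine (Finset.abs_sum_le_sum_abs _ _).trans (Finset.sum_le_sum fun Y _ => ?_)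
            have hnn : 0 ≤ ∏ i, P (Y i) := Finset.prod_nonneg fun i _ => hP _
            rw [abs_mul, abs_of_nonneg hnn]
            refine mul_le_mul_of_nonneg_left ?_ hnn
            by_cases hα : Nonempty α
            · obtain ⟨z₀⟩ := hα
              have := hg 0 (Fin.cons z₀ Y)
              simpa only [Fin.update_cons_zero] using this
            · have : IsEmpty α := not_nonempty_iff.1 hα
              simp at sP
        _ = B := by rw [← Finset.sum_mul, hsum, one_mul]
    have h2 : |∑ z, U z * ∑ Y : Fin n → α, (∏ i, P (Y i) - ∏ i, U (Y i)) * g (Fin.cons z Y)|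
        ≤ n * B := by
      calc _ ≤ ∑ z, U z * (n * B) := by
            refine (Finset.abs_sum_le_sum_abs _ _).trans (Finset.sum_le_sum fun z _ => ?_)
            rw [abs_mul, abs_of_nonneg (hU z)]
            refine mul_le_mul_of_nonneg_left (ih _ fun i Y => ?_) (hU z)
            have := hg i.succ (Fin.cons z Y)
            simpa only [← Fin.cons_update] using this
        _ = n * B := by rw [← Finset.sum_mul, sU, one_mul]
    rw [hsplit]
    refine (abs_add_le _ _).trans ?_
    push_cast
    linarith

theorem sum_prod_unif_eq (Q : ℕ) (I : Type) [Fintype I] [DecidableEq I] :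
    ∑ _r : Fin Q → Bits I, ∏ _j : Fin Q, unif I = 1 := by
  rw [sum_pi_prod fun _ _ => unif I, sum_unif, Finset.prod_const_one]

theorem sum_collision_pair {Q : ℕ} {I : Type} [Fintype I] [DecidableEq I] {j j' : Fin Q}
    (h : j ≠ j') :
    ∑ r : Fin Q → Bits I, (∏ _j : Fin Q, unif I) * (if r j = r j' then 1 else 0) = unif I := by
  have hpt : ∀ r : Fin Q → Bits I, (∏ _j : Fin Q, unif I) * (if r j = r j' then (1 : ℝ) else 0) =
      ∑ x : Bits I, ∏ i, (unif I * if i ∈ ({j, j'} : Finset (Fin Q)) then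
        (if r i = x then 1 else 0) else 1) := by
    intro r
    simp_rw [Finset.prod_mul_distrib, ← Finset.mul_sum]
    congr 1
    simp_rw [Finset.prod_ite_mem, Finset.univ_inter, Finset.prod_pair h]
    rw [Finset.sum_eq_single (r j)]
    · simp [eq_comm]
    · intro x _ hx
      simp [hx.symm]
    · simp
  simp_rw [hpt]
  rw [Finset.sum_comm]
  have hx : ∀ x : Bits I, ∑ r : Fin Q → Bits I, ∏ i, (unif I *
      if i ∈ ({j, j'} : Finset (Fin Q)) then (if r i = x then 1 else 0) else 1) =
      unif I * unif I := by
    intro x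
    rw [sum_pi_prod fun i z => unif I *
      if i ∈ ({j, j'} : Finset (Fin Q)) then (if z = x then 1 else 0) else 1]
    have : ∀ i : Fin Q, ∑ z : Bits I, (unif I *
        if i ∈ ({j, j'} : Finset (Fin Q)) then (if z = x then 1 else 0) else 1) =
        if i ∈ ({j, j'} : Finset (Fin Q)) then unif I else 1 := by
      intro i
      split_ifs
      · simp
      · simp_rw [mul_one]
        exact sum_unif I
    simp_rw [this]
    rw [Finset.prod_ite_mem, Finset.univ_inter, Finset.prod_pair h]
  simp_rw [hx]
  rw [← Finset.sum_mul, sum_unif, one_mul]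

open Classical in
theorem collision_le (Q : ℕ) (I : Type) [Fintype I] [DecidableEq I] :
    ∑ r : Fin Q → Bits I, (∏ _j : Fin Q, unif I) * (if Function.Injective r then 0 else 1)
      ≤ Q * Q * unif I := by
  have hu := unif_nonneg I
  have hpt : ∀ r : Fin Q → Bits I, (∏ _j : Fin Q, unif I) *
      (if Function.Injective r then (0 : ℝ) else 1) ≤ ∑ j : Fin Q, ∑ j' : Fin Q,
        (if j = j' then 0 else (∏ _j : Fin Q, unif I) * (if r j = r j' then 1 else 0)) := by
    intro r
    have hp : 0 ≤ ∏ _j : Fin Q, unif I := Finset.prod_nonneg fun _ _ => hu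
    have hnn : ∀ j j' : Fin Q, 0 ≤ (if j = j' then 0 else (∏ _j : Fin Q, unif I) *
        (if r j = r j' then (1 : ℝ) else 0)) := by
      intro j j'
      split_ifs
      · exact le_rfl
      · rwa [mul_one]
      · rw [mul_zero]
    split_ifs with hr
    · rw [mul_zero]
      exact Finset.sum_nonneg fun j _ => Finset.sum_nonneg fun j' _ => hnn j j'
    · simp only [Function.Injective, not_forall] at hr
      obtain ⟨j, j', h1, h2⟩ := hr
      refine le_trans ?_ (Finset.single_le_sum (f := fun j => ∑ j' : Fin Q, (if j = j' then 0 else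
        (∏ _j : Fin Q, unif I) * (if r j = r j' then (1 : ℝ) else 0)))
        (fun j _ => Finset.sum_nonneg fun j' _ => hnn j j') (Finset.mem_univ j))
      refine le_trans ?_ (Finset.single_le_sum (fun j' _ => hnn j j') (Finset.mem_univ j'))
      simp [h1, h2]
  refine (Finset.sum_le_sum fun r _ => hpt r).trans ?_
  rw [Finset.sum_comm]
  have hj : ∀ j : Fin Q, ∑ r : Fin Q → Bits I, ∑ j' : Fin Q, (if j = j' then 0 else
      (∏ _j : Fin Q, unif I) * (if r j = r j' then (1 : ℝ) else 0)) ≤ Q * unif I := by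
    intro j
    rw [Finset.sum_comm]
    refine (Finset.sum_le_sum (g := fun _ => unif I) fun j' _ => ?_).trans (by simp)
    by_cases h : j = j'
    · simp [h, hu]
    · simp only [h, if_false]
      exact (sum_collision_pair h).le
  refine (Finset.sum_le_sum fun j _ => hj j).trans ?_
  simp [mul_assoc]

/-! ### The joint distribution of the ciphertexts -/

section Ciphertexts

variable {m ℓ : ℕ → ℕ} {F : KeyedFun m ℓ}

/-- The distribution of the values of `F` on the inputs `r` under one uniform key. -/
def outDist (F : KeyedFun m ℓ) (n : ℕ) {Q : ℕ} (r : Fin Q → Bits (Fin (m n)))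
    (Y : Fin Q → Bits (Fin (ℓ n))) : ℝ :=
  ∑ k : Bits (Fin n), unif (Fin n) * ∏ j, F n k (r j) (Y j)

theorem outDist_nonneg (hF : F.QPT) (n : ℕ) {Q : ℕ} (r : Fin Q → Bits (Fin (m n)))
    (Y : Fin Q → Bits (Fin (ℓ n))) : 0 ≤ outDist F n r Y :=
  Finset.sum_nonneg fun _ _ => mul_nonneg (unif_nonneg _) <|
    Finset.prod_nonneg fun _ _ => hF.nonneg _ _ _ _

theorem sum_outDist (hF : F.QPT) (n : ℕ) {Q : ℕ} (r : Fin Q → Bits (Fin (m n))) :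
    ∑ Y : Fin Q → Bits (Fin (ℓ n)), outDist F n r Y = 1 := by
  simp only [outDist]
  rw [Finset.sum_comm]
  have : ∀ k : Bits (Fin n), ∑ Y : Fin Q → Bits (Fin (ℓ n)), ∏ j, F n k (r j) (Y j) = 1 := by
    intro k
    rw [sum_pi_prod fun j y => F n k (r j) y]
    simp [hF.sum_eq_one]
  refine (Finset.sum_congr rfl fun k _ => ?_).trans (sum_unif (Fin n))
  rw [← Finset.mul_sum, this, mul_one]

/-- The ciphertexts of the messages `msg` with nonces `r` and values `Y` of `F`. -/
def ciphertexts {n Q : ℕ} (r : Fin Q → Bits (Fin (m n))) (msg : Fin Q → Bits (Fin (ℓ n)))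
    (Y : Fin n → Fin Q → Bits (Fin (ℓ n))) : Bits (Fin Q × CtReg m ℓ n) :=
  fun p => (mkCt (r p.1) fun i => xorBits (msg p.1) (Y i p.1) : Bits (CtReg m ℓ n)) p.2

theorem enc_prod_sum {n Q : ℕ} (k : Bits (KeyReg n)) (msg : Fin Q → Bits (Fin (ℓ n)))
    (h : (Fin Q → Bits (CtReg m ℓ n)) → ℝ) :
    ∑ c : Fin Q → Bits (CtReg m ℓ n), (∏ j, (ske F).Enc n k (msg j) (c j)) * h c =
    ∑ r : Fin Q → Bits (Fin (m n)), ∑ y : Fin Q → Fin n → Bits (Fin (ℓ n)),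
      (∏ j, (unif (Fin (m n)) * ∏ i, F n (fun t => k (i, t)) (r j) (y j i))) *
        h fun j => mkCt (r j) fun i => xorBits (msg j) (y j i) := by
  let w : Bits (Fin (m n)) × (Fin n → Bits (Fin (ℓ n))) → ℝ := fun a =>
    unif (Fin (m n)) * ∏ i, F n (fun t => k (i, t)) a.1 (a.2 i)
  let φ : Fin Q → Bits (Fin (m n)) × (Fin n → Bits (Fin (ℓ n))) → Bits (CtReg m ℓ n) := fun j a =>
    mkCt a.1 fun i => xorBits (msg j) (a.2 i)
  have hEnc : ∀ j c, (ske F).Enc n k (msg j) c = ∑ a, w a * if c = φ j a then 1 else 0 := by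
    intro j c
    rw [Fintype.sum_prod_type]
    simp only [ske, w, φ, Finset.mul_sum, mul_assoc]
  have hprod : ∀ c : Fin Q → Bits (CtReg m ℓ n), ∏ j, (ske F).Enc n k (msg j) (c j) =
      ∑ a : Fin Q → Bits (Fin (m n)) × (Fin n → Bits (Fin (ℓ n))),
        (∏ j, w (a j)) * if c = (fun j => φ j (a j)) then 1 else 0 := by
    intro c
    simp_rw [hEnc]
    rw [← sum_pi_prod fun j a => w a * if c j = φ j a then 1 else 0]
    refine Finset.sum_congr rfl fun a _ => ?_
    rw [Finset.prod_mul_distrib, Finset.prod_ite_zero]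
    simp [funext_iff]
  simp_rw [hprod, Finset.sum_mul]
  rw [Finset.sum_comm]
  simp_rw [mul_assoc, ← Finset.mul_sum, sum_det_mul]
  rw [← Fintype.sum_prod_type']
  exact Fintype.sum_equiv (Equiv.arrowProdEquivProdArrow (Fin Q) (fun _ => Bits (Fin (m n)))
    (fun _ => Fin n → Bits (Fin (ℓ n)))) _ _ fun a => rfl

theorem sum_key_enc {n Q : ℕ} (msg : Fin Q → Bits (Fin (ℓ n)))
    (h : Bits (Fin Q × CtReg m ℓ n) → ℝ) :
    ∑ k : Bits (KeyReg n), unif (KeyReg n) * ∑ c : Fin Q → Bits (CtReg m ℓ n),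
      (∏ j, (ske F).Enc n k (msg j) (c j)) * h (fun p => c p.1 p.2) =
    ∑ r : Fin Q → Bits (Fin (m n)), (∏ _j : Fin Q, unif (Fin (m n))) *
      ∑ Y : Fin n → Fin Q → Bits (Fin (ℓ n)), (∏ i, outDist F n r (Y i)) *
        h (ciphertexts r msg Y) := by
  simp_rw [enc_prod_sum _ msg fun c => h fun p => c p.1 p.2, Finset.mul_sum]
  rw [Finset.sum_comm]
  refine Finset.sum_congr rfl fun r _ => ?_
  rw [Finset.sum_comm]
  refine Fintype.sum_equiv (Equiv.piComm fun (_ : Fin Q) (_ : Fin n) => Bits (Fin (ℓ n))) _ _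
    fun y => ?_
  have hY : ∏ i, outDist F n r ((Equiv.piComm fun (_ : Fin Q) (_ : Fin n) => Bits (Fin (ℓ n))) y i)
      = ∑ k : Bits (KeyReg n), unif (KeyReg n) *
        ∏ j, ∏ i, F n (fun t => k (i, t)) (r j) (y j i) := by
    change ∏ i, ∑ k : Bits (Fin n), unif (Fin n) * ∏ j, F n k (r j) (y j i) = _
    rw [← sum_pi_prod fun i (k : Bits (Fin n)) => unif (Fin n) * ∏ j, F n k (r j) (y j i),
      sum_bits_prod]
    refine Finset.sum_congr rfl fun κ _ => ?_
    rw [Finset.prod_mul_distrib, unif_prod, Finset.prod_comm]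
  rw [hY, Finset.sum_mul, Finset.mul_sum]
  refine Finset.sum_congr rfl fun k _ => ?_
  rw [Finset.prod_mul_distrib]
  have hc : (ciphertexts r msg ((Equiv.piComm fun (_ : Fin Q) (_ : Fin n) => Bits (Fin (ℓ n))) y) :
    Bits (Fin Q × CtReg m ℓ n)) =
      fun p => (mkCt (r p.1) fun i => xorBits (msg p.1) (y p.1 i) : Bits (CtReg m ℓ n)) p.2 := rfl
  rw [hc]
  ring

end Ciphertexts

/-! ### The adversary -/

section Security

variable {m ℓ q : ℕ → ℕ} {F : KeyedFun m ℓ}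
  (A : CPAAdversary q (fun n => Fin (ℓ n)) (CtReg m ℓ)) (n : ℕ)

/-- The unnormalized memory of the adversary after choosing the messages `msgs`. -/
def memState (msgs : Bits (Fin (q n) × Bool × Fin (ℓ n))) : Op (Fin (A.memLen n)) :=
  afterOutcome ((A.choose n).run (A.advice n)) msgs

/-- The probability that the adversary chooses the messages `msgs`. -/
def msgsProb (msgs : Bits (Fin (q n) × Bool × Fin (ℓ n))) : ℝ := (memState A n msgs).trace.re

/-- The joint probability of choosing `msgs` and then guessing `b` on the ciphertexts `c`. -/
def guessProb (b : Bool) (msgs : Bits (Fin (q n) × Bool × Fin (ℓ n)))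
    (c : Bits (Fin (q n) × CtReg m ℓ n)) : ℝ :=
  measure ((A.guess n).run (tensor (memState A n msgs) (ket c))) fun _ => b

theorem memState_posSemidef (msgs : Bits (Fin (q n) × Bool × Fin (ℓ n))) :
    (memState A n msgs).PosSemidef :=
  afterOutcome_posSemidef ((A.choose n).run_posSemidef (A.isDensity n).posSemidef) msgs

theorem msgsProb_nonneg (msgs : Bits (Fin (q n) × Bool × Fin (ℓ n))) : 0 ≤ msgsProb A n msgs :=
  (Complex.le_def.1 (memState_posSemidef A n msgs).trace_nonneg).1

theorem memState_trace (msgs : Bits (Fin (q n) × Bool × Fin (ℓ n))) :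
    (memState A n msgs).trace = (msgsProb A n msgs : ℂ) :=
  Complex.ext rfl (Complex.le_def.1 (memState_posSemidef A n msgs).trace_nonneg).2.symm

theorem sum_msgsProb : ∑ msgs, msgsProb A n msgs = 1 := by
  simp only [msgsProb]
  rw [← Complex.re_sum]
  simp only [memState]
  rw [sum_afterOutcome_trace, Circuit.run_trace, (A.isDensity n).trace_eq_one, Complex.one_re]

theorem guessProb_nonneg (b : Bool) (msgs : Bits (Fin (q n) × Bool × Fin (ℓ n)))
    (c : Bits (Fin (q n) × CtReg m ℓ n)) : 0 ≤ guessProb A n b msgs c :=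
  measure_nonneg ((A.guess n).run_posSemidef
    (tensor_ket_posSemidef (memState_posSemidef A n msgs) c)) _

theorem guessProb_true_add_false (msgs : Bits (Fin (q n) × Bool × Fin (ℓ n)))
    (c : Bits (Fin (q n) × CtReg m ℓ n)) :
    guessProb A n true msgs c + guessProb A n false msgs c = msgsProb A n msgs := by
  rw [guessProb, guessProb, measure_true_add_false, Circuit.run_trace, tensor_ket_trace, msgsProb]

theorem guessProb_le (b : Bool) (msgs : Bits (Fin (q n) × Bool × Fin (ℓ n)))
    (c : Bits (Fin (q n) × CtReg m ℓ n)) : guessProb A n b msgs c ≤ msgsProb A n msgs := by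
  have h := guessProb_true_add_false A n msgs c
  have h1 := guessProb_nonneg A n true msgs c
  have h2 := guessProb_nonneg A n false msgs c
  cases b <;> linarith

/-- Probability of choosing `msgs` and winning with challenge bit `b` on nonces `r`, when the values
of all blocks are distributed according to `D`. -/
def winWith (D : (Fin (q n) → Bits (Fin (ℓ n))) → ℝ) (b : Bool)
    (msgs : Bits (Fin (q n) × Bool × Fin (ℓ n))) (r : Fin (q n) → Bits (Fin (m n))) : ℝ :=
  ∑ Y : Fin n → Fin (q n) → Bits (Fin (ℓ n)), (∏ i, D (Y i)) *
    guessProb A n b msgs (ciphertexts r (fun j t => msgs (j, b, t)) Y)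

theorem cpaWin_eq : (ske F).cpaWin A n = ∑ b : Bool, (1 / 2) * ∑ msgs,
    ∑ r : Fin (q n) → Bits (Fin (m n)), (∏ _j : Fin (q n), unif (Fin (m n))) *
      winWith A n (outDist F n r) b msgs r := by
  unfold Scheme.cpaWin
  refine Finset.sum_congr rfl fun b _ => ?_
  congr 1
  simp only [Finset.mul_sum (s := (Finset.univ : Finset (Bits (Fin (q n) × Bool × Fin (ℓ n)))))]
  rw [Finset.sum_comm]
  refine Finset.sum_congr rfl fun msgs _ => ?_
  exact sum_key_enc (fun j t => msgs (j, b, t)) (guessProb A n b msgs)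

/-- The uniform distribution on lists of strings. -/
def unifDist (Q L : ℕ) (_Y : Fin Q → Bits (Fin L)) : ℝ := ∏ _j : Fin Q, unif (Fin L)

theorem unifDist_nonneg (Q L : ℕ) (Y : Fin Q → Bits (Fin L)) : 0 ≤ unifDist Q L Y :=
  Finset.prod_nonneg fun _ _ => unif_nonneg _

theorem sum_unifDist (Q L : ℕ) : ∑ Y, unifDist Q L Y = 1 := sum_prod_unif_eq Q (Fin L)

theorem sum_winWith_unif (r : Fin (q n) → Bits (Fin (m n)))
    (msgs : Bits (Fin (q n) × Bool × Fin (ℓ n))) :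
    ∑ b : Bool, winWith A n (unifDist (q n) (ℓ n)) b msgs r = msgsProb A n msgs := by
  have hshift : ∀ b, winWith A n (unifDist (q n) (ℓ n)) b msgs r =
      ∑ Y : Fin n → Fin (q n) → Bits (Fin (ℓ n)), (∏ i, unifDist (q n) (ℓ n) (Y i)) *
        guessProb A n b msgs (ciphertexts r (fun _ _ => false) Y) := by
    intro b
    let e : (Fin n → Fin (q n) → Bits (Fin (ℓ n))) ≃ (Fin n → Fin (q n) → Bits (Fin (ℓ n))) :=
      Function.Involutive.toPerm
        (fun Y i j t => xor (msgs (j, b, t)) (Y i j t)) fun Y => by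
          funext i j t
          simp
    have hc : ∀ Y, ciphertexts (m := m) r (fun j t => msgs (j, b, t)) Y =
        ciphertexts r (fun _ _ => false) (e Y) := by
      intro Y
      funext ⟨j, p⟩
      rcases p with t | ⟨i, t⟩
      · rfl
      · change xor (msgs (j, b, t)) (Y i j t) = xor false (xor (msgs (j, b, t)) (Y i j t))
        rw [Bool.false_xor]
    simp only [winWith, hc, unifDist]
    exact Equiv.sum_comp e fun Y => (∏ _i : Fin n, ∏ _j : Fin (q n), unif (Fin (ℓ n))) *
      guessProb A n b msgs (ciphertexts r (fun _ _ => false) Y)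
  rw [Fintype.sum_bool, hshift, hshift, ← Finset.sum_add_distrib]
  refine (Finset.sum_congr rfl fun Y _ => by
    rw [← mul_add, guessProb_true_add_false]).trans ?_
  rw [← Finset.sum_mul, sum_pi_prod fun _ => unifDist (q n) (ℓ n)]
  simp [sum_unifDist]

/-! ### The distinguisher -/

/-- The positions of the nonces and of block `i` among the ciphertexts. -/
def viewEmb (m ℓ q : ℕ → ℕ) {n : ℕ} (i : Fin n) :
    KeyedFun.ViewReg m ℓ q n ↪ Fin (q n) × CtReg m ℓ n where
  toFun := Sum.elim (fun p => (p.1, .inl p.2)) fun p => (p.1, .inr (i, p.2))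
  inj' := by
    rintro (⟨j, t⟩ | ⟨j, t⟩) (⟨j', t'⟩ | ⟨j', t'⟩) h <;> simp_all

/-- What is fixed in one hybrid step: the block that is replaced, the messages, the nonces, and the
strings added to the challenge. -/
abbrev HybridChoice (n : ℕ) : Type :=
  Fin n × {msgs : Bits (Fin (q n) × Bool × Fin (ℓ n)) // msgsProb A n msgs ≠ 0} ×
    {r : Fin (q n) → Bits (Fin (m n)) // Function.Injective r} × Bits (Fin (q n) × CtReg m ℓ n)

/-- A circuit without gates, with constant output. -/
def constCircuit (I : Type) [Fintype I] [DecidableEq I] : Circuit I Unit where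
  Wire := I ⊕ Unit
  gates := []
  inp := .inl
  out := .inr

/-- The ciphertexts simulated from the challenge `Z`. -/
def simulated {n : ℕ} (i : Fin n) (r : Fin (q n) → Bits (Fin (m n)))
    (mask : Bits (Fin (q n) × CtReg m ℓ n)) (Z : Fin (q n) → Bits (Fin (ℓ n))) :
    Bits (Fin (q n) × CtReg m ℓ n) :=
  xorBits (Function.extend (viewEmb m ℓ q i) (KeyedFun.view r Z) fun _ => false) mask

theorem ket_isDensity {I : Type} [Fintype I] [DecidableEq I] (x : Bits I) : IsDensity (ket x) := by
  refine ⟨?_, by simp [ket]⟩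
  have h : ket x = Matrix.diagonal fun y => if y = x then (1 : ℂ) else 0 := by
    ext u v
    simp only [ket, Matrix.single_apply, Matrix.diagonal_apply]
    by_cases h1 : u = v
    · subst h1
      simp [eq_comm]
    · have : ¬ (x = u ∧ x = v) := fun h => h1 (h.1.symm.trans h.2)
      simp [h1, this]
  rw [h]
  refine Matrix.PosSemidef.diagonal fun y => ?_
  change (0 : ℂ) ≤ if y = x then 1 else 0
  split_ifs <;> simp

theorem isDensity_normalized (msgs : Bits (Fin (q n) × Bool × Fin (ℓ n)))
    (h : msgsProb A n msgs ≠ 0) :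
    IsDensity ((((msgsProb A n msgs)⁻¹ : ℝ) : ℂ) • memState A n msgs) := by
  constructor
  · refine (memState_posSemidef A n msgs).smul ?_
    exact_mod_cast inv_nonneg.2 (msgsProb_nonneg A n msgs)
  · rw [Matrix.trace_smul, memState_trace, smul_eq_mul, ← Complex.ofReal_mul, inv_mul_cancel₀ h,
      Complex.ofReal_one]

theorem polyBounded_memLen : PolyBounded A.memLen :=
  A.guess_polySize.mono fun n => by
    have h := Fintype.card_le_of_embedding (A.guess n).inp
    simp only [Fintype.card_sum, Fintype.card_fin] at h
    simp only [Circuit.size]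
    omega

/-- The distinguisher that simulates the adversary on given hybrid choices. -/
def hybridDistinguisher (hm : PolyBounded m) (hℓ : PolyBounded ℓ) (hq : PolyBounded q)
    (c : ∀ n, Option (HybridChoice A n)) : Distinguisher (KeyedFun.ViewReg m ℓ q) where
  advLen := A.memLen
  circuit n := (c n).elim (constCircuit _) fun a =>
    (A.guess n).maskInput (viewEmb m ℓ q a.1) a.2.2.2
  advice n := (c n).elim (ket fun _ => false) fun a =>
    (((msgsProb A n a.2.1.1)⁻¹ : ℝ) : ℂ) • memState A n a.2.1.1
  polySize := by
    have hc : PolyBounded fun n => 2 * (A.memLen n + (q n * m n + q n * ℓ n) + 1) :=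
      (PolyBounded.const 2).mul (((polyBounded_memLen A).add
        ((hq.mul hm).add (hq.mul hℓ))).add (PolyBounded.const 1))
    refine (hc.add ((PolyBounded.const 7).mul A.guess_polySize)).mono fun n => ?_
    cases c n with
    | none =>
      have h : (constCircuit (Fin (A.memLen n) ⊕ KeyedFun.ViewReg m ℓ q n)).size =
          2 * (A.memLen n + (q n * m n + q n * ℓ n) + 1) := by
        change 0 + Fintype.card ((Fin (A.memLen n) ⊕ KeyedFun.ViewReg m ℓ q n) ⊕ Unit) +
          Fintype.card ((Fin (A.memLen n) ⊕ KeyedFun.ViewReg m ℓ q n) ⊕ Unit) = _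
        simp only [Fintype.card_sum, Fintype.card_prod, Fintype.card_fin, Fintype.card_unit]
        ring
      simp only [Option.elim_none]
      omega
    | some a =>
      have h := (A.guess n).maskInput_size (viewEmb m ℓ q a.1) a.2.2.2
      simp only [Option.elim_some]
      omega
  isDensity n := by
    cases c n with
    | none => exact ket_isDensity _
    | some a => exact isDensity_normalized A n _ a.2.1.2

theorem hybridDistinguisher_accept (hm : PolyBounded m) (hℓ : PolyBounded ℓ) (hq : PolyBounded q)
    (c : ∀ n, Option (HybridChoice A n)) (a : HybridChoice A n) (hc : c n = some a)
    (Z : Fin (q n) → Bits (Fin (ℓ n))) :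
    (hybridDistinguisher A hm hℓ hq c).accept n (KeyedFun.view a.2.2.1.1 Z) =
      (msgsProb A n a.2.1.1)⁻¹ *
        guessProb A n true a.2.1.1 (simulated a.1 a.2.2.1.1 a.2.2.2 Z) := by
  have h1 : (hybridDistinguisher A hm hℓ hq c).accept n (KeyedFun.view a.2.2.1.1 Z) =
      measure (((A.guess n).maskInput (viewEmb m ℓ q a.1) a.2.2.2).run
        (tensor ((((msgsProb A n a.2.1.1)⁻¹ : ℝ) : ℂ) • memState A n a.2.1.1)
          (ket (KeyedFun.view a.2.2.1.1 Z)))) fun _ => true := by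
    simp only [Distinguisher.accept, hybridDistinguisher]
    rw [hc]
    rfl
  rw [h1, Circuit.maskInput_run, tensor_smul, Circuit.run_smul, measure_smul]
  rfl

/-- The normalized change of the acceptance probability in one hybrid step. -/
def hybridGap (F : KeyedFun m ℓ) (a : HybridChoice A n) : ℝ :=
  |∑ Z, (outDist F n a.2.2.1.1 Z - unifDist (q n) (ℓ n) Z) * ((msgsProb A n a.2.1.1)⁻¹ *
    guessProb A n true a.2.1.1 (simulated a.1 a.2.2.1.1 a.2.2.2 Z))|

theorem exists_hybridGap_le (hF : F.IsSelectivelySecureQPRF) (hq : PolyBounded q) :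
    ∃ δ, Negligible δ ∧ (∀ n, 0 ≤ δ n) ∧ ∀ n a, hybridGap A n F a ≤ δ n := by
  obtain ⟨hm, hℓ⟩ := hF.qpt.polyBounded
  refine exists_negligible_of_families _ fun c => ?_
  obtain ⟨ε, hε, hle⟩ := hF.selectivelySecure q hq (hybridDistinguisher A hm hℓ hq c) fun n =>
    (c n).elim (fun _ _ => false) fun a => a.2.2.1.1
  refine ⟨ε, hε, fun n a ha => ?_⟩
  have h := hle n
  rw [ha] at h
  refine le_trans (le_of_eq ?_) (h a.2.2.1.2)
  rw [hybridGap]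
  congr 1
  simp_rw [sub_mul, Finset.sum_sub_distrib]
  congr 1
  · simp only [Option.elim_some, KeyedFun.realAccept, outDist, Finset.sum_mul, Finset.mul_sum]
    rw [Finset.sum_comm]
    refine Finset.sum_congr rfl fun k _ => Finset.sum_congr rfl fun Z _ => ?_
    rw [hybridDistinguisher_accept A n hm hℓ hq c a ha, mul_assoc]
  · simp only [Option.elim_some, KeyedFun.idealAccept, unifDist]
    refine Finset.sum_congr rfl fun Z _ => ?_
    rw [hybridDistinguisher_accept A n hm hℓ hq c a ha]

theorem simulated_eq {n : ℕ} (i : Fin n) (r : Fin (q n) → Bits (Fin (m n)))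
    (msg : Fin (q n) → Bits (Fin (ℓ n))) (Y : Fin n → Fin (q n) → Bits (Fin (ℓ n)))
    (Z : Fin (q n) → Bits (Fin (ℓ n))) :
    simulated i r (fun p => Sum.elim (fun _ => false) (fun s => xor (msg p.1 s.2)
      (Function.update Y i (fun _ _ => false) s.1 p.1 s.2)) p.2) Z =
      ciphertexts r msg (Function.update Y i Z) := by
  funext ⟨j, p⟩
  have hx : ∀ s, Function.extend (viewEmb m ℓ q i) (KeyedFun.view r Z) (fun _ => false)
      (viewEmb m ℓ q i s) = KeyedFun.view r Z s := fun s =>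
    (viewEmb m ℓ q i).injective.extend_apply _ _ _
  rcases p with t | ⟨i', t⟩
  · have h := hx (.inl (j, t))
    change xor (Function.extend (viewEmb m ℓ q i) (KeyedFun.view r Z) (fun _ => false)
      (viewEmb m ℓ q i (.inl (j, t)))) false = r j t
    rw [h, Bool.xor_false]
    rfl
  · change xor (Function.extend (viewEmb m ℓ q i) (KeyedFun.view r Z) (fun _ => false)
      (j, .inr (i', t))) (xor (msg j t) (Function.update Y i (fun _ _ => false) i' j t)) =
      xor (msg j t) (Function.update Y i Z i' j t)
    by_cases e : i' = i
    · subst e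
      have h : Function.extend (viewEmb m ℓ q i') (KeyedFun.view r Z) (fun _ => false)
        (j, .inr (i', t)) = Z j t := hx (.inr (j, t))
      rw [h, Function.update_self, Function.update_self, Bool.xor_false, Bool.xor_comm]
    · rw [Function.extend_apply', Function.update_of_ne e, Function.update_of_ne e, Bool.false_xor]
      rintro ⟨s | s, hs⟩
      · have h : (Sum.inl s.2 : CtReg m ℓ n) = Sum.inr (i', t) := congrArg Prod.snd hs
        cases h
      · have h : (Sum.inr (i, s.2) : CtReg m ℓ n) = Sum.inr (i', t) := congrArg Prod.snd hs
        exact e (congrArg Prod.fst (Sum.inr_injective h)).symm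

theorem abs_hybrid_step_le (hF : F.QPT) {δ : ℝ} (hδ : ∀ a, hybridGap A n F a ≤ δ) (b : Bool)
    (msgs : Bits (Fin (q n) × Bool × Fin (ℓ n))) (r : Fin (q n) → Bits (Fin (m n)))
    (hr : Function.Injective r) (msg : Fin (q n) → Bits (Fin (ℓ n))) (i : Fin n)
    (Y : Fin n → Fin (q n) → Bits (Fin (ℓ n))) :
    |∑ Z, (outDist F n r Z - unifDist (q n) (ℓ n) Z) *
      guessProb A n b msgs (ciphertexts r msg (Function.update Y i Z))| ≤ δ * msgsProb A n msgs := by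
  by_cases h0 : msgsProb A n msgs = 0
  · have hz : ∀ c, guessProb A n b msgs c = 0 := fun c =>
      le_antisymm (h0 ▸ guessProb_le A n b msgs c) (guessProb_nonneg A n b msgs c)
    simp [hz, h0]
  · have hpos : 0 < msgsProb A n msgs := lt_of_le_of_ne (msgsProb_nonneg A n msgs) (Ne.symm h0)
    have htrue : |∑ Z, (outDist F n r Z - unifDist (q n) (ℓ n) Z) *
        guessProb A n true msgs (ciphertexts r msg (Function.update Y i Z))|
          ≤ δ * msgsProb A n msgs := by
      have h := hδ (i, ⟨msgs, h0⟩, ⟨r, hr⟩, fun p => Sum.elim (fun _ => false)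
        (fun s => xor (msg p.1 s.2) (Function.update Y i (fun _ _ => false) s.1 p.1 s.2)) p.2)
      simp only [hybridGap, simulated_eq] at h
      simp_rw [mul_left_comm _ (msgsProb A n msgs)⁻¹, ← Finset.mul_sum] at h
      rw [abs_mul, abs_of_pos (inv_pos.2 hpos), inv_mul_le_iff₀ hpos] at h
      linarith
    cases b with
    | true => exact htrue
    | false =>
      have hneg : ∑ Z, (outDist F n r Z - unifDist (q n) (ℓ n) Z) *
          guessProb A n false msgs (ciphertexts r msg (Function.update Y i Z)) =
          -∑ Z, (outDist F n r Z - unifDist (q n) (ℓ n) Z) *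
            guessProb A n true msgs (ciphertexts r msg (Function.update Y i Z)) := by
        have hsum : ∑ Z, (outDist F n r Z - unifDist (q n) (ℓ n) Z) * msgsProb A n msgs = 0 := by
          rw [← Finset.sum_mul, Finset.sum_sub_distrib, sum_outDist hF, sum_unifDist, sub_self,
            zero_mul]
        rw [eq_neg_iff_add_eq_zero, ← Finset.sum_add_distrib, ← hsum]
        refine Finset.sum_congr rfl fun Z _ => ?_
        rw [← guessProb_true_add_false A n msgs (ciphertexts r msg (Function.update Y i Z))]
        ring
      rw [hneg, abs_neg]
      exact htrue

theorem winWith_mem (D : (Fin (q n) → Bits (Fin (ℓ n))) → ℝ) (hD : ∀ Y, 0 ≤ D Y)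
    (sD : ∑ Y, D Y = 1) (b : Bool) (msgs : Bits (Fin (q n) × Bool × Fin (ℓ n)))
    (r : Fin (q n) → Bits (Fin (m n))) :
    0 ≤ winWith A n D b msgs r ∧ winWith A n D b msgs r ≤ msgsProb A n msgs := by
  have hnn : ∀ Y : Fin n → Fin (q n) → Bits (Fin (ℓ n)), 0 ≤ ∏ i, D (Y i) := fun Y =>
    Finset.prod_nonneg fun _ _ => hD _
  refine ⟨Finset.sum_nonneg fun Y _ => mul_nonneg (hnn Y) (guessProb_nonneg A n _ _ _), ?_⟩
  calc _ ≤ ∑ Y : Fin n → Fin (q n) → Bits (Fin (ℓ n)), (∏ i, D (Y i)) * msgsProb A n msgs :=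
        Finset.sum_le_sum fun Y _ => mul_le_mul_of_nonneg_left (guessProb_le A n _ _ _) (hnn Y)
    _ = msgsProb A n msgs := by
        rw [← Finset.sum_mul, sum_pi_prod fun _ => D]
        simp [sD]

open Classical in
theorem abs_winWith_sub_le (hF : F.QPT) {δ : ℝ} (h0 : 0 ≤ δ) (hδ : ∀ a, hybridGap A n F a ≤ δ)
    (b : Bool) (msgs : Bits (Fin (q n) × Bool × Fin (ℓ n))) (r : Fin (q n) → Bits (Fin (m n))) :
    |winWith A n (outDist F n r) b msgs r - winWith A n (unifDist (q n) (ℓ n)) b msgs r| ≤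
      (n * δ + if Function.Injective r then 0 else 1) * msgsProb A n msgs := by
  have hτ := msgsProb_nonneg A n msgs
  split_ifs with hr
  · rw [winWith, winWith, ← Finset.sum_sub_distrib]
    simp_rw [← sub_mul]
    refine (abs_sum_prod_sub_le _ _ (outDist_nonneg hF n r) (unifDist_nonneg _ _)
      (sum_outDist hF n r) (sum_unifDist _ _) (δ * msgsProb A n msgs) _ fun i Y =>
        abs_hybrid_step_le A n hF hδ b msgs r hr _ i Y).trans ?_
    rw [add_zero, mul_assoc]
  · obtain ⟨h1, h2⟩ := winWith_mem A n _ (outDist_nonneg hF n r) (sum_outDist hF n r) b msgs r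
    obtain ⟨h3, h4⟩ := winWith_mem A n _ (unifDist_nonneg (q n) (ℓ n))
      (sum_unifDist _ _) b msgs r
    have h5 : 0 ≤ n * δ * msgsProb A n msgs := by positivity
    rw [abs_le]
    constructor <;> linarith

theorem abs_cpaWin_sub_half_le (hF : F.QPT) {δ : ℝ} (h0 : 0 ≤ δ)
    (hδ : ∀ a, hybridGap A n F a ≤ δ) :
    |(ske F).cpaWin A n - 1 / 2| ≤ n * δ + q n * q n * unif (Fin (m n)) := by
  classical
  have hideal : ∑ b : Bool, (1 / 2 : ℝ) * ∑ msgs, ∑ r : Fin (q n) → Bits (Fin (m n)),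
      (∏ _j : Fin (q n), unif (Fin (m n))) * winWith A n (unifDist (q n) (ℓ n)) b msgs r
        = 1 / 2 := by
    rw [← Finset.mul_sum, Finset.sum_comm]
    have : ∀ msgs, ∑ b : Bool, ∑ r : Fin (q n) → Bits (Fin (m n)),
        (∏ _j : Fin (q n), unif (Fin (m n))) * winWith A n (unifDist (q n) (ℓ n)) b msgs r =
        msgsProb A n msgs := by
      intro msgs
      rw [Finset.sum_comm]
      refine (Finset.sum_congr rfl fun r _ => by
        rw [← Finset.mul_sum, sum_winWith_unif]).trans ?_
      rw [← Finset.sum_mul, sum_prod_unif_eq, one_mul]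
    simp_rw [this]
    rw [sum_msgsProb, mul_one]
  have hu : 0 ≤ ∏ _j : Fin (q n), unif (Fin (m n)) :=
    Finset.prod_nonneg fun _ _ => unif_nonneg _
  have hdiff : (ske F).cpaWin A n - 1 / 2 = ∑ b : Bool, (1 / 2 : ℝ) * ∑ msgs,
      ∑ r : Fin (q n) → Bits (Fin (m n)), (∏ _j : Fin (q n), unif (Fin (m n))) *
        (winWith A n (outDist F n r) b msgs r - winWith A n (unifDist (q n) (ℓ n)) b msgs r) := by
    rw [cpaWin_eq]
    conv_lhs => rhs; rw [← hideal]
    rw [← Finset.sum_sub_distrib]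
    refine Finset.sum_congr rfl fun b _ => ?_
    rw [← mul_sub, ← Finset.sum_sub_distrib]
    congr 1
    refine Finset.sum_congr rfl fun msgs _ => ?_
    rw [← Finset.sum_sub_distrib]
    exact Finset.sum_congr rfl fun r _ => (mul_sub _ _ _).symm
  have havg : ∀ v : (Fin (q n) → Bits (Fin (m n))) → ℝ, ∑ _b : Bool, (1 / 2 : ℝ) *
      ∑ msgs, ∑ r, (∏ _j : Fin (q n), unif (Fin (m n))) * (v r * msgsProb A n msgs) =
      ∑ r, (∏ _j : Fin (q n), unif (Fin (m n))) * v r := by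
    intro v
    have : ∑ msgs, ∑ r, (∏ _j : Fin (q n), unif (Fin (m n))) * (v r * msgsProb A n msgs) =
        ∑ r, (∏ _j : Fin (q n), unif (Fin (m n))) * v r := by
      rw [Finset.sum_comm]
      refine Finset.sum_congr rfl fun r _ => ?_
      rw [← Finset.mul_sum, ← Finset.mul_sum, sum_msgsProb, mul_one]
    rw [this, Fintype.sum_bool]
    ring
  rw [hdiff]
  calc _ ≤ ∑ b : Bool, (1 / 2 : ℝ) * ∑ msgs, ∑ r : Fin (q n) → Bits (Fin (m n)),
        (∏ _j : Fin (q n), unif (Fin (m n))) *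
          ((n * δ + if Function.Injective r then 0 else 1) * msgsProb A n msgs) := by
        refine (Finset.abs_sum_le_sum_abs _ _).trans (Finset.sum_le_sum fun b _ => ?_)
        rw [abs_mul, abs_of_pos (by norm_num : (0 : ℝ) < 1 / 2)]
        refine mul_le_mul_of_nonneg_left ?_ (by norm_num)
        refine (Finset.abs_sum_le_sum_abs _ _).trans (Finset.sum_le_sum fun msgs _ => ?_)
        refine (Finset.abs_sum_le_sum_abs _ _).trans (Finset.sum_le_sum fun r _ => ?_)
        rw [abs_mul, abs_of_nonneg hu]
        exact mul_le_mul_of_nonneg_left (abs_winWith_sub_le A n hF h0 hδ b msgs r) hu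
    _ = n * δ + ∑ r : Fin (q n) → Bits (Fin (m n)), (∏ _j : Fin (q n), unif (Fin (m n))) *
          (if Function.Injective r then 0 else 1) := by
        rw [havg fun r => n * δ + if Function.Injective r then 0 else 1]
        simp_rw [mul_add]
        rw [Finset.sum_add_distrib, ← Finset.sum_mul, sum_prod_unif_eq, one_mul]
    _ ≤ _ := by
        have := collision_le (q n) (Fin (m n))
        linarith

theorem ske_secure (hF : F.IsSelectivelySecureQPRF)
    (hm : (fun n : ℕ => Real.log n) =o[atTop] fun n : ℕ => (m n : ℝ)) :
    (ske F).NonAdaptiveCPASecure := by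
  intro q hq A
  obtain ⟨δ, hδ, h0, hle⟩ := exists_hybridGap_le A hF hq
  refine ⟨fun n => n * δ n + (q n * q n : ℕ) * unif (Fin (m n)),
    hδ.natCast_mul.add ((negligible_unif hm).polyBounded_mul (hq.mul hq)), fun n => ?_⟩
  have h := abs_cpaWin_sub_half_le A n hF.qpt (h0 n) (hle n)
  push_cast
  exact h

end Security

end QCrypto

end

theorem mainTheorem8 (m ℓ : ℕ → ℕ) (F : QCrypto.KeyedFun m ℓ)
    (hF : F.IsSelectivelySecureQPRF)
    (hm : (fun n : ℕ => Real.log n) =o[Filter.atTop] fun n : ℕ => (m n : ℝ)) :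
    (QCrypto.ske F).IsNonAdaptiveCPASecureEncryption :=
  ⟨QCrypto.ske_qpt hF.qpt, QCrypto.ske_correct hF.qpt hF.pseudodeterministic,
    QCrypto.ske_secure hF hm⟩
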